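/- Let $X$ be a compact connected Riemann surface, let $\omega_0$ be a Kähler form on $X$, and let $\omega$ be a Kähler form on $X$ with $\int_X\omega=1$ (for example $\omega=c_1(\mathcal L,\mathfrak h)/\deg\mathcal L$ for a holomorphic line bundle $\mathcal L$ of positive degree with a Hermitian metric $\mathfrak h$ of strictly positive curvature). Put $\mathrm{dd^c}=\frac{i}{\pi}\partial\overline\partial$. A function $U:X\to[-\infty,\infty)$ is quasi-subharmonic if it is locally the difference of a subharmonic function and a smooth function. For a probability measure $\mu$ on $X$, let $U_\mu$ be its $\omega$-potential of type M, that is, the unique quasi-subharmonic function on $X$ with $\mu=\omega+\mathrm{dd^c}U_\mu$ in the sense of currents and $\max_X U_\mu=0$. For an open set $D\subset X$, let $\mathcal M(X\setminus D)$ be the set of probability measures supported on $X\setminus D$, and define $$\mathcal I_{D}(\mu):=-\int_X U_\mu\,\omega-\int_X U_\mu\,\mathrm d\mu\in[0,+\infty],\qquad \mu\in\mathcal M(X\setminus D).$$ Fix $x_0\in X$. For $r>0$, let $\mathbb B(x_0,r)$ be the open ball for the Riemannian distance of $\omega_0$. **Proposition.** There exist constants $C>c>0$, independent of $r$, such that for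 every sufficiently small $r>0$ the functional $\mathcal I_{\mathbb B(x_0,r)}$ attains its minimum on $\mathcal M(X\setminus\mathbb B(x_0,r))$ and $$c\,r^4\le\min_{\mathcal M(X\setminus\mathbb B(x_0,r))}\mathcal I_{\mathbb B(x_0,r)}\le C\,r^4 .$$ -/

import Mathlib

open MeasureTheory Set Filter Topology
open scoped Manifold ContDiff ENNReal Laplacian

noncomputable section

/-- The Lebesgue integral of an extended real valued function, `∫ f⁺ - ∫ f⁻`.
It is only used for functions that are bounded above, with respect to finite measures, so that
the first term is finite and the difference lies in `[-∞, ∞)`. -/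
def erealIntegral {α : Type*} [MeasurableSpace α] (μ : Measure α) (f : α → EReal) : EReal :=
  ((∫⁻ x, (f x).toENNReal ∂μ : ℝ≥0∞) : EReal) - ((∫⁻ x, (-f x).toENNReal ∂μ : ℝ≥0∞) : EReal)

/-- Subharmonic functions `u : V → [-∞, ∞)` on an open set `V ⊆ ℂ`: upper semicontinuous
functions with the local submean property
`u z ≤ (1 / 2π) ∫ u (z + r exp (i θ)) dθ` for all small `r > 0`. -/
def SubharmonicOn (u : ℂ → EReal) (V : Set ℂ) : Prop :=
  UpperSemicontinuousOn u V ∧ (∀ z ∈ V, u z ≠ ⊤) ∧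
    ∀ z ∈ V, ∃ ρ > (0 : ℝ), ∀ r : ℝ, 0 < r → r < ρ → Metric.closedBall z r ⊆ V ∧
      ((2 * Real.pi : ℝ) : EReal) * u z ≤
        erealIntegral (volume.restrict (Ioc 0 (2 * Real.pi))) (fun θ ↦ u (circleMap z r θ))

section RiemannSurface

variable (X : Type*) [TopologicalSpace X] [ChartedSpace ℂ X]

/-- A Kähler form on a Riemann surface, that is, a smooth strictly positive real `(1,1)`-form
(closedness is automatic in complex dimension one). In a holomorphic chart `e` with coordinate
`z = x + i y`, the form is `density e z · (i / 2) dz ∧ dz̄ = density e z · dx ∧ dy`; the last field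
is the transformation law of `(1,1)`-forms under the holomorphic change of charts. The values of
`density` at charts outside the atlas and at points outside the target of a chart play no role. -/
structure KahlerForm where
  density : OpenPartialHomeomorph X ℂ → ℂ → ℝ
  contDiffOn : ∀ e ∈ atlas ℂ X, ContDiffOn ℝ ∞ (density e) e.target
  pos : ∀ e ∈ atlas ℂ X, ∀ z ∈ e.target, 0 < density e z
  transform : ∀ e ∈ atlas ℂ X, ∀ e' ∈ atlas ℂ X, ∀ z ∈ (e.symm.trans e').source,
    density e z = density e' (e' (e.symm z)) * ‖deriv (fun w ↦ e' (e.symm w)) z‖ ^ 2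

variable {X}

namespace KahlerForm

/-- The coefficient of the form at the point `x`, in the preferred chart at `x`. -/
def coeffAt (η : KahlerForm X) (x : X) : ℝ := η.density (chartAt ℂ x) (chartAt ℂ x x)

/-- The measure `A ↦ ∫_A η`. On the domain of a chart `e` it is `density e z · dx dy`; the chart
domains cover `X`, so it is the supremum of these measures over all charts of the atlas. -/
def measure [MeasurableSpace X] (η : KahlerForm X) : Measure X :=
  ⨆ e ∈ atlas ℂ X, Measure.map e.symm
    ((volume.restrict e.target).withDensity (fun z ↦ ENNReal.ofReal (η.density e z)))

/-- The norm on the tangent spaces of the Riemannian metric of `η`, which is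
`density e z · (dx² + dy²)` in a chart `e`. -/
@[reducible] def tangentENorm (η : KahlerForm X) (x : X) : ENorm (TangentSpace 𝓘(ℝ, ℂ) x) where
  enorm v := ENNReal.ofReal (Real.sqrt (η.coeffAt x) * ‖(show ℂ from v)‖)

/-- The geodesic distance of the Riemannian metric of `η`: the infimum of the lengths of
`C^1` paths. -/
def edist (η : KahlerForm X) (x y : X) : ℝ≥0∞ :=
  letI : ∀ z : X, ENorm (TangentSpace 𝓘(ℝ, ℂ) z) := η.tangentENorm
  Manifold.riemannianEDist 𝓘(ℝ, ℂ) x y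

/-- The open ball `B(x, r)` for the geodesic distance of `η`. -/
def ball (η : KahlerForm X) (x : X) (r : ℝ) : Set X := {y | η.edist x y < ENNReal.ofReal r}

/-- The function `(dd^c φ) / η`, that is, `dd^c φ = (η.ddc φ) · η`. Here
`dd^c = (i / π) ∂∂̄`, which is `(1 / 2π) (∂²/∂x² + ∂²/∂y²) φ · dx ∧ dy` in a chart. -/
def ddc (η : KahlerForm X) (φ : X → ℝ) (x : X) : ℝ :=
  (2 * Real.pi)⁻¹ * (Δ (fun z : ℂ ↦ φ ((chartAt ℂ x).symm z))) (chartAt ℂ x x) / η.coeffAt x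

end KahlerForm

/-- Quasi-subharmonic functions `U : X → [-∞, ∞)`: in a chart around each point, `U` is the
difference of a subharmonic function and a smooth function `p`. -/
def QuasiSubharmonic (U : X → EReal) : Prop :=
  ∀ x : X, ∃ V : Set ℂ, IsOpen V ∧ chartAt ℂ x x ∈ V ∧ V ⊆ (chartAt ℂ x).target ∧
    ∃ p : ℂ → ℝ, ContDiffOn ℝ ∞ p V ∧
      SubharmonicOn (fun z ↦ U ((chartAt ℂ x).symm z) + (p z : EReal)) V

variable [MeasurableSpace X]

/-- `U` is the `η`-potential of type M of `μ`: a quasi-subharmonic function in `L¹` such that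
`μ = η + dd^c U` in the sense of currents and `max U = 0`. -/
structure IsPotentialM (η : KahlerForm X) (μ : Measure X) (U : X → EReal) : Prop where
  quasiSubharmonic : QuasiSubharmonic U
  ae_ne_bot : ∀ᵐ x ∂η.measure, U x ≠ ⊥
  integrable : Integrable (fun x ↦ (U x).toReal) η.measure
  current_eq : ∀ φ : X → ℝ, ContMDiff 𝓘(ℝ, ℂ) 𝓘(ℝ, ℝ) ∞ φ →
    ∫ x, φ x ∂μ = ∫ x, φ x ∂η.measure + ∫ x, (U x).toReal * η.ddc φ x ∂η.measure
  isGreatest : IsGreatest (range U) 0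

/-- The functional `I_η (μ) = - ∫ U_μ η - ∫ U_μ dμ`, where `U_μ` is the `η`-potential of type M
of `μ`. A probability measure on a compact connected Riemann surface with `∫ η = 1` has exactly
one such potential, so that the infimum below runs over a single function. -/
def holeFunctional (η : KahlerForm X) (μ : Measure X) : EReal :=
  ⨅ (U : X → EReal) (_ : IsPotentialM η μ U), -erealIntegral η.measure U - erealIntegral μ U

/-- The probability measures supported on `X \ D`, for an open set `D`. -/
def measuresOff (D : Set X) : Set (Measure X) := {μ | IsProbabilityMeasure μ ∧ μ D = 0}

end RiemannSurface

end

/-!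
A current `μ = η + dd^c U` with `U ≤ 0` is recorded by the pair of measures `(μ, ν)`, where
`ν = -U η` (`IsCurrentPair`, `negMeasure`). Such pairs are closed under weak convergence, and the
potential can be recovered from its pair: testing the current against `logKernel ⋆ g`, with a
truncated logarithmic kernel, shows that in a coordinate disc `ν` has the density `-P` with respect
to `η`, where `P` is a smooth function minus the logarithmic potential of `μ`
(`restrict_eq_withDensity_canonicalPotential`). The function `P` is quasi-subharmonic in every
holomorphic coordinate because logarithms of moduli of holomorphic functions are subharmonic
(`exists_subharmonicOn_canonicalPotential`), and quasi-subharmonic functions that agree almost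
everywhere agree (`SubharmonicOn.le_of_ae_le`). Hence a potential of type M is given in each
coordinate disc by the formula for `P` (`IsPotentialM.eq_localPotential`), and a pair `(μ, ν)` comes
from a potential of type M as soon as the function defined by these formulas has a zero
(`IsCurrentPair.isPotentialM`).

Existence of a minimizer (`exists_isLeast_energySet`) is the direct method. Along a minimizing
sequence, the measures `μ`, the measures `ν`, and the points where the potentials vanish have
limits, by compactness. The formula for `P` shows that potentials are upper semicontinuous jointly
in the pair and the point (`eventually_lt_neg_localPotential`): the smooth part converges and the
logarithmic potential is lower semicontinuous. So the limit potential vanishes at the limit point,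
and a form of Fatou's lemma for weakly convergent measures (`lintegral_le_liminf_of_tendsto`) gives
the lower semicontinuity of the functional. A limit of measures that do not charge the open set `D`
does not charge `D`.

The bounds are consequences of scaling. A geodesic ball of radius `r` lies between coordinate discs
of radii comparable to `r` (`exists_geodesicBall_comparison`). If `μ` does not charge a disc of
radius `s`, testing the current against a bump function `φ` at scale `s` gives
`∫ φ η = -∫ U dd^c φ`. The left side is of order `s ^ 2` and `dd^c φ / η` is of order `s ^ (-2)`, so
`-∫ U η` is at least of order `s ^ 4` (`exists_le_of_mem_energySet`). For the upper bound, it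
suffices to give one measure with such an energy. A function `W ≤ 0` of the form
`(logKernel - M b) ⋆ g`, where `g` agrees with the density of `η` on a small disc and `b` is a bump
function, sweeps the mass of this disc to an annulus (`exists_planar_balayage`). Rescaled to the
disc of radius `r`, it is a potential of size `r ^ 2` supported on a set of area `r ^ 2`, so that
the energy is of order `r ^ 4` (`exists_mem_energySet_le`).
-/

/-! ### The Laplacian on the plane -/

theorem laplacian_eq_fderiv_fderiv {f : ℂ → ℝ} {x : ℂ} :
    Δ f x = fderiv ℝ (fderiv ℝ f) x 1 1 + fderiv ℝ (fderiv ℝ f) x Complex.I Complex.I := by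
  rw [InnerProductSpace.laplacian_eq_iteratedFDeriv_complexPlane]
  simp [iteratedFDeriv_two_apply]

theorem laplacian_eq_directional {f : ℂ → ℝ} {x : ℂ} (hf : ContDiffAt ℝ 2 f x) :
    Δ f x = fderiv ℝ (fun y ↦ fderiv ℝ f y 1) x 1
      + fderiv ℝ (fun y ↦ fderiv ℝ f y Complex.I) x Complex.I := by
  have h : DifferentiableAt ℝ (fderiv ℝ f) x :=
    (hf.fderiv_right (m := 1) (by norm_num)).differentiableAt (by norm_num)
  rw [laplacian_eq_fderiv_fderiv, fderiv_clm_apply h (differentiableAt_const _),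
    fderiv_clm_apply h (differentiableAt_const _)]
  simp

theorem ContDiff.fderiv_apply_const {f : ℂ → ℝ} (hf : ContDiff ℝ ∞ f) (v : ℂ) :
    ContDiff ℝ ∞ (fun y ↦ fderiv ℝ f y v) :=
  (hf.fderiv_right (m := ∞) (by simp)).clm_apply contDiff_const

theorem ContDiff.contDiff_laplacian {f : ℂ → ℝ} (hf : ContDiff ℝ ∞ f) : ContDiff ℝ ∞ (Δ f) := by
  have : Δ f = fun x ↦ fderiv ℝ (fun y ↦ fderiv ℝ f y 1) x 1
      + fderiv ℝ (fun y ↦ fderiv ℝ f y Complex.I) x Complex.I := by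
    ext x
    exact laplacian_eq_directional (contDiff_infty.1 hf 2).contDiffAt
  rw [this]
  exact ((hf.fderiv_apply_const 1).fderiv_apply_const 1).add
    ((hf.fderiv_apply_const _).fderiv_apply_const _)

theorem tsupport_laplacian_subset (f : ℂ → ℝ) : tsupport (Δ f) ⊆ tsupport f := by
  refine closure_minimal (fun x hx ↦ ?_) isClosed_closure
  by_contra h
  have h0 : f =ᶠ[𝓝 x] fun _ ↦ (0 : ℝ) := notMem_tsupport_iff_eventuallyEq.mp h
  have := (InnerProductSpace.laplacian_congr_nhds h0).self_of_nhds
  rw [Function.mem_support] at hx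
  apply hx
  rw [this, laplacian_eq_fderiv_fderiv]
  simp

theorem HasCompactSupport.laplacian {f : ℂ → ℝ} (hf : HasCompactSupport f) :
    HasCompactSupport (Δ f) :=
  hf.of_isClosed_subset isClosed_closure (tsupport_laplacian_subset f)

/-- Conformal covariance of the Laplacian: the terms with the second derivative of `T` cancel,
since `1 ^ 2 + I ^ 2 = 0`. -/
theorem laplacian_comp_analyticAt {h : ℂ → ℝ} {T : ℂ → ℂ} {z : ℂ} (hT : AnalyticAt ℂ T z)
    (hh : ContDiffAt ℝ 2 h (T z)) :
    Δ (fun w ↦ h (T w)) z = ‖deriv T z‖ ^ 2 * Δ h (T z) := by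
  have hTe : ∀ᶠ w in 𝓝 z, DifferentiableAt ℂ T w :=
    hT.eventually_analyticAt.mono fun w hw ↦ hw.differentiableAt
  have hhe : ∀ᶠ w in 𝓝 z, DifferentiableAt ℝ h (T w) := by
    have := hT.continuousAt.eventually (hh.eventually (by simp))
    exact this.mono fun w hw ↦ hw.differentiableAt (by norm_num)
  have hTR : ContDiffAt ℝ 2 T z := (hT.contDiffAt (n := 2)).restrict_scalars ℝ
  have hd : DifferentiableAt ℝ (fderiv ℝ h) (T z) :=
    (hh.fderiv_right (m := 1) (by norm_num)).differentiableAt (by norm_num)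
  have hT1 :
      HasFDerivAt T ((ContinuousLinearMap.toSpanSingleton ℂ (deriv T z)).restrictScalars ℝ) z :=
    hT.differentiableAt.hasDerivAt.hasFDerivAt.restrictScalars ℝ
  have hT2 : HasFDerivAt (deriv T)
      ((ContinuousLinearMap.toSpanSingleton ℂ (deriv (deriv T) z)).restrictScalars ℝ) z :=
    hT.deriv.differentiableAt.hasDerivAt.hasFDerivAt.restrictScalars ℝ
  have key (v : ℂ) : fderiv ℝ (fun y ↦ fderiv ℝ (fun w ↦ h (T w)) y v) z v
      = fderiv ℝ (fderiv ℝ h) (T z) (v * deriv T z) (v * deriv T z)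
        + fderiv ℝ h (T z) (v * deriv (deriv T) z * v) := by
    have h1 : (fun y ↦ fderiv ℝ (fun w ↦ h (T w)) y v) =ᶠ[𝓝 z]
        fun y ↦ fderiv ℝ h (T y) (v * deriv T y) := by
      filter_upwards [hTe, hhe] with y hy hy'
      have h2 : HasFDerivAt T
          ((ContinuousLinearMap.toSpanSingleton ℂ (deriv T y)).restrictScalars ℝ) y :=
        hy.hasDerivAt.hasFDerivAt.restrictScalars ℝ
      have h3 : HasFDerivAt (fun w ↦ h (T w)) _ y := hy'.hasFDerivAt.comp y h2
      rw [h3.fderiv]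
      simp
    have h3 : HasFDerivAt (fun y ↦ fderiv ℝ h (T y)) _ z := hd.hasFDerivAt.comp z hT1
    have h4 := h3.clm_apply (hT2.const_mul v)
    rw [h1.fderiv_eq, h4.fderiv]
    simp [mul_assoc, add_comm, mul_comm (deriv (deriv T) z) v]
  have hcomp : ContDiffAt ℝ 2 (fun w ↦ h (T w)) z := hh.comp z hTR
  rw [laplacian_eq_directional hcomp, key, key, laplacian_eq_fderiv_fderiv]
  set B := fderiv ℝ (fderiv ℝ h) (T z)
  set a := deriv T z
  set D := fderiv ℝ h (T z)
  have e1 : (1 : ℂ) * a = a.re • (1 : ℂ) + a.im • Complex.I := by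
    apply Complex.ext <;> simp
  have e2 : Complex.I * a = (-a.im) • (1 : ℂ) + a.re • Complex.I := by
    apply Complex.ext <;> simp
  have e3 : Complex.I * deriv (deriv T) z * Complex.I = - (1 * deriv (deriv T) z * 1) := by
    linear_combination (deriv (deriv T) z) * Complex.I_mul_I
  rw [e3, map_neg, e1, e2, Complex.sq_norm, Complex.normSq_apply]
  simp only [map_add, map_smul, add_apply, smul_apply, smul_eq_mul]
  ring

theorem laplacian_comp_add_mul {h : ℂ → ℝ} (hh : ContDiff ℝ ∞ h) (a c z : ℂ) :
    Δ (fun w ↦ h (a + c * w)) z = ‖c‖ ^ 2 * Δ h (a + c * z) := by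
  have h1 : AnalyticAt ℂ (fun w ↦ a + c * w) z := by fun_prop
  have h2 := laplacian_comp_analyticAt (h := h) h1
    (contDiff_infty.1 hh 2).contDiffAt
  rw [h2]
  congr 3
  simp

/-- Green's second identity for a smooth function and a test function. -/
theorem integral_mul_laplacian {f g : ℂ → ℝ} (hf : ContDiff ℝ ∞ f) (hg : ContDiff ℝ ∞ g)
    (hgc : HasCompactSupport g) : ∫ x, f x * Δ g x = ∫ x, Δ f x * g x := by
  have hf2 : ∀ x, ContDiffAt ℝ 2 f x := fun x ↦ (contDiff_infty.1 hf 2).contDiffAt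
  have hg2 : ∀ x, ContDiffAt ℝ 2 g x := fun x ↦ (contDiff_infty.1 hg 2).contDiffAt
  have cs1 (v : ℂ) : HasCompactSupport (fun y ↦ fderiv ℝ g y v) := hgc.fderiv_apply ℝ v
  have cs2 (v : ℂ) : HasCompactSupport (fun y ↦ fderiv ℝ (fun w ↦ fderiv ℝ g w v) y v) :=
    (cs1 v).fderiv_apply ℝ v
  have ifg {a b : ℂ → ℝ} (ha : ContDiff ℝ ∞ a) (hb : ContDiff ℝ ∞ b) (hbc : HasCompactSupport b) :
      Integrable (fun x ↦ a x * b x) :=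
    (ha.continuous.mul hb.continuous).integrable_of_hasCompactSupport hbc.mul_left
  have key (v : ℂ) : ∫ x, f x * fderiv ℝ (fun w ↦ fderiv ℝ g w v) x v
      = ∫ x, fderiv ℝ (fun w ↦ fderiv ℝ f w v) x v * g x := by
    have f1 := hf.fderiv_apply_const v
    have g1 := hg.fderiv_apply_const v
    rw [integral_mul_fderiv_eq_neg_fderiv_mul_of_integrable (ifg f1 g1 (cs1 v))
      (ifg hf (g1.fderiv_apply_const v) (cs2 v)) (ifg hf g1 (cs1 v))
      (fun x _ ↦ (hf.differentiable (by simp)) x) (fun x _ ↦ (g1.differentiable (by simp)) x),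
      integral_mul_fderiv_eq_neg_fderiv_mul_of_integrable (f := fun w ↦ fderiv ℝ f w v)
      (ifg (f1.fderiv_apply_const v) hg hgc)
      (ifg f1 g1 (cs1 v)) (ifg f1 hg hgc)
      (fun x _ ↦ (f1.differentiable (by simp)) x) (fun x _ ↦ (hg.differentiable (by simp)) x),
      neg_neg]
  simp_rw [fun x ↦ laplacian_eq_directional (hf2 x), fun x ↦ laplacian_eq_directional (hg2 x),
    mul_add, add_mul]
  rw [integral_add, integral_add, key, key]
  · exact ifg ((hf.fderiv_apply_const _).fderiv_apply_const _) hg hgc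
  · exact ifg ((hf.fderiv_apply_const _).fderiv_apply_const _) hg hgc
  · exact ifg hf ((hg.fderiv_apply_const _).fderiv_apply_const _) (cs2 _)
  · exact ifg hf ((hg.fderiv_apply_const _).fderiv_apply_const _) (cs2 _)

/-! ### The logarithm as fundamental solution of the Laplacian -/

theorem integrableOn_log_norm_ball (R : ℝ) :
    IntegrableOn (fun z : ℂ ↦ Real.log ‖z‖) (Metric.ball 0 R) := by
  have h : Integrable (fun z : ℂ ↦ (Iio R).indicator Real.log ‖z‖) := by
    rw [integrable_fun_norm_addHaar volume (f := (Iio R).indicator Real.log)]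
    have : (fun y : ℝ ↦ y ^ (Module.finrank ℝ ℂ - 1) • (Iio R).indicator Real.log y)
        = (Iio R).indicator (fun y ↦ y * Real.log y) := by
      ext y
      by_cases hy : y < R <;> simp [hy]
    rw [this, integrableOn_indicator_iff measurableSet_Iio]
    refine (Real.continuous_mul_log.integrableOn_Icc (a := 0) (b := R)).mono_set ?_
    rintro y ⟨h1, h2⟩
    exact ⟨le_of_lt h2, le_of_lt h1⟩
  refine (h.integrableOn (s := Metric.ball 0 R)).congr_fun (fun z hz ↦ ?_) measurableSet_ball
  have : ‖z‖ < R := by simpa using hz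
  simp [this]

theorem locallyIntegrable_log_norm : LocallyIntegrable (fun z : ℂ ↦ Real.log ‖z‖) := by
  intro x
  refine ⟨Metric.ball 0 (‖x‖ + 1), Metric.isOpen_ball.mem_nhds (by simp), ?_⟩
  exact integrableOn_log_norm_ball _

/-- The total mass of `Δ (regLog 1)`. -/
theorem integral_two_div_one_add_norm_sq_sq :
    ∫ z : ℂ, 2 / (1 + ‖z‖ ^ 2) ^ 2 = 2 * Real.pi := by
  have h := integral_fun_norm_addHaar (volume : Measure ℂ) (fun r ↦ 2 / (1 + r ^ 2) ^ 2)
  have h2 : ∫ y in Ioi (0 : ℝ), y * (2 / (1 + y ^ 2) ^ 2) = 0 - (-1 / (1 + 0 ^ 2)) := by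
    refine integral_Ioi_of_hasDerivAt_of_nonneg' (g := fun y ↦ -1 / (1 + y ^ 2)) (fun x _ ↦ ?_)
      (fun x hx ↦ ?_) ?_
    · have hx : (1 + x ^ 2) ≠ 0 := by positivity
      have := ((((hasDerivAt_id x).pow 2).const_add 1).inv hx).neg
      refine (this.congr_deriv ?_).congr_of_eventuallyEq (Eventually.of_forall fun y ↦ ?_)
      · simp; field_simp
      · simp [neg_div]
    · have : (0 : ℝ) < x := hx
      positivity
    · refine Tendsto.div_atTop tendsto_const_nhds (tendsto_atTop_add_const_left _ _ ?_)
      exact tendsto_pow_atTop (by norm_num)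
  rw [h]
  simp only [Complex.finrank_real_complex, Nat.add_one_sub_one, pow_one, smul_eq_mul, h2]
  simp [Measure.real, Complex.volume_ball]

theorem integrable_two_div_one_add_norm_sq_sq :
    Integrable (fun z : ℂ ↦ 2 / (1 + ‖z‖ ^ 2) ^ 2) := by
  by_contra h
  have h1 := integral_two_div_one_add_norm_sq_sq
  rw [integral_undef h] at h1
  linarith [Real.pi_pos]

/-- The smooth regularisation `log √(|z|² + ε²)` of `log |z|`. -/
noncomputable def regLog (ε : ℝ) (z : ℂ) : ℝ := 2⁻¹ * Real.log (z.re ^ 2 + z.im ^ 2 + ε ^ 2)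

theorem regLog_eq (ε : ℝ) (z : ℂ) : regLog ε z = 2⁻¹ * Real.log (‖z‖ ^ 2 + ε ^ 2) := by
  rw [regLog, Complex.sq_norm, Complex.normSq_apply]
  ring_nf

theorem contDiff_regLog {ε : ℝ} (hε : 0 < ε) : ContDiff ℝ ∞ (regLog ε) := by
  refine contDiff_const.mul (ContDiff.log ?_ fun z ↦ by positivity)
  exact ((Complex.reCLM.contDiff.pow 2).add (Complex.imCLM.contDiff.pow 2)).add contDiff_const

theorem laplacian_regLog {ε : ℝ} (hε : 0 < ε) (z : ℂ) :
    Δ (regLog ε) z = 2 * ε ^ 2 / (‖z‖ ^ 2 + ε ^ 2) ^ 2 := by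
  have hre (z : ℂ) : HasFDerivAt (fun w : ℂ ↦ w.re) Complex.reCLM z := Complex.reCLM.hasFDerivAt
  have him (z : ℂ) : HasFDerivAt (fun w : ℂ ↦ w.im) Complex.imCLM z := Complex.imCLM.hasFDerivAt
  have hq (z : ℂ) := ((((hre z).pow 2).add ((him z).pow 2)).add_const (ε ^ 2))
  have q0 (z : ℂ) : z.re ^ 2 + z.im ^ 2 + ε ^ 2 ≠ 0 := by positivity
  have hL (z : ℂ) : HasFDerivAt (regLog ε) _ z := ((hq z).log (q0 z)).const_mul 2⁻¹
  have h1 : (fun y ↦ fderiv ℝ (regLog ε) y 1) =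
      fun y ↦ y.re * (y.re ^ 2 + y.im ^ 2 + ε ^ 2)⁻¹ := by
    ext y
    rw [(hL y).fderiv]
    simp
    ring
  have hI : (fun y ↦ fderiv ℝ (regLog ε) y Complex.I) =
      fun y ↦ y.im * (y.re ^ 2 + y.im ^ 2 + ε ^ 2)⁻¹ := by
    ext y
    rw [(hL y).fderiv]
    simp
    ring
  have hinv := (hasDerivAt_inv (q0 z)).comp_hasFDerivAt z (hq z)
  have h1' := (hre z).mul hinv
  have hI' := (him z).mul hinv
  rw [laplacian_eq_directional ((contDiff_infty.1 (contDiff_regLog hε) 2).contDiffAt), h1, hI]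
  have e1 : fderiv ℝ (fun y : ℂ ↦ y.re * (y.re ^ 2 + y.im ^ 2 + ε ^ 2)⁻¹) z = _ := h1'.fderiv
  have e2 : fderiv ℝ (fun y : ℂ ↦ y.im * (y.re ^ 2 + y.im ^ 2 + ε ^ 2)⁻¹) z = _ := hI'.fderiv
  rw [e1, e2, Complex.sq_norm, Complex.normSq_apply]
  have := q0 z
  have h3 : z.re * z.re + z.im * z.im + ε ^ 2 ≠ 0 := by
    rw [← pow_two, ← pow_two]; exact this
  simp
  field_simp
  ring

theorem norm_regLog_le {ε : ℝ} (hε : 0 < ε) (hε1 : ε ≤ 1) {z : ℂ} (hz : z ≠ 0) :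
    |regLog ε z| ≤ |Real.log ‖z‖| + Real.log (‖z‖ ^ 2 + 1) := by
  have hz' : 0 < ‖z‖ := norm_pos_iff.mpr hz
  have h1 : Real.log ‖z‖ ≤ regLog ε z := by
    rw [regLog_eq]
    have : Real.log (‖z‖ ^ 2) ≤ Real.log (‖z‖ ^ 2 + ε ^ 2) :=
      Real.log_le_log (by positivity) (by nlinarith)
    rw [Real.log_pow] at this
    push_cast at this
    linarith
  have h2 : regLog ε z ≤ 2⁻¹ * Real.log (‖z‖ ^ 2 + 1) := by
    rw [regLog_eq]
    gcongr
    nlinarith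
  have h3 : 0 ≤ Real.log (‖z‖ ^ 2 + 1) := Real.log_nonneg (by nlinarith)
  rw [abs_le]
  constructor
  · linarith [neg_abs_le (Real.log ‖z‖)]
  · linarith [abs_nonneg (Real.log ‖z‖)]

/-- `log |z|` is `2π` times the fundamental solution of the Laplacian. -/
theorem integral_log_norm_mul_laplacian {g : ℂ → ℝ} (hg : ContDiff ℝ ∞ g)
    (hgc : HasCompactSupport g) :
    ∫ z : ℂ, Real.log ‖z‖ * Δ g z = 2 * Real.pi * g 0 := by
  -- Regularize the logarithm by `regLog ε` and let `ε → 0`.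
  set ε : ℕ → ℝ := fun n ↦ 1 / ((n : ℝ) + 1) with hε
  have hε0 (n : ℕ) : 0 < ε n := Nat.one_div_pos_of_nat
  have hε1 (n : ℕ) : ε n ≤ 1 := by
    rw [hε]
    simp only
    rw [div_le_one (by positivity)]
    linarith [(Nat.cast_nonneg n : (0 : ℝ) ≤ n)]
  have hεt : Tendsto ε atTop (𝓝 0) := tendsto_one_div_add_atTop_nhds_zero_nat
  have hLc := hg.contDiff_laplacian.continuous
  have hLs := hgc.laplacian
  have h1 : Tendsto (fun n ↦ ∫ z, regLog (ε n) z * Δ g z) atTop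
      (𝓝 (∫ z : ℂ, Real.log ‖z‖ * Δ g z)) := by
    refine tendsto_integral_of_dominated_convergence
      (fun z ↦ (|Real.log ‖z‖| + Real.log (‖z‖ ^ 2 + 1)) * |Δ g z|) (fun n ↦ ?_) ?_ (fun n ↦ ?_) ?_
    · exact ((contDiff_regLog (hε0 n)).continuous.mul hLc).aestronglyMeasurable
    · have : LocallyIntegrable (fun z : ℂ ↦ |Real.log ‖z‖| + Real.log (‖z‖ ^ 2 + 1)) := by
        have h0 : LocallyIntegrable (fun z : ℂ ↦ |Real.log ‖z‖|) := by
          intro x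
          obtain ⟨s, hs, h⟩ := locallyIntegrable_log_norm x
          exact ⟨s, hs, h.norm⟩
        refine LocallyIntegrable.add h0 (Continuous.locallyIntegrable ?_)
        exact Continuous.log (by fun_prop) fun z ↦ by positivity
      have h2 := this.integrable_smul_right_of_hasCompactSupport hLc.abs
        (hLs.comp_left (g := fun t : ℝ ↦ |t|) (by simp))
      simpa using h2
    · filter_upwards [compl_mem_ae_iff.mpr (measure_singleton (0 : ℂ))] with z hz
      rw [norm_mul, Real.norm_eq_abs, Real.norm_eq_abs]
      gcongr
      exact norm_regLog_le (hε0 n) (hε1 n) hz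
    · filter_upwards [compl_mem_ae_iff.mpr (measure_singleton (0 : ℂ))] with z hz
      have hz' : 0 < ‖z‖ := norm_pos_iff.mpr hz
      refine Tendsto.mul_const _ ?_
      simp_rw [regLog_eq]
      have : Tendsto (fun n ↦ 2⁻¹ * Real.log (‖z‖ ^ 2 + ε n ^ 2)) atTop
          (𝓝 (2⁻¹ * Real.log (‖z‖ ^ 2 + 0 ^ 2))) := by
        refine Tendsto.const_mul _ (Tendsto.log (tendsto_const_nhds.add (hεt.pow 2)) ?_)
        positivity
      convert this using 2
      simp
  have h2 : Tendsto (fun n ↦ ∫ z, regLog (ε n) z * Δ g z) atTop (𝓝 (2 * Real.pi * g 0)) := by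
    -- Green's identity and the substitution `z = ε w`: the Laplacian of `regLog ε` is an
    -- approximate identity of mass `2 π`.
    have e (n : ℕ) : ∫ z, regLog (ε n) z * Δ g z
        = ∫ w : ℂ, 2 / (1 + ‖w‖ ^ 2) ^ 2 * g (ε n • w) := by
      rw [integral_mul_laplacian (contDiff_regLog (hε0 n)) hg hgc]
      have := Measure.integral_comp_smul (volume : Measure ℂ)
        (fun z ↦ Δ (regLog (ε n)) z * g z) (ε n)
      rw [Complex.finrank_real_complex, abs_of_pos (by have := hε0 n; positivity)] at this
      have h3 : ∫ z, Δ (regLog (ε n)) z * g z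
          = ∫ w, ε n ^ 2 * (Δ (regLog (ε n)) (ε n • w) * g (ε n • w)) := by
        rw [integral_const_mul, this, smul_eq_mul, ← mul_assoc, mul_inv_cancel₀, one_mul]
        have := (hε0 n).ne'
        positivity
      rw [h3]
      congr 1
      ext w
      rw [laplacian_regLog (hε0 n), norm_smul, Real.norm_of_nonneg (hε0 n).le, ← mul_assoc]
      congr 1
      have := (hε0 n).ne'
      field_simp
      ring
    simp_rw [e]
    rw [← integral_two_div_one_add_norm_sq_sq, ← integral_mul_const]
    obtain ⟨C, hC⟩ := hgc.exists_bound_of_continuous hg.continuous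
    refine tendsto_integral_of_dominated_convergence
      (fun w ↦ 2 / (1 + ‖w‖ ^ 2) ^ 2 * C) (fun n ↦ ?_) ?_ (fun n ↦ ?_) ?_
    · refine (Continuous.mul ?_ (hg.continuous.comp (by fun_prop))).aestronglyMeasurable
      exact continuous_const.div (by fun_prop) fun w ↦ by positivity
    · exact integrable_two_div_one_add_norm_sq_sq.mul_const _
    · refine Eventually.of_forall fun w ↦ ?_
      rw [norm_mul, Real.norm_of_nonneg (by positivity)]
      gcongr
      exact hC _
    · refine Eventually.of_forall fun w ↦ Tendsto.const_mul _ ?_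
      have : Tendsto (fun n ↦ ε n • w) atTop (𝓝 0) := by
        simpa using hεt.smul_const w
      exact (hg.continuous.tendsto 0).comp this
  exact tendsto_nhds_unique h1 h2

/-! ### Convolutions on the plane -/

/-- The convolution `k ⋆ g` of two functions on the plane. -/
noncomputable def planeConv (k g : ℂ → ℝ) (x : ℂ) : ℝ := ∫ t, k t * g (x - t)

/-- The convolution `g ⋆ ν` of a function with a measure. -/
noncomputable def convMeasure (g : ℂ → ℝ) (ν : Measure ℂ) (x : ℂ) : ℝ := ∫ t, g (x - t) ∂ν

theorem planeConv_eq_convolution (k g : ℂ → ℝ) :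
    planeConv k g = convolution k g (ContinuousLinearMap.mul ℝ ℝ) volume := rfl

theorem convMeasure_eq_convolution (g : ℂ → ℝ) (ν : Measure ℂ) :
    convMeasure g ν = convolution (fun _ ↦ (1 : ℝ)) g (ContinuousLinearMap.mul ℝ ℝ) ν := by
  ext x
  simp [convMeasure, convolution_def]

theorem planeConv_comm (k g : ℂ → ℝ) : planeConv k g = planeConv g k := by
  ext x
  rw [planeConv, planeConv, ← integral_sub_left_eq_self _ volume x]
  simp [mul_comm]

theorem contDiff_planeConv {k g : ℂ → ℝ} (hk : LocallyIntegrable k) (hg : ContDiff ℝ ∞ g)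
    (hgc : HasCompactSupport g) : ContDiff ℝ ∞ (planeConv k g) := by
  rw [planeConv_eq_convolution]
  exact hgc.contDiff_convolution_right _ hk hg

theorem contDiff_convMeasure {g : ℂ → ℝ} {ν : Measure ℂ} [IsFiniteMeasure ν]
    (hg : ContDiff ℝ ∞ g) (hgc : HasCompactSupport g) : ContDiff ℝ ∞ (convMeasure g ν) := by
  rw [convMeasure_eq_convolution]
  exact hgc.contDiff_convolution_right _ (locallyIntegrable_const 1) hg

theorem fderiv_planeConv {k g : ℂ → ℝ} (hk : LocallyIntegrable k) (hg : ContDiff ℝ ∞ g)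
    (hgc : HasCompactSupport g) (v : ℂ) :
    (fun x ↦ fderiv ℝ (planeConv k g) x v) = planeConv k (fun x ↦ fderiv ℝ g x v) := by
  ext x
  rw [planeConv_eq_convolution,
    (hgc.hasFDerivAt_convolution_right _ hk (contDiff_infty.1 hg 1) x).fderiv,
    convolution_precompR_apply _ hk (hgc.fderiv ℝ) (hg.continuous_fderiv (by simp))]
  rfl

theorem integrable_mul_comp_sub {k g : ℂ → ℝ} (hk : LocallyIntegrable k) (hg : Continuous g)
    (hgc : HasCompactSupport g) (x : ℂ) : Integrable (fun t ↦ k t * g (x - t)) := by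
  have h1 : HasCompactSupport (fun t ↦ g (x - t)) :=
    hgc.comp_homeomorph (Homeomorph.subLeft x)
  have h2 := hk.integrable_smul_right_of_hasCompactSupport
    (hg.comp (continuous_const.sub continuous_id) : Continuous (fun t ↦ g (x - t))) h1
  simpa using h2

theorem laplacian_planeConv {k g : ℂ → ℝ} (hk : LocallyIntegrable k) (hg : ContDiff ℝ ∞ g)
    (hgc : HasCompactSupport g) : Δ (planeConv k g) = planeConv k (Δ g) := by
  have hs := contDiff_planeConv hk hg hgc
  have cs (v : ℂ) : HasCompactSupport (fun y ↦ fderiv ℝ g y v) := hgc.fderiv_apply ℝ v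
  have cs2 (v : ℂ) : HasCompactSupport (fun y ↦ fderiv ℝ (fun w ↦ fderiv ℝ g w v) y v) :=
    (cs v).fderiv_apply ℝ v
  have sm (v : ℂ) := (hg.fderiv_apply_const v)
  have sm2 (v : ℂ) := ((hg.fderiv_apply_const v).fderiv_apply_const v)
  ext x
  rw [laplacian_eq_directional (contDiff_infty.1 hs 2).contDiffAt, fderiv_planeConv hk hg hgc,
    fderiv_planeConv hk hg hgc]
  have e (v : ℂ) := congrFun (fderiv_planeConv hk (sm v) (cs v) v) x
  rw [e, e]
  unfold planeConv
  rw [← integral_add (integrable_mul_comp_sub hk (sm2 _).continuous (cs2 _) x)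
    (integrable_mul_comp_sub hk (sm2 _).continuous (cs2 _) x)]
  congr 1
  ext t
  rw [laplacian_eq_directional (contDiff_infty.1 hg 2).contDiffAt, mul_add]

open scoped Pointwise in
theorem tsupport_planeConv_subset {k g : ℂ → ℝ} {r : ℝ} (hk : Function.support k ⊆ Metric.ball 0 r)
    {z : ℂ} {δ : ℝ} (hgc : HasCompactSupport g) (hg : tsupport g ⊆ Metric.ball z δ) :
    HasCompactSupport (planeConv k g) ∧
      tsupport (planeConv k g) ⊆ Metric.ball z (δ + r) := by
  have h1 : Function.support (planeConv k g) ⊆ tsupport g + Metric.closedBall 0 r := by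
    rw [planeConv_eq_convolution]
    refine (support_convolution_subset_swap _).trans (add_subset_add subset_closure ?_)
    exact hk.trans Metric.ball_subset_closedBall
  have hcomp : IsCompact (tsupport g + Metric.closedBall (0 : ℂ) r) :=
    hgc.isCompact.add (isCompact_closedBall _ _)
  have h2 : tsupport (planeConv k g) ⊆ tsupport g + Metric.closedBall 0 r :=
    closure_minimal h1 hcomp.isClosed
  refine ⟨hcomp.of_isClosed_subset isClosed_closure h2, h2.trans ?_⟩
  rintro _ ⟨a, ha, b, hb, rfl⟩
  have h3 : dist a z < δ := hg ha
  have h4 : ‖b‖ ≤ r := by simpa using hb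
  rw [Metric.mem_ball, dist_eq_norm]
  rw [dist_eq_norm] at h3
  calc ‖a + b - z‖ = ‖(a - z) + b‖ := by ring_nf
    _ ≤ ‖a - z‖ + ‖b‖ := norm_add_le _ _
    _ < δ + r := by linarith

/-- Fubini for `∫ (k ⋆ g) dν`, for an even kernel `k`. -/
theorem integral_planeConv {k g : ℂ → ℝ} (hk : Integrable k) (hkeven : ∀ z, k (-z) = k z)
    {C : ℝ} (hg : Continuous g) (hC : ∀ x, ‖g x‖ ≤ C) (ν : Measure ℂ) [IsFiniteMeasure ν] :
    ∫ x, planeConv k g x ∂ν = ∫ y, g y * convMeasure k ν y := by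
  have h1 := Integrable.convolution_integrand (ContinuousLinearMap.mul ℝ ℝ) (μ := volume)
    (integrable_const (μ := ν) (1 : ℝ)) hk
  simp only [ContinuousLinearMap.mul_apply', one_mul] at h1
  have h2 : Integrable (fun p : ℂ × ℂ ↦ g p.1 * k (p.1 - p.2)) (volume.prod ν) :=
    h1.bdd_mul (c := C) ((hg.comp continuous_fst).aestronglyMeasurable)
      (Eventually.of_forall fun p ↦ hC _)
  have h3 := integral_integral_swap (f := fun y t ↦ g y * k (y - t)) h2
  simp only [integral_const_mul] at h3
  rw [show (fun y ↦ g y * convMeasure k ν y) = fun y ↦ g y * ∫ t, k (y - t) ∂ν from rfl, h3]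
  congr 1
  ext x
  rw [planeConv_comm]
  unfold planeConv
  congr 1
  ext y
  rw [← hkeven, neg_sub]

theorem integrable_convMeasure {k : ℂ → ℝ} (hk : Integrable k) (ν : Measure ℂ)
    [IsFiniteMeasure ν] : Integrable (convMeasure k ν) := by
  have h1 := Integrable.convolution_integrand (ContinuousLinearMap.mul ℝ ℝ) (μ := volume)
    (integrable_const (μ := ν) (1 : ℝ)) hk
  simp only [ContinuousLinearMap.mul_apply', one_mul] at h1
  exact h1.integral_prod_left

theorem ae_integrable_comp_sub {k : ℂ → ℝ} (hk : Integrable k) (ν : Measure ℂ)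
    [IsFiniteMeasure ν] : ∀ᵐ x, Integrable (fun t ↦ k (x - t)) ν := by
  have h1 := Integrable.ae_convolution_exists (ContinuousLinearMap.mul ℝ ℝ) (μ := volume)
    (integrable_const (μ := ν) (1 : ℝ)) hk
  filter_upwards [h1] with x hx
  simpa [ConvolutionExistsAt] using hx

/-! ### The truncated logarithmic kernel -/

section LogKernel

variable (b : ContDiffBump (0 : ℂ))

/-- The truncated logarithmic kernel `b(z) log (R / |z|) ≥ 0`, where `b` is a bump function with
outer radius `R`; its value at `z = 0` is `0`. -/
noncomputable def logKernel (z : ℂ) : ℝ := b z * Real.log (b.rOut / ‖z‖)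

/-- The difference `log (R / |z|) - logKernel b z`, which is smooth. -/
noncomputable def logRest (z : ℂ) : ℝ := (1 - b z) * Real.log (b.rOut / ‖z‖)

/-- The smooth, compactly supported remainder in `Δ (logKernel b) = -2π δ₀ - logRemainder b`. -/
noncomputable def logRemainder : ℂ → ℝ := Δ (logRest b)

theorem logKernel_nonneg (z : ℂ) : 0 ≤ logKernel b z := by
  by_cases hz : z = 0
  · simp [logKernel, hz]
  by_cases h : ‖z‖ < b.rOut
  · refine mul_nonneg b.nonneg (Real.log_nonneg ?_)
    rw [le_div_iff₀ (norm_pos_iff.mpr hz)]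
    linarith
  · rw [logKernel, b.zero_of_le_dist (by simpa using h)]
    simp

theorem support_logKernel_subset : Function.support (logKernel b) ⊆ Metric.ball 0 b.rOut := by
  refine (Function.support_mul_subset_left _ _).trans ?_
  rw [b.support_eq]

theorem logKernel_neg (z : ℂ) : logKernel b (-z) = logKernel b z := by
  simp [logKernel, b.neg]

theorem logRest_neg (z : ℂ) : logRest b (-z) = logRest b z := by
  simp [logRest, b.neg]

theorem logKernel_add_logRest {z : ℂ} (hz : z ≠ 0) :
    logKernel b z = Real.log b.rOut - Real.log ‖z‖ - logRest b z := by
  rw [logKernel, logRest, Real.log_div b.rOut_pos.ne' (norm_ne_zero_iff.mpr hz)]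
  ring

theorem integrable_logKernel : Integrable (logKernel b) := by
  have h : IntegrableOn (fun z : ℂ ↦ Real.log b.rOut - Real.log ‖z‖) (Metric.ball 0 b.rOut) :=
    Integrable.sub (integrableOn_const (by finiteness)) (integrableOn_log_norm_ball _)
  have h2 : IntegrableOn (logKernel b) (Metric.ball 0 b.rOut) := by
    have h3 : IntegrableOn (fun z ↦ b z * (Real.log b.rOut - Real.log ‖z‖))
        (Metric.ball 0 b.rOut) :=
      Integrable.bdd_mul (c := 1) h b.continuous.aestronglyMeasurable
        (Eventually.of_forall fun z ↦ by rw [Real.norm_of_nonneg b.nonneg]; exact b.le_one)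
    refine h3.congr ?_
    have : ∀ᵐ z : ℂ ∂(volume.restrict (Metric.ball 0 b.rOut)), z ≠ 0 :=
      ae_restrict_of_ae (compl_mem_ae_iff.mpr (measure_singleton (0 : ℂ)))
    filter_upwards [this] with z hz
    rw [logKernel, Real.log_div b.rOut_pos.ne' (norm_ne_zero_iff.mpr hz)]
  rwa [integrableOn_iff_integrable_of_support_subset (support_logKernel_subset b)] at h2

theorem contDiff_logRest : ContDiff ℝ ∞ (logRest b) := by
  rw [contDiff_iff_contDiffAt]
  intro z
  by_cases hz : ‖z‖ < b.rIn
  · have : logRest b =ᶠ[𝓝 z] fun _ ↦ 0 := by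
      filter_upwards [(Metric.isOpen_ball (x := (0 : ℂ)) (ε := b.rIn)).mem_nhds (by simpa using hz)]
        with w hw
      rw [logRest, b.one_of_mem_closedBall (Metric.ball_subset_closedBall hw)]
      simp
    exact contDiffAt_const.congr_of_eventuallyEq this
  · have hz0 : z ≠ 0 := by
      rintro rfl
      exact hz (by simpa using b.rIn_pos)
    have h1 : ContDiffAt ℝ ∞ (fun w : ℂ ↦ ‖w‖) z := contDiffAt_norm ℝ hz0
    refine (contDiffAt_const.sub b.contDiff.contDiffAt).mul (ContDiffAt.log ?_ ?_)
    · exact contDiffAt_const.div h1 (norm_ne_zero_iff.mpr hz0)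
    · exact div_ne_zero b.rOut_pos.ne' (norm_ne_zero_iff.mpr hz0)

theorem contDiff_logRemainder : ContDiff ℝ ∞ (logRemainder b) :=
  (contDiff_logRest b).contDiff_laplacian

theorem logRemainder_neg (z : ℂ) : logRemainder b (-z) = logRemainder b z := by
  have h := laplacian_comp_add_mul (contDiff_logRest b) 0 (-1) z
  simp only [zero_add, neg_mul, one_mul, norm_neg, norm_one, one_pow, logRest_neg] at h
  exact h.symm

/-- The remainder vanishes off the annulus where the bump function is not locally constant, because
`log |z|` is harmonic. -/
theorem logRemainder_eq_zero {z : ℂ} (hz : ‖z‖ < b.rIn ∨ b.rOut < ‖z‖) :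
    logRemainder b z = 0 := by
  rcases hz with hz | hz
  · have : logRest b =ᶠ[𝓝 z] fun _ ↦ 0 := by
      filter_upwards [(Metric.isOpen_ball (x := (0 : ℂ)) (ε := b.rIn)).mem_nhds (by simpa using hz)]
        with w hw
      rw [logRest, b.one_of_mem_closedBall (Metric.ball_subset_closedBall hw)]
      simp
    rw [logRemainder, (InnerProductSpace.laplacian_congr_nhds this).self_of_nhds,
      laplacian_eq_fderiv_fderiv]
    simp
  · have hz0 : z ≠ 0 := by
      rintro rfl
      simp at hz
      linarith [b.rOut_pos]
    have : logRest b =ᶠ[𝓝 z] (fun _ ↦ Real.log b.rOut) - (fun w ↦ Real.log ‖id w‖) := by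
      filter_upwards [(isOpen_lt continuous_const continuous_norm).mem_nhds hz,
        isOpen_ne.mem_nhds hz0] with w hw hw0
      rw [logRest, b.zero_of_le_dist (by simpa using le_of_lt hw),
        Real.log_div b.rOut_pos.ne' (norm_ne_zero_iff.mpr hw0)]
      simp
    have h2 := AnalyticAt.harmonicAt_log_norm (f := id) (z := z) analyticAt_id hz0
    have h3 := (InnerProductSpace.harmonicAt_const (Real.log b.rOut) (x := z)).sub h2
    rw [logRemainder, (InnerProductSpace.laplacian_congr_nhds this).self_of_nhds]
    exact h3.2.self_of_nhds

theorem hasCompactSupport_logRemainder : HasCompactSupport (logRemainder b) := by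
  refine HasCompactSupport.intro (isCompact_closedBall (0 : ℂ) b.rOut) fun z hz ↦ ?_
  exact logRemainder_eq_zero b (Or.inr (by simpa using hz))

theorem integral_laplacian_eq_zero {g : ℂ → ℝ} (hg : ContDiff ℝ ∞ g) (hgc : HasCompactSupport g) :
    ∫ z, Δ g z = 0 := by
  have h := integral_mul_laplacian (f := fun _ ↦ 1) contDiff_const hg hgc
  simp only [one_mul] at h
  rw [h]
  simp [laplacian_eq_fderiv_fderiv]

/-- The identity `Δ (logKernel b) = -2 π δ₀ - logRemainder b` of distributions. -/
theorem integral_logKernel_mul_laplacian {g : ℂ → ℝ} (hg : ContDiff ℝ ∞ g)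
    (hgc : HasCompactSupport g) :
    ∫ z, logKernel b z * Δ g z = -(2 * Real.pi * g 0) - ∫ z, logRemainder b z * g z := by
  have hLc := hg.contDiff_laplacian.continuous
  have hLs := hgc.laplacian
  have i1 : Integrable (fun z ↦ Real.log b.rOut * Δ g z) :=
    (hLc.integrable_of_hasCompactSupport hLs).const_mul _
  have i2 : Integrable (fun z : ℂ ↦ Real.log ‖z‖ * Δ g z) := by
    simpa using locallyIntegrable_log_norm.integrable_smul_right_of_hasCompactSupport hLc hLs
  have i3 : Integrable (fun z ↦ logRest b z * Δ g z) :=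
    ((contDiff_logRest b).continuous.mul hLc).integrable_of_hasCompactSupport hLs.mul_left
  have e : ∫ z, logKernel b z * Δ g z
      = ∫ z, (Real.log b.rOut * Δ g z - Real.log ‖z‖ * Δ g z - logRest b z * Δ g z) := by
    refine integral_congr_ae ?_
    filter_upwards [compl_mem_ae_iff.mpr (measure_singleton (0 : ℂ))] with z hz
    rw [logKernel_add_logRest b hz]
    ring
  rw [e, integral_sub (by exact i1.sub i2) i3, integral_sub i1 i2, integral_const_mul,
    integral_laplacian_eq_zero hg hgc, integral_log_norm_mul_laplacian hg hgc,
    integral_mul_laplacian (contDiff_logRest b) hg hgc]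
  simp [logRemainder]

/-- The operator `logKernel b ⋆ ·` inverts `-(2 π)⁻¹ Δ` up to a convolution with a smooth kernel. -/
theorem laplacian_planeConv_logKernel {g : ℂ → ℝ} (hg : ContDiff ℝ ∞ g)
    (hgc : HasCompactSupport g) (x : ℂ) :
    Δ (planeConv (logKernel b) g) x
      = -(2 * Real.pi * g x) - planeConv (logRemainder b) g x := by
  rw [laplacian_planeConv (integrable_logKernel b).locallyIntegrable hg hgc]
  have h1 : ContDiff ℝ ∞ (fun t ↦ g (x + (-1) * t)) :=
    hg.comp (contDiff_const.add (contDiff_const.mul contDiff_id))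
  have h2 : HasCompactSupport (fun t ↦ g (x + (-1) * t)) := by
    have := hgc.comp_homeomorph (Homeomorph.subLeft x)
    convert this using 2
    simp [Homeomorph.subLeft, sub_eq_add_neg]
  have h3 := integral_logKernel_mul_laplacian b h1 h2
  simp_rw [laplacian_comp_add_mul hg] at h3
  simpa [planeConv, sub_eq_add_neg] using h3

end LogKernel

/-! ### Representing a current by its potential -/

/-- A finite measure that acts on test functions as a locally integrable function `G` does is
absolutely continuous with density `G`. Both the measure and the Lebesgue measure are written as
densities with respect to their sum, where the statement is one about functions. -/
theorem restrict_eq_withDensity_of_integral_eq {N : Measure ℂ} [IsFiniteMeasure N] {G : ℂ → ℝ}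
    (hG : Integrable G) (hGm : Measurable G) {U : Set ℂ} (hU : IsOpen U)
    (h : ∀ g : ℂ → ℝ, ContDiff ℝ ∞ g → HasCompactSupport g → tsupport g ⊆ U →
      ∫ x, g x ∂N = ∫ x, g x * G x) :
    (∀ᵐ x ∂(volume.restrict U), 0 ≤ G x) ∧
      N.restrict U = (volume.restrict U).withDensity (fun x ↦ ENNReal.ofReal (G x)) := by
  set l : Measure ℂ := volume + N with hl
  have a1 : N ≪ l := Measure.absolutelyContinuous_of_le (Measure.le_add_left le_rfl)
  have a2 : (volume : Measure ℂ) ≪ l := Measure.absolutelyContinuous_of_le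
    (Measure.le_add_right le_rfl)
  set h1 := N.rnDeriv l with hh1
  set h2 := (volume : Measure ℂ).rnDeriv l with hh2
  have i1 : Integrable (fun x ↦ (h1 x).toReal) l := by
    have := (integrable_rnDeriv_smul_iff (μ := N) (ν := l) a1 (f := fun _ ↦ (1 : ℝ))).mpr
      (integrable_const 1)
    simpa using this
  have i2 : Integrable (fun x ↦ (h2 x).toReal * G x) l :=
    (integrable_rnDeriv_smul_iff (μ := volume) (ν := l) a2 (f := G)).mpr hG
  have key : ∀ᵐ x ∂l, x ∈ U → (h1 x).toReal - (h2 x).toReal * G x = 0 := by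
    refine hU.ae_eq_zero_of_integral_contDiff_smul_eq_zero
      ((i1.sub i2).locallyIntegrable.locallyIntegrableOn U) fun g hg hgc hgU ↦ ?_
    have e := h g hg hgc hgU
    obtain ⟨C, hC⟩ := hgc.exists_bound_of_continuous hg.continuous
    have j1 : Integrable (fun x ↦ g x * (h1 x).toReal) l :=
      i1.bdd_mul hg.continuous.aestronglyMeasurable (Eventually.of_forall hC)
    have j2 : Integrable (fun x ↦ g x * ((h2 x).toReal * G x)) l :=
      i2.bdd_mul hg.continuous.aestronglyMeasurable (Eventually.of_forall hC)
    rw [← integral_rnDeriv_smul a1, ← integral_rnDeriv_smul a2] at e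
    simp only [smul_eq_mul] at e ⊢
    simp_rw [mul_sub]
    rw [integral_sub j1 j2, sub_eq_zero]
    calc ∫ x, g x * (h1 x).toReal ∂l = ∫ x, (h1 x).toReal * g x ∂l := by simp_rw [mul_comm]
      _ = ∫ x, (h2 x).toReal * (g x * G x) ∂l := e
      _ = ∫ x, g x * ((h2 x).toReal * G x) ∂l := by
        congr 1
        ext x
        ring
  have f1 : ∀ᵐ x ∂l, h1 x < ⊤ := N.rnDeriv_lt_top l
  have f2 : ∀ᵐ x ∂l, h2 x < ⊤ := Measure.rnDeriv_lt_top _ l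
  have pos2 : ∀ᵐ x, 0 < h2 x := Measure.rnDeriv_pos a2
  have hUm := hU.measurableSet
  constructor
  · rw [ae_restrict_iff' hUm]
    filter_upwards [a2.ae_le key, pos2, a2.ae_le f2] with x hx hx2 hx3 hxU
    have h3 : 0 < (h2 x).toReal := ENNReal.toReal_pos hx2.ne' hx3.ne
    have h4 : 0 ≤ (h1 x).toReal := ENNReal.toReal_nonneg
    have h5 := hx hxU
    by_contra hneg
    push Not at hneg
    nlinarith
  · have e1 : N = l.withDensity h1 := (Measure.withDensity_rnDeriv_eq _ _ a1).symm
    have e2 : volume = l.withDensity h2 := (Measure.withDensity_rnDeriv_eq _ _ a2).symm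
    have e3 : (volume.restrict U).withDensity (fun x ↦ ENNReal.ofReal (G x))
        = (l.restrict U).withDensity (h2 * fun x ↦ ENNReal.ofReal (G x)) := by
      rw [e2, restrict_withDensity hUm, withDensity_mul₀]
      · exact (Measure.measurable_rnDeriv _ _).aemeasurable
      · exact hGm.ennreal_ofReal.aemeasurable
    rw [e3]
    conv_lhs => rw [e1]
    rw [restrict_withDensity hUm]
    refine withDensity_congr_ae ?_
    filter_upwards [ae_restrict_of_ae f1, ae_restrict_of_ae f2,
      (ae_restrict_iff' hUm).mpr key] with x hx1 hx2 hx3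
    rw [sub_eq_zero] at hx3
    rw [Pi.mul_apply, ← ENNReal.ofReal_toReal hx1.ne, hx3,
      ENNReal.ofReal_mul ENNReal.toReal_nonneg, ENNReal.ofReal_toReal hx2.ne]

section Potential

variable (b : ContDiffBump (0 : ℂ))

/-- The truncated logarithmic kernel with its correct value `∞` at the origin. -/
noncomputable def logKernelE (z : ℂ) : ℝ≥0∞ := if z = 0 then ⊤ else ENNReal.ofReal (logKernel b z)

theorem logKernelE_of_ne {z : ℂ} (hz : z ≠ 0) :
    logKernelE b z = ENNReal.ofReal (logKernel b z) := if_neg hz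

theorem continuous_logKernelE : Continuous (logKernelE b) := by
  rw [continuous_iff_continuousAt]
  intro z
  by_cases hz : z = 0
  · subst hz
    rw [ContinuousAt, logKernelE, if_pos rfl]
    have h1 : Tendsto (fun z : ℂ ↦ Real.log b.rOut - Real.log ‖z‖) (𝓝[≠] 0) atTop := by
      have h2 : Tendsto (fun z : ℂ ↦ Real.log ‖z‖) (𝓝[≠] 0) atBot :=
        Real.tendsto_log_nhdsGT_zero.comp tendsto_norm_nhdsNE_zero
      exact tendsto_atTop_add_const_left _ _ (tendsto_neg_atBot_atTop.comp h2)
    have h3 : Tendsto (logKernelE b) (𝓝[≠] 0) (𝓝 ⊤) := by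
      refine (ENNReal.tendsto_ofReal_nhds_top.mpr h1).congr' ?_
      have : ∀ᶠ z : ℂ in 𝓝[≠] 0, z ∈ Metric.ball 0 b.rIn :=
        nhdsWithin_le_nhds (Metric.ball_mem_nhds _ b.rIn_pos)
      filter_upwards [this, self_mem_nhdsWithin] with z hz hz0
      rw [logKernelE_of_ne b hz0, logKernel, b.one_of_mem_closedBall
        (Metric.ball_subset_closedBall hz), one_mul,
        Real.log_div b.rOut_pos.ne' (norm_ne_zero_iff.mpr hz0)]
    rw [← nhdsNE_sup_pure]
    refine h3.sup ?_
    rw [tendsto_pure_left]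
    intro s hs
    simpa [logKernelE] using mem_of_mem_nhds hs
  · have : logKernelE b =ᶠ[𝓝 z] fun w ↦ ENNReal.ofReal (logKernel b w) := by
      filter_upwards [isOpen_ne.mem_nhds hz] with w hw
      exact logKernelE_of_ne b hw
    refine ContinuousAt.congr ?_ this.symm
    refine ENNReal.continuous_ofReal.continuousAt.comp ?_
    refine b.continuous.continuousAt.mul (ContinuousAt.log ?_ ?_)
    · exact continuousAt_const.div continuous_norm.continuousAt (norm_ne_zero_iff.mpr hz)
    · exact div_ne_zero b.rOut_pos.ne' (norm_ne_zero_iff.mpr hz)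

/-- The potential `y ↦ ∫ logKernelE b (y - x) dM(x)` of a measure, with values in `[0, ∞]`. -/
noncomputable def logPotential (M : Measure ℂ) (y : ℂ) : ℝ≥0∞ := ∫⁻ x, logKernelE b (y - x) ∂M

/-- The measure `M` may have atoms, but the singular points of the kernel are a null set for
`volume.prod M`. -/
theorem logPotential_ae (M : Measure ℂ) [IsFiniteMeasure M] :
    ∀ᵐ y, logPotential b M y = ENNReal.ofReal (convMeasure (logKernel b) M y) := by
  have hnull : ∀ᵐ y : ℂ, ∀ᵐ x ∂M, y - x ≠ 0 := by
    refine Measure.ae_ae_of_ae_prod (p := fun p : ℂ × ℂ ↦ p.1 - p.2 ≠ 0) ?_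
    have hm : MeasurableSet {p : ℂ × ℂ | p.1 - p.2 ≠ 0} :=
      (isOpen_ne_fun (continuous_fst.sub continuous_snd) continuous_const).measurableSet
    rw [Measure.ae_prod_iff_ae_ae hm, Measure.ae_ae_comm hm]
    refine Eventually.of_forall fun x ↦ ?_
    filter_upwards [compl_mem_ae_iff.mpr (measure_singleton x)] with y hy
    exact sub_ne_zero.mpr hy
  filter_upwards [hnull, ae_integrable_comp_sub (integrable_logKernel b) M] with y h1 h2
  rw [convMeasure, ofReal_integral_eq_lintegral_ofReal h2
    (Eventually.of_forall fun x ↦ logKernel_nonneg b _), logPotential]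
  refine lintegral_congr_ae ?_
  filter_upwards [h1] with x hx
  exact logKernelE_of_ne b hx

theorem convMeasure_logKernel_nonneg (M : Measure ℂ) (y : ℂ) :
    0 ≤ convMeasure (logKernel b) M y := integral_nonneg fun _ ↦ logKernel_nonneg b _

theorem measurable_convMeasure_logKernel (M : Measure ℂ) [IsFiniteMeasure M] :
    Measurable (convMeasure (logKernel b) M) := by
  have h1 : Measurable (logKernel b) :=
    b.continuous.measurable.mul (Real.measurable_log.comp (measurable_const.div measurable_norm))
  have h2 : StronglyMeasurable (fun p : ℂ × ℂ ↦ logKernel b (p.1 - p.2)) :=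
    (h1.comp (measurable_fst.sub measurable_snd)).stronglyMeasurable
  exact h2.integral_prod_right'.measurable

/-- The smooth part of the potential of the current `M - F dx dy = -(2 π)⁻¹ Δ N`. -/
noncomputable def smoothPart (F : ℂ → ℝ) (N : Measure ℂ) (y : ℂ) : ℝ :=
  planeConv (logKernel b) F y + (2 * Real.pi)⁻¹ * convMeasure (logRemainder b) N y

theorem contDiff_smoothPart {F : ℂ → ℝ} (hF : ContDiff ℝ ∞ F) (hFc : HasCompactSupport F)
    (N : Measure ℂ) [IsFiniteMeasure N] : ContDiff ℝ ∞ (smoothPart b F N) :=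
  (contDiff_planeConv (integrable_logKernel b).locallyIntegrable hF hFc).add
    (contDiff_const.mul (contDiff_convMeasure (contDiff_logRemainder b)
      (hasCompactSupport_logRemainder b)))

/-- The quasi-subharmonic function that represents the potential `-N` of the current
`M - F dx dy = -(2 π)⁻¹ Δ N` everywhere and not only almost everywhere. -/
noncomputable def canonicalPotential (F : ℂ → ℝ) (M N : Measure ℂ) (y : ℂ) : EReal :=
  (smoothPart b F N y : EReal) - (logPotential b M y : EReal)

/-- If `M = F dx dy - (2π)⁻¹ Δ N` as distributions near the disc `D(z₀, δ)`, then `-N` is there the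
canonical potential. The identity is tested against `logKernel b ⋆ g`. -/
theorem restrict_eq_withDensity_canonicalPotential {F : ℂ → ℝ} (hF : ContDiff ℝ ∞ F)
    (hFc : HasCompactSupport F) {M N : Measure ℂ} [IsFiniteMeasure M] [IsFiniteMeasure N]
    {z₀ : ℂ} {δ : ℝ}
    (H : ∀ φ : ℂ → ℝ, ContDiff ℝ ∞ φ → HasCompactSupport φ →
      tsupport φ ⊆ Metric.ball z₀ (δ + b.rOut) →
      ∫ x, φ x ∂M = (∫ x, φ x * F x) - (2 * Real.pi)⁻¹ * ∫ x, Δ φ x ∂N) :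
    (∀ᵐ y ∂(volume.restrict (Metric.ball z₀ δ)), canonicalPotential b F M N y ≤ 0 ∧
      canonicalPotential b F M N y ≠ ⊥) ∧
    N.restrict (Metric.ball z₀ δ) = (volume.restrict (Metric.ball z₀ δ)).withDensity
      (fun y ↦ (-canonicalPotential b F M N y).toENNReal) := by
  have hS := contDiff_smoothPart b hF hFc N
  obtain ⟨χ, hχs, hχc, hχ1⟩ : ∃ χ : ℂ → ℝ, ContDiff ℝ ∞ χ ∧ HasCompactSupport χ ∧
      ∀ z ∈ Metric.ball z₀ δ, χ z = 1 := by
    let c : ContDiffBump z₀ := ⟨|δ| + 1, |δ| + 2, by positivity, by linarith⟩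
    refine ⟨c, c.contDiff, c.hasCompactSupport, fun z hz ↦ ?_⟩
    refine c.one_of_mem_closedBall ?_
    have : dist z z₀ < δ := hz
    change dist z z₀ ≤ |δ| + 1
    linarith [le_abs_self δ]
  set S := smoothPart b F N with hSdef
  -- the smooth part is cut off outside the disc, to have an integrable function
  set G : ℂ → ℝ := fun y ↦ convMeasure (logKernel b) M y - χ y * S y with hG
  have iq := integrable_convMeasure (integrable_logKernel b) M
  have iS : Integrable (fun y ↦ χ y * S y) :=
    (hχs.continuous.mul hS.continuous).integrable_of_hasCompactSupport hχc.mul_right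
  have hmain := restrict_eq_withDensity_of_integral_eq (N := N) (G := G) (iq.sub iS)
    ((measurable_convMeasure_logKernel b M).sub (hχs.continuous.mul hS.continuous).measurable)
    (U := Metric.ball z₀ δ) Metric.isOpen_ball (fun g hg hgc hgU ↦ ?_)
  · have hae : ∀ᵐ y ∂(volume.restrict (Metric.ball z₀ δ)), canonicalPotential b F M N y
        = ((-G y : ℝ) : EReal) := by
      filter_upwards [ae_restrict_of_ae (logPotential_ae b M),
        ae_restrict_mem measurableSet_ball] with y hy hyU
      rw [canonicalPotential, hy, EReal.coe_ennreal_ofReal,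
        max_eq_left (convMeasure_logKernel_nonneg b M y), ← EReal.coe_sub]
      simp [hG, hχ1 y hyU, hSdef]
    refine ⟨?_, ?_⟩
    · filter_upwards [hmain.1, hae] with y h1 h2
      rw [h2]
      refine ⟨?_, EReal.coe_ne_bot _⟩
      exact_mod_cast neg_nonpos.mpr h1
    · rw [hmain.2]
      refine withDensity_congr_ae ?_
      filter_upwards [hae] with y h2
      rw [h2, ← EReal.coe_neg, neg_neg]
      simp
  · obtain ⟨C, hC⟩ := hgc.exists_bound_of_continuous hg.continuous
    have hsub := tsupport_planeConv_subset (support_logKernel_subset b) hgc hgU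
    have e := H (planeConv (logKernel b) g)
      (contDiff_planeConv (integrable_logKernel b).locallyIntegrable hg hgc) hsub.1 hsub.2
    have hrem := contDiff_logRemainder b
    have hremc := hasCompactSupport_logRemainder b
    have irem : Integrable (logRemainder b) := hrem.continuous.integrable_of_hasCompactSupport hremc
    have sR := contDiff_planeConv irem.locallyIntegrable hg hgc
    have sK := contDiff_planeConv (integrable_logKernel b).locallyIntegrable hg hgc
    have kR : HasCompactSupport (planeConv (logRemainder b) g) := by
      rw [planeConv_eq_convolution]
      exact hremc.convolution _ hgc
    have ig : Integrable g N := hg.continuous.integrable_of_hasCompactSupport hgc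
    have iR : Integrable (planeConv (logRemainder b) g) N :=
      sR.continuous.integrable_of_hasCompactSupport kR
    simp_rw [laplacian_planeConv_logKernel b hg hgc] at e
    rw [integral_sub (by exact (ig.const_mul _).neg) iR, integral_neg, integral_const_mul,
      integral_planeConv (integrable_logKernel b) (logKernel_neg b) hg.continuous hC,
      integral_planeConv irem (logRemainder_neg b) hg.continuous hC] at e
    have e2 : ∫ x, planeConv (logKernel b) g x * F x
        = ∫ y, g y * planeConv (logKernel b) F y := by
      have hfub : Integrable (fun p : ℂ × ℂ ↦ (g p.1 * F p.2) * logKernel b (p.1 - p.2))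
          (volume.prod volume) := by
        obtain ⟨D, hD⟩ := hFc.exists_bound_of_continuous hF.continuous
        have h1 := Integrable.convolution_integrand (ContinuousLinearMap.mul ℝ ℝ) (μ := volume)
          (hF.continuous.integrable_of_hasCompactSupport hFc (μ := volume))
          (integrable_logKernel b)
        simp only [ContinuousLinearMap.mul_apply'] at h1
        have h2 := h1.bdd_mul (c := C) ((hg.continuous.comp continuous_fst).aestronglyMeasurable)
          (Eventually.of_forall fun p ↦ hC _)
        refine h2.congr (Eventually.of_forall fun p ↦ ?_)
        simp only [Function.comp_apply]
        ring
      have h3 := integral_integral_swap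
        (f := fun y t ↦ (g y * F t) * logKernel b (y - t)) hfub
      calc ∫ x, planeConv (logKernel b) g x * F x
          = ∫ t, ∫ y, (g y * F t) * logKernel b (y - t) := by
            congr 1
            ext x
            rw [planeConv_comm, planeConv, ← integral_mul_const]
            congr 1
            ext y
            rw [← logKernel_neg, neg_sub]
            ring
        _ = ∫ y, ∫ t, (g y * F t) * logKernel b (y - t) := h3.symm
        _ = _ := by
            congr 1
            ext y
            rw [planeConv_comm (logKernel b) F, planeConv, ← integral_const_mul]
            congr 1
            ext t
            ring
    rw [e2] at e
    have e3 : ∫ x, g x * G x = (∫ x, g x * convMeasure (logKernel b) M x)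
        - ((∫ x, g x * planeConv (logKernel b) F x)
          + (2 * Real.pi)⁻¹ * ∫ x, g x * convMeasure (logRemainder b) N x) := by
      have j1 : Integrable (fun x ↦ g x * convMeasure (logKernel b) M x) :=
        iq.bdd_mul hg.continuous.aestronglyMeasurable (Eventually.of_forall hC)
      have sF := contDiff_planeConv (integrable_logKernel b).locallyIntegrable hF hFc
      have j2 : Integrable (fun x ↦ g x * planeConv (logKernel b) F x) :=
        (hg.continuous.mul sF.continuous).integrable_of_hasCompactSupport hgc.mul_right
      have sN := contDiff_convMeasure (ν := N) hrem hremc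
      have j3 : Integrable (fun x ↦ g x * convMeasure (logRemainder b) N x) :=
        (hg.continuous.mul sN.continuous).integrable_of_hasCompactSupport hgc.mul_right
      rw [← integral_const_mul, ← integral_add j2 (j3.const_mul _),
        ← integral_sub j1 (by exact j2.add (j3.const_mul _))]
      congr 1
      ext x
      by_cases hx : g x = 0
      · simp [hx]
      · have : χ x = 1 := hχ1 x (hgU (subset_tsupport g hx))
        rw [hG]
        simp only [this, hSdef, smoothPart]
        ring
    rw [e3, e]
    have := Real.pi_pos
    field_simp
    ring
end Potential

/-! ### Logarithmic potentials are subharmonic -/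

/-- A circle contains only finitely many zeros of a holomorphic function that does not vanish at
its centre. -/
theorem ae_circleMap_ne_zero {F : ℂ → ℂ} {c : ℂ} {r : ℝ} (hr : 0 < r)
    (hF : AnalyticOnNhd ℂ F (Metric.closedBall c r)) (hc : F c ≠ 0) :
    ∀ᵐ θ ∂(volume.restrict (Ioc 0 (2 * Real.pi))), F (circleMap c r θ) ≠ 0 := by
  have hfin : (Metric.closedBall c r ∩ F ⁻¹' {0}).Finite := by
    by_contra hinf
    obtain ⟨x, hx, hacc⟩ := Set.Infinite.exists_accPt_of_subset_isCompact hinf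
      (isCompact_closedBall c r) inter_subset_left
    have hfreq : ∃ᶠ z in 𝓝[≠] x, F z = 0 := by
      rw [accPt_iff_frequently_nhdsNE] at hacc
      exact hacc.mono fun z hz ↦ hz.2
    have := hF.eqOn_zero_of_preconnected_of_frequently_eq_zero
      (convex_closedBall c r).isPreconnected hx hfreq
    exact hc (this (Metric.mem_closedBall_self hr.le))
  have hinj : InjOn (circleMap c r) (Ioc 0 (2 * Real.pi)) := by
    have := injOn_circleMap_of_abs_sub_le (a := 0) (b := 2 * Real.pi) (c := c) hr.ne'
      (by simp [abs_of_pos Real.pi_pos])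
    rwa [uIoc_of_le (by positivity)] at this
  have hfin2 : (Ioc 0 (2 * Real.pi) ∩ (circleMap c r) ⁻¹'
      (Metric.closedBall c r ∩ F ⁻¹' {0})).Finite := by
    refine Set.Finite.of_finite_image (hfin.subset ?_) (hinj.mono inter_subset_left)
    rintro _ ⟨θ, hθ, rfl⟩
    exact hθ.2
  rw [ae_restrict_iff' measurableSet_Ioc]
  filter_upwards [compl_mem_ae_iff.mpr (hfin2.measure_zero volume)] with θ hθ hmem h0
  exact hθ ⟨hmem, circleMap_mem_closedBall c hr.le θ, h0⟩

/-- The submean value inequality for `log |F|`, from Jensen's formula. -/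
theorem log_norm_le_integral_circleMap {F : ℂ → ℂ} {c : ℂ} {r : ℝ} (hr : 0 < r)
    (hF : AnalyticOnNhd ℂ F (Metric.closedBall c r)) (hc : F c ≠ 0) :
    IntegrableOn (fun θ ↦ Real.log ‖F (circleMap c r θ)‖) (Ioc 0 (2 * Real.pi)) ∧
    2 * Real.pi * Real.log ‖F c‖
      ≤ ∫ θ in Ioc 0 (2 * Real.pi), Real.log ‖F (circleMap c r θ)‖ := by
  have habs : |r| = r := abs_of_pos hr
  constructor
  · have h : CircleIntegrable (fun z ↦ Real.log ‖F z‖) c r := by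
      refine MeromorphicOn.circleIntegrable_log_norm ?_
      rw [habs]
      exact (hF.mono Metric.sphere_subset_closedBall).meromorphicOn
    exact h.1
  · have h := AnalyticOnNhd.circleAverage_log_norm (f := F) (c := c) hr.ne' (by rwa [habs]) hc
    have h2 : 0 ≤ ∑ᶠ u, MeromorphicOn.divisor F (Metric.closedBall c |r|) u
        * Real.log (r * ‖c - u‖⁻¹) := by
      refine finsum_nonneg fun u ↦ ?_
      by_cases hu : u ∈ Metric.closedBall c |r|
      · refine mul_nonneg ?_ ?_
        · have hd := MeromorphicOn.AnalyticOnNhd.divisor_nonneg (f := F)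
            (U := Metric.closedBall c |r|) (by rwa [habs])
          exact_mod_cast hd u
        · by_cases hcu : c = u
          · simp [hcu]
          · have h3 : 0 < ‖c - u‖ := norm_pos_iff.mpr (sub_ne_zero.mpr hcu)
            refine Real.log_nonneg ?_
            rw [← div_eq_mul_inv, one_le_div h3]
            rw [habs, mem_closedBall_iff_norm'] at hu
            exact hu
      · simp [Function.locallyFinsuppWithin.apply_eq_zero_of_notMem _ hu]
    rw [Real.circleAverage, intervalIntegral.integral_of_le (by positivity)] at h
    have hpi := Real.pi_pos
    simp only [smul_eq_mul] at h
    have h4 : Real.log ‖F c‖ ≤ (2 * Real.pi)⁻¹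
        * ∫ θ in Ioc 0 (2 * Real.pi), Real.log ‖F (circleMap c r θ)‖ := by
      rw [h]; linarith
    rw [inv_mul_eq_div, le_div_iff₀ (by positivity)] at h4
    linarith

variable (b : ContDiffBump (0 : ℂ))

theorem logKernel_of_norm_le {z : ℂ} (hz : z ≠ 0) (h : ‖z‖ ≤ b.rIn) :
    logKernel b z = Real.log b.rOut - Real.log ‖z‖ := by
  rw [logKernel, b.one_of_mem_closedBall (by simpa using h), one_mul,
    Real.log_div b.rOut_pos.ne' (norm_ne_zero_iff.mpr hz)]

/-- Where it is a logarithm, the kernel is superharmonic in any holomorphic coordinate. -/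
theorem lintegral_logKernelE_circleMap_le {F : ℂ → ℂ} {c : ℂ} {r : ℝ} (hr : 0 < r)
    (hF : AnalyticOnNhd ℂ F (Metric.closedBall c r))
    (hb : ∀ ζ ∈ Metric.closedBall c r, ‖F ζ‖ ≤ b.rIn) :
    ∫⁻ θ in Ioc 0 (2 * Real.pi), logKernelE b (F (circleMap c r θ))
      ≤ ENNReal.ofReal (2 * Real.pi) * logKernelE b (F c) := by
  have hpi := Real.pi_pos
  by_cases hc : F c = 0
  · rw [hc, logKernelE, if_pos rfl, ENNReal.mul_top]
    · exact le_top
    · simpa using hpi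
  obtain ⟨h1, h2⟩ := log_norm_le_integral_circleMap hr hF hc
  have hcb := hb c (Metric.mem_closedBall_self hr.le)
  have hconst : IntegrableOn (fun _ : ℝ ↦ Real.log b.rOut) (Ioc 0 (2 * Real.pi)) :=
    integrableOn_const measure_Ioc_lt_top.ne
  have hval : ∀ᵐ θ ∂(volume.restrict (Ioc 0 (2 * Real.pi))),
      logKernel b (F (circleMap c r θ))
        = Real.log b.rOut - Real.log ‖F (circleMap c r θ)‖ := by
    filter_upwards [ae_circleMap_ne_zero hr hF hc] with θ hθ
    exact logKernel_of_norm_le b hθ (hb _ (circleMap_mem_closedBall c hr.le θ))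
  have e1 : ∫⁻ θ in Ioc 0 (2 * Real.pi), logKernelE b (F (circleMap c r θ))
      = ∫⁻ θ in Ioc 0 (2 * Real.pi),
        ENNReal.ofReal (Real.log b.rOut - Real.log ‖F (circleMap c r θ)‖) := by
    refine lintegral_congr_ae ?_
    filter_upwards [ae_circleMap_ne_zero hr hF hc, hval] with θ hθ hv
    rw [logKernelE_of_ne b hθ, hv]
  have e2 := ofReal_integral_eq_lintegral_ofReal (hconst.sub h1) ?_
  · simp only [Pi.sub_apply] at e2
    rw [e1, ← e2, logKernelE_of_ne b hc, ← ENNReal.ofReal_mul (by positivity),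
      integral_sub hconst h1]
    refine ENNReal.ofReal_le_ofReal ?_
    rw [logKernel_of_norm_le b hc hcb]
    simp only [integral_const, MeasurableSet.univ, measureReal_restrict_apply, univ_inter,
      Real.volume_real_Ioc, smul_eq_mul]
    rw [max_eq_left (by linarith)]
    linarith
  · filter_upwards [hval] with θ hv
    simp only [Pi.zero_apply, Pi.sub_apply]
    rw [← hv]
    exact logKernel_nonneg b _

theorem measurable_logKernelE : Measurable (logKernelE b) := (continuous_logKernelE b).measurable

theorem lowerSemicontinuous_logPotential (M : Measure ℂ) :
    LowerSemicontinuous (logPotential b M) := by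
  rw [lowerSemicontinuous_iff_le_liminf]
  intro y
  have h : ∀ x, logKernelE b (y - x) = liminf (fun w ↦ logKernelE b (w - x)) (𝓝 y) := fun x ↦
    (((continuous_logKernelE b).comp (continuous_id.sub continuous_const)).tendsto y).liminf_eq.symm
  rw [logPotential, lintegral_congr h]
  exact lintegral_liminf_le fun w ↦
    (measurable_logKernelE b).comp (measurable_const.sub measurable_id)

/-- The supermean value inequality for the logarithmic potential in a holomorphic coordinate, for
circles so close to the measure that the kernel is not truncated. -/
theorem logPotential_circleMap_le {M : Measure ℂ} [IsFiniteMeasure M] {T : ℂ → ℂ} {c : ℂ} {r : ℝ}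
    (hr : 0 < r) (hT : AnalyticOnNhd ℂ T (Metric.closedBall c r))
    (hM : ∀ᵐ w ∂M, ∀ ζ ∈ Metric.closedBall c r, ‖T ζ - w‖ ≤ b.rIn) :
    ∫⁻ θ in Ioc 0 (2 * Real.pi), logPotential b M (T (circleMap c r θ))
      ≤ ENNReal.ofReal (2 * Real.pi) * logPotential b M (T c) := by
  have hTc : Continuous (fun θ ↦ T (circleMap c r θ)) :=
    hT.continuousOn.comp_continuous (continuous_circleMap c r)
      fun θ ↦ circleMap_mem_closedBall c hr.le θ
  unfold logPotential
  rw [lintegral_lintegral_swap, ← lintegral_const_mul]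
  · refine lintegral_mono_ae ?_
    filter_upwards [hM] with w hw
    exact lintegral_logKernelE_circleMap_le b (F := fun ζ ↦ T ζ - w) hr
      (hT.sub analyticOnNhd_const) hw
  · exact (measurable_logKernelE b).comp (measurable_const.sub measurable_id)
  · exact ((measurable_logKernelE b).comp
      ((hTc.measurable.comp measurable_fst).sub measurable_snd)).aemeasurable

theorem erealIntegral_neg_coe {α : Type*} [MeasurableSpace α] (μ : Measure α) (f : α → ℝ≥0∞) :
    erealIntegral μ (fun x ↦ -(f x : EReal)) = -((∫⁻ x, f x ∂μ : ℝ≥0∞) : EReal) := by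
  have h1 (x : α) : (-(f x : EReal)).toENNReal = 0 :=
    EReal.toENNReal_of_nonpos (EReal.neg_le_of_neg_le (by simpa using EReal.coe_ennreal_nonneg _))
  unfold erealIntegral
  simp_rw [h1, neg_neg, EReal.toENNReal_coe]
  simp

theorem coe_sub_add_coe_eq_neg (s c : ℝ) (hc : 0 ≤ c) (Φ : ℝ≥0∞) :
    (s : EReal) - ((Φ + ENNReal.ofReal c : ℝ≥0∞) : EReal) + ((-s + c : ℝ) : EReal)
      = -(Φ : EReal) := by
  induction Φ using ENNReal.recTopCoe with
  | top => simp
  | coe x =>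
    rw [EReal.coe_ennreal_add, EReal.coe_ennreal_ofReal, max_eq_left hc,
      show ((x : ℝ≥0∞) : EReal) = ((x : ℝ) : EReal) from rfl]
    norm_cast
    ring

/-- In any holomorphic coordinate, the canonical potential is locally the difference of a
subharmonic function and a smooth function: near a point `z₁` the subharmonic part is
`∫ log |T z - w| dM(w)`, the integral being over `w` near `T z₁`. -/
theorem exists_subharmonicOn_canonicalPotential {F : ℂ → ℝ} (hF : ContDiff ℝ ∞ F)
    (hFc : HasCompactSupport F) (M N : Measure ℂ) [IsFiniteMeasure M] [IsFiniteMeasure N]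
    {T : ℂ → ℂ} {z₁ : ℂ} {ρ₀ : ℝ} (hρ₀ : 0 < ρ₀) (hT : AnalyticOnNhd ℂ T (Metric.ball z₁ ρ₀)) :
    ∃ ρ > 0, ρ ≤ ρ₀ ∧ ∃ p : ℂ → ℝ, ContDiffOn ℝ ∞ p (Metric.ball z₁ ρ) ∧
      SubharmonicOn (fun z ↦ canonicalPotential b F M N (T z) + (p z : EReal))
        (Metric.ball z₁ ρ) := by
  have hin := b.rIn_pos
  have hTc : ContinuousAt T z₁ := (hT z₁ (Metric.mem_ball_self hρ₀)).continuousAt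
  obtain ⟨ρ₁, hρ₁, hρT⟩ := Metric.continuousAt_iff.mp hTc (b.rIn / 4) (by positivity)
  set ρ := min ρ₀ ρ₁ with hρdef
  have hρ : 0 < ρ := lt_min hρ₀ hρ₁
  have hTV : AnalyticOnNhd ℂ T (Metric.ball z₁ ρ) :=
    hT.mono (Metric.ball_subset_ball (min_le_left _ _))
  have hTd : ∀ z ∈ Metric.ball z₁ ρ, ‖T z - T z₁‖ < b.rIn / 4 := fun z hz ↦ by
    rw [← dist_eq_norm]
    exact hρT (lt_of_lt_of_le hz (min_le_right _ _))
  set M₁ := M.restrict (Metric.ball (T z₁) (b.rIn / 2)) with hM₁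
  set M₂ := M.restrict (Metric.ball (T z₁) (b.rIn / 2))ᶜ with hM₂
  -- The smooth kernel `κ` agrees with the logarithmic kernel away from the origin, so that the mass
  -- away from `T z₁` contributes a smooth function.
  let c : ContDiffBump (0 : ℂ) := ⟨b.rIn / 8, b.rIn / 4, by positivity, by linarith⟩
  set κ : ℂ → ℝ := fun z ↦ (1 - c z) * logKernel b z with hκ
  have hκs : ContDiff ℝ ∞ κ := by
    have e : κ = fun z ↦ b z * logRest c z + b z * ((1 - c z) * Real.log (b.rOut / c.rOut)) := by
      ext z
      by_cases hz : z = 0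
      · have hc0 : c 0 = 1 := c.one_of_mem_closedBall (Metric.mem_closedBall_self c.rIn_pos.le)
        simp [hκ, hz, logKernel, logRest, hc0]
      · have h0 := norm_ne_zero_iff.mpr hz
        simp only [hκ, logKernel, logRest]
        rw [Real.log_div b.rOut_pos.ne' h0, Real.log_div c.rOut_pos.ne' h0,
          Real.log_div b.rOut_pos.ne' c.rOut_pos.ne']
        ring
    rw [e]
    exact (b.contDiff.mul (contDiff_logRest c)).add
      (b.contDiff.mul ((contDiff_const.sub c.contDiff).mul contDiff_const))
  have hκc : HasCompactSupport κ := by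
    have : κ = fun z ↦ b z * ((1 - c z) * Real.log (b.rOut / ‖z‖)) := by
      ext z; simp only [hκ, logKernel]; ring
    rw [this]
    exact b.hasCompactSupport.mul_right
  have hκ0 : ∀ z, 0 ≤ κ z := fun z ↦
    mul_nonneg (sub_nonneg.mpr c.le_one) (logKernel_nonneg b z)
  have hκE : ∀ z, b.rIn / 4 ≤ ‖z‖ → logKernelE b z = ENNReal.ofReal (κ z) := fun z hz ↦ by
    have hz0 : z ≠ 0 := by
      rintro rfl
      simp at hz
      linarith
    rw [logKernelE_of_ne b hz0]
    simp only [hκ]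
    rw [c.zero_of_le_dist (by simpa using hz)]
    simp
  set p : ℂ → ℝ := fun z ↦ -smoothPart b F N (T z) + convMeasure κ M₂ (T z) with hp
  have hTs : ContDiffOn ℝ ∞ T (Metric.ball z₁ ρ) := fun z hz ↦
    ((hTV z hz).contDiffAt.restrict_scalars ℝ).contDiffWithinAt
  have hps : ContDiffOn ℝ ∞ p (Metric.ball z₁ ρ) :=
    ((contDiff_smoothPart b hF hFc N).comp_contDiffOn hTs).neg.add
      ((contDiff_convMeasure hκs hκc).comp_contDiffOn hTs)
  have hE : ∀ z ∈ Metric.ball z₁ ρ, canonicalPotential b F M N (T z) + (p z : EReal)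
      = -(logPotential b M₁ (T z) : EReal) := fun z hz ↦ by
    have h1 : logPotential b M (T z) = logPotential b M₁ (T z)
        + ENNReal.ofReal (convMeasure κ M₂ (T z)) := by
      have h2 : logPotential b M₂ (T z) = ENNReal.ofReal (convMeasure κ M₂ (T z)) := by
        rw [convMeasure, ofReal_integral_eq_lintegral_ofReal _
          (Eventually.of_forall fun x ↦ hκ0 _), logPotential]
        · refine setLIntegral_congr_fun measurableSet_ball.compl fun w hw ↦ hκE _ ?_
          have hw' : b.rIn / 2 ≤ ‖w - T z₁‖ := by
            simpa [dist_eq_norm] using hw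
          have h3 : ‖w - T z₁‖ ≤ ‖T z - w‖ + ‖T z - T z₁‖ := by
            have := norm_sub_le (T z - T z₁) (T z - w)
            have e : (T z - T z₁) - (T z - w) = w - T z₁ := by ring
            rw [e] at this
            linarith
          have := hTd z hz
          linarith
        · refine Continuous.integrable_of_hasCompactSupport
            (hκs.continuous.comp (continuous_const.sub continuous_id)) ?_
          exact hκc.comp_homeomorph (Homeomorph.subLeft (T z))
      rw [← h2, logPotential, logPotential, logPotential, hM₁, hM₂]
      exact (lintegral_add_compl _ measurableSet_ball).symm
    rw [canonicalPotential, h1]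
    exact coe_sub_add_coe_eq_neg _ _ (integral_nonneg fun _ ↦ hκ0 _) _
  refine ⟨ρ, hρ, min_le_left _ _, p, hps, ?_, ?_, ?_⟩
  · have h1 : LowerSemicontinuousOn (fun z ↦ logPotential b M₁ (T z)) (Metric.ball z₁ ρ) :=
      fun z hz y hy ↦ (hTV.continuousOn z hz).eventually
        (lowerSemicontinuous_logPotential b M₁ (T z) y hy)
    have h2 : UpperSemicontinuousOn (fun z ↦ -(logPotential b M₁ (T z) : EReal))
        (Metric.ball z₁ ρ) :=
      (continuous_neg.comp continuous_coe_ennreal_ereal).comp_lowerSemicontinuousOn_antitone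
        h1 (fun x y hxy ↦ EReal.neg_le_neg_iff.mpr (EReal.coe_ennreal_le_coe_ennreal_iff.mpr hxy))
    intro z hz y hy
    have hy' : -(logPotential b M₁ (T z) : EReal) < y := by
      rw [← hE z hz]
      exact hy
    filter_upwards [h2 z hz y hy', self_mem_nhdsWithin] with w hw hwV
    rw [hE w hwV]
    exact hw
  · intro z hz
    change canonicalPotential b F M N (T z) + (p z : EReal) ≠ ⊤
    rw [hE z hz]
    simp
  · intro z hz
    obtain ⟨σ, hσ, hσz⟩ := Metric.isOpen_ball.mem_nhds hz |> Metric.mem_nhds_iff.mp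
    refine ⟨σ, hσ, fun r hr hrσ ↦ ?_⟩
    have hsub : Metric.closedBall z r ⊆ Metric.ball z₁ ρ :=
      (Metric.closedBall_subset_ball hrσ).trans hσz
    refine ⟨hsub, ?_⟩
    have hcirc : ∀ θ, circleMap z r θ ∈ Metric.ball z₁ ρ := fun θ ↦
      hsub (circleMap_mem_closedBall z hr.le θ)
    simp_rw [fun θ ↦ hE _ (hcirc θ)]
    rw [hE z hz, erealIntegral_neg_coe]
    have hM : ∀ᵐ w ∂M₁, ∀ ζ ∈ Metric.closedBall z r, ‖T ζ - w‖ ≤ b.rIn := by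
      filter_upwards [ae_restrict_mem measurableSet_ball] with w hw ζ hζ
      have h1 := hTd ζ (hsub hζ)
      have h2 : ‖w - T z₁‖ < b.rIn / 2 := by simpa [dist_eq_norm] using hw
      have h3 := norm_sub_le (T ζ - T z₁) (w - T z₁)
      rw [sub_sub_sub_cancel_right] at h3
      linarith
    have h := logPotential_circleMap_le b hr (hTV.mono hsub) hM
    rw [mul_neg, EReal.neg_le_neg_iff]
    have e : ((2 * Real.pi : ℝ) : EReal) = ((ENNReal.ofReal (2 * Real.pi) : ℝ≥0∞) : EReal) := by
      rw [EReal.coe_ennreal_ofReal, max_eq_left (by positivity)]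
    rw [e, ← EReal.coe_ennreal_mul]
    exact EReal.coe_ennreal_le_coe_ennreal_iff.mpr h

/-! ### Comparison of quasi-subharmonic functions -/

/-- Fubini in polar coordinates: a property that holds almost everywhere in the plane holds almost
everywhere on almost every circle about `z`. -/
theorem ae_ae_circleMap {Q : ℂ → Prop} (hQ : ∀ᵐ w, Q w) (z : ℂ) :
    ∀ᵐ r ∂(volume.restrict (Ioi (0 : ℝ))), ∀ᵐ θ ∂(volume.restrict (Ioc 0 (2 * Real.pi))),
      Q (circleMap z r θ) := by
  have hpi := Real.pi_pos
  have h1 : ∀ᵐ w, Q (z + w) := by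
    have := (measurePreserving_add_left volume z).quasiMeasurePreserving.ae hQ
    exact this
  obtain ⟨A, hsub, hAm, hA0⟩ := exists_measurable_superset_of_null h1
  have h2 := Complex.lintegral_comp_polarCoord_symm (A.indicator 1)
  rw [lintegral_indicator_one hAm, hA0] at h2
  have hmeas : Measurable (fun p : ℝ × ℝ ↦ Complex.polarCoord.symm p) := by
    have : (fun p : ℝ × ℝ ↦ Complex.polarCoord.symm p)
        = fun p ↦ (p.1 : ℂ) * (Real.cos p.2 + Real.sin p.2 * Complex.I) := by
      ext p
      exact Complex.polarCoord_symm_apply p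
    rw [this]
    fun_prop
  rw [lintegral_eq_zero_iff] at h2
  swap
  · exact (ENNReal.measurable_ofReal.comp measurable_fst).mul
      ((measurable_one.indicator hAm).comp hmeas)
  have htarget : polarCoord.target = Ioi (0 : ℝ) ×ˢ Ioo (-Real.pi) Real.pi := rfl
  rw [htarget, Measure.volume_eq_prod, ← Measure.prod_restrict] at h2
  have h3 : ∀ᵐ p ∂((volume.restrict (Ioi (0 : ℝ))).prod
      (volume.restrict (Ioo (-Real.pi) Real.pi))), 0 < p.1 → Complex.polarCoord.symm p ∉ A := by
    filter_upwards [h2] with p hp hp0 hpA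
    simp only [Pi.zero_apply, smul_eq_mul, mul_eq_zero, ENNReal.ofReal_eq_zero] at hp
    rcases hp with hp | hp
    · linarith
    · rw [indicator_of_mem hpA] at hp
      exact one_ne_zero hp
  have h4 := Measure.ae_ae_of_ae_prod h3
  filter_upwards [h4, ae_restrict_mem measurableSet_Ioi] with r hr hr0
  have h5 : ∀ᵐ θ ∂(volume.restrict (Ioo (-Real.pi) Real.pi)), Q (circleMap z r θ) := by
    filter_upwards [hr] with θ hθ
    have h6 := hθ hr0
    by_contra hq
    refine h6 (hsub ?_)
    have e : z + Complex.polarCoord.symm (r, θ) = circleMap z r θ := by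
      rw [Complex.polarCoord_symm_apply, circleMap, Complex.exp_mul_I]
      simp
    change ¬ Q (z + Complex.polarCoord.symm (r, θ))
    rwa [e]
  rw [ae_restrict_iff' measurableSet_Ioo] at h5
  rw [ae_restrict_iff' measurableSet_Ioc]
  have h6 : ∀ᵐ θ : ℝ, θ - 2 * Real.pi ∈ Ioo (-Real.pi) Real.pi →
      Q (circleMap z r (θ - 2 * Real.pi)) :=
    (measurePreserving_sub_right volume (2 * Real.pi)).quasiMeasurePreserving.ae h5
  filter_upwards [h5, h6, compl_mem_ae_iff.mpr (measure_singleton Real.pi)] with θ a1 a2 a3 a4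
  rcases lt_trichotomy θ Real.pi with h | h | h
  · exact a1 ⟨by linarith [a4.1], h⟩
  · exact absurd h a3
  · have := a2 ⟨by linarith, by linarith [a4.2]⟩
    rwa [(periodic_circleMap z r).sub_eq] at this

theorem erealIntegral_le_of_ae_le {μ : Measure ℝ} [IsFiniteMeasure μ] {f : ℝ → EReal} {K : ℝ}
    (h : ∀ᵐ x ∂μ, f x ≤ (K : EReal)) :
    erealIntegral μ f ≤ ((μ.real univ * K : ℝ) : EReal) := by
  have hfin : μ univ ≠ ⊤ := measure_ne_top _ _
  rcases le_total 0 K with hK | hK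
  · have h1 : ∫⁻ x, (f x).toENNReal ∂μ ≤ ENNReal.ofReal (μ.real univ * K) := by
      calc ∫⁻ x, (f x).toENNReal ∂μ ≤ ∫⁻ _, ENNReal.ofReal K ∂μ := by
            refine lintegral_mono_ae ?_
            filter_upwards [h] with x hx
            exact (EReal.toENNReal_le_toENNReal hx).trans (by simp)
        _ = ENNReal.ofReal (μ.real univ * K) := by
            rw [lintegral_const, ENNReal.ofReal_mul measureReal_nonneg, Measure.real,
              ENNReal.ofReal_toReal hfin, mul_comm]
    calc erealIntegral μ f ≤ ((∫⁻ x, (f x).toENNReal ∂μ : ℝ≥0∞) : EReal) - 0 :=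
          EReal.sub_le_sub le_rfl (EReal.coe_ennreal_nonneg _)
      _ ≤ ((μ.real univ * K : ℝ) : EReal) := by
          rw [sub_zero]
          refine (EReal.coe_ennreal_le_coe_ennreal_iff.mpr h1).trans ?_
          rw [EReal.coe_ennreal_ofReal, max_eq_left (by positivity)]
  · have h0 : ∫⁻ x, (f x).toENNReal ∂μ = 0 := by
      rw [lintegral_congr_ae (g := fun _ ↦ 0), lintegral_zero]
      filter_upwards [h] with x hx
      exact EReal.toENNReal_of_nonpos (hx.trans (by exact_mod_cast hK))
    have h1 : ENNReal.ofReal (μ.real univ * (-K)) ≤ ∫⁻ x, (-f x).toENNReal ∂μ := by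
      calc ENNReal.ofReal (μ.real univ * (-K)) = ∫⁻ _, ENNReal.ofReal (-K) ∂μ := by
            rw [lintegral_const, ENNReal.ofReal_mul measureReal_nonneg, Measure.real,
              ENNReal.ofReal_toReal hfin, mul_comm]
        _ ≤ _ := by
            refine lintegral_mono_ae ?_
            filter_upwards [h] with x hx
            have : ((-K : ℝ) : EReal) ≤ -f x := by
              rw [EReal.coe_neg]
              exact EReal.neg_le_neg_iff.mpr hx
            exact le_trans (by simp) (EReal.toENNReal_le_toENNReal this)
    have h2 := EReal.coe_ennreal_le_coe_ennreal_iff.mpr h1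
    rw [EReal.coe_ennreal_ofReal, max_eq_left (by
      exact mul_nonneg measureReal_nonneg (by linarith))] at h2
    rw [erealIntegral, h0]
    calc ((0 : ℝ≥0∞) : EReal) - _ ≤ 0 - ((μ.real univ * (-K) : ℝ) : EReal) :=
          EReal.sub_le_sub (by simp) h2
      _ = _ := by
          rw [zero_sub, ← EReal.coe_neg]
          congr 1
          ring

/-- Upper semicontinuity of `u + p` passes to `u`, although subtraction in the extended reals is not
continuous. -/
theorem SubharmonicOn.upperSemicontinuousAt {u : ℂ → EReal} {V : Set ℂ} {p : ℂ → ℝ} {z : ℂ}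
    (h : SubharmonicOn (fun w ↦ u w + (p w : EReal)) V) (hV : V ∈ 𝓝 z) (hp : ContinuousAt p z) :
    UpperSemicontinuousAt u z := by
  intro y hy
  obtain ⟨x₁, h1, h1y⟩ := EReal.lt_iff_exists_real_btwn.mp hy
  obtain ⟨x₀, h0, h01⟩ := EReal.lt_iff_exists_real_btwn.mp h1
  have h01' : x₀ < x₁ := by exact_mod_cast h01
  have hz : u z + (p z : EReal) < ((x₀ + p z : ℝ) : EReal) := by
    rw [EReal.coe_add]
    exact EReal.add_lt_add_right_coe h0 _
  have hu := h.1 z (mem_of_mem_nhds hV) _ hz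
  rw [nhdsWithin_eq_nhds.mpr hV] at hu
  have hpz : ∀ᶠ w in 𝓝 z, p z - (x₁ - x₀) < p w := hp.eventually_const_lt (by linarith)
  filter_upwards [hu, hpz] with w hw hw2
  refine lt_of_lt_of_le ?_ h1y.le
  by_contra hcon
  push Not at hcon
  have h3 : ((x₁ + p w : ℝ) : EReal) ≤ u w + (p w : EReal) := by
    rw [EReal.coe_add]
    gcongr
  have h4 := h3.trans_lt hw
  have h5 : x₁ + p w < x₀ + p z := by exact_mod_cast h4
  linarith

/-- A quasi-subharmonic function that is almost everywhere at most an upper semicontinuous function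
is everywhere at most that function. -/
theorem SubharmonicOn.le_of_ae_le {u₁ u₂ : ℂ → EReal} {V : Set ℂ} {p : ℂ → ℝ} {z : ℂ}
    (h : SubharmonicOn (fun w ↦ u₁ w + (p w : EReal)) V) (hV : V ∈ 𝓝 z) (hp : ContinuousAt p z)
    (h2 : UpperSemicontinuousAt u₂ z) {W : Set ℂ} (hW : W ∈ 𝓝 z)
    (hae : ∀ᵐ w, w ∈ W → u₁ w ≤ u₂ w) : u₁ z ≤ u₂ z := by
  by_contra hcon
  push Not at hcon
  obtain ⟨t', ht', h1t'⟩ := EReal.lt_iff_exists_real_btwn.mp hcon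
  obtain ⟨t, ht, htt'⟩ := EReal.lt_iff_exists_real_btwn.mp ht'
  have htt'' : t < t' := by exact_mod_cast htt'
  have e1 := h2 _ ht
  have e2 : ∀ᶠ w in 𝓝 z, p w < p z + (t' - t) := hp.eventually_lt_const (by linarith)
  obtain ⟨ρ, hρ, hball⟩ := Metric.eventually_nhds_iff_ball.mp
    (e1.and (e2.and (eventually_mem_set.mpr hW)))
  have hae2 : ∀ᵐ w, w ∈ Metric.ball z ρ → u₁ w + (p w : EReal) ≤ ((t' + p z : ℝ) : EReal) := by
    filter_upwards [hae] with w hw hwb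
    obtain ⟨a1, a2, a3⟩ := hball w hwb
    calc u₁ w + (p w : EReal) ≤ (t : EReal) + ((p z + (t' - t) : ℝ) : EReal) := by
          refine add_le_add ((hw a3).trans a1.le) ?_
          exact_mod_cast a2.le
      _ = _ := by
          rw [← EReal.coe_add]
          congr 1
          ring
  obtain ⟨σ, hσ, hsub⟩ := h.2.2 z (mem_of_mem_nhds hV)
  -- Small circles on which the inequality holds almost everywhere exist, and the submean value
  -- inequality on one of them contradicts the choice of `t'`.
  have hr := ae_ae_circleMap hae2 z
  obtain ⟨r, hr1, hr2⟩ : ∃ r ∈ Ioo 0 (min ρ σ), ∀ᵐ θ ∂(volume.restrict (Ioc 0 (2 * Real.pi))),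
      circleMap z r θ ∈ Metric.ball z ρ →
        u₁ (circleMap z r θ) + (p (circleMap z r θ) : EReal) ≤ ((t' + p z : ℝ) : EReal) := by
    rw [ae_restrict_iff' measurableSet_Ioi] at hr
    have hpos : volume (Ioo 0 (min ρ σ)) ≠ 0 := by
      simp [hρ, hσ]
    by_contra hno
    refine hpos (measure_mono_null (fun r hr' ↦ ?_) hr)
    intro hcontra
    exact hno ⟨r, hr', hcontra hr'.1⟩
  obtain ⟨hcl, hmean⟩ := hsub r hr1.1 (hr1.2.trans_le (min_le_right _ _))
  have hbound := erealIntegral_le_of_ae_le (μ := volume.restrict (Ioc 0 (2 * Real.pi)))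
    (f := fun θ ↦ u₁ (circleMap z r θ) + (p (circleMap z r θ) : EReal)) (K := t' + p z) (by
      filter_upwards [hr2] with θ hθ
      refine hθ ?_
      rw [Metric.mem_ball, dist_eq_norm, circleMap_sub_center, norm_circleMap_zero,
        abs_of_pos hr1.1]
      exact hr1.2.trans_le (min_le_left _ _))
  have hpi := Real.pi_pos
  have hvol : (volume.restrict (Ioc 0 (2 * Real.pi))).real univ = 2 * Real.pi := by
    simp [Measure.real, hpi.le]
  rw [hvol] at hbound
  have h3 := hmean.trans hbound
  have h4 : ((t' + p z : ℝ) : EReal) < u₁ z + (p z : EReal) := by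
    rw [EReal.coe_add]
    exact EReal.add_lt_add_right_coe h1t' _
  obtain ⟨s, hs1, hs2⟩ := EReal.lt_iff_exists_real_btwn.mp h4
  have h5 : ((2 * Real.pi : ℝ) : EReal) * (s : EReal)
      ≤ ((2 * Real.pi : ℝ) : EReal) * (u₁ z + (p z : EReal)) :=
    mul_le_mul_of_nonneg_left hs2.le (by exact_mod_cast (by positivity))
  have h6 := h5.trans h3
  rw [← EReal.coe_mul] at h6
  have h7 : 2 * Real.pi * s ≤ 2 * Real.pi * (t' + p z) := by exact_mod_cast h6
  have h8 : t' + p z < s := by exact_mod_cast hs1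
  nlinarith

/-! ### Charts and the operator `dd^c` -/

section Charts

variable {X : Type*} [TopologicalSpace X]

/-- The function on `X` that equals `φ₀` in the chart `e` and vanishes off its domain. -/
noncomputable def chartFun (e : OpenPartialHomeomorph X ℂ) (φ₀ : ℂ → ℝ) : X → ℝ :=
  e.source.indicator (fun x ↦ φ₀ (e x))

theorem chartFun_symm {e : OpenPartialHomeomorph X ℂ} {φ₀ : ℂ → ℝ} {z : ℂ} (hz : z ∈ e.target) :
    chartFun e φ₀ (e.symm z) = φ₀ z := by
  rw [chartFun, indicator_of_mem (e.map_target hz), e.right_inv hz]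

theorem chartFun_of_mem {e : OpenPartialHomeomorph X ℂ} {φ₀ : ℂ → ℝ} {x : X} (hx : x ∈ e.source) :
    chartFun e φ₀ x = φ₀ (e x) := indicator_of_mem hx _

theorem tsupport_chartFun_subset [T2Space X] {e : OpenPartialHomeomorph X ℂ} {φ₀ : ℂ → ℝ}
    (hc : HasCompactSupport φ₀) (ht : tsupport φ₀ ⊆ e.target) :
    tsupport (chartFun e φ₀) ⊆ e.symm '' tsupport φ₀ := by
  have hK : IsCompact (e.symm '' tsupport φ₀) :=
    hc.image_of_continuousOn (e.continuousOn_symm.mono ht)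
  refine closure_minimal (fun x hx ↦ ?_) hK.isClosed
  have hxs : x ∈ e.source := by
    by_contra h
    exact hx (indicator_of_notMem h _)
  rw [Function.mem_support, chartFun_of_mem hxs] at hx
  exact ⟨e x, subset_tsupport _ hx, e.left_inv hxs⟩

variable [ChartedSpace ℂ X]

/-- Transition maps are only assumed `C^1` over `ℂ`, hence they are analytic. -/
theorem analyticOnNhd_transition [IsManifold 𝓘(ℂ) 1 X] {e e' : OpenPartialHomeomorph X ℂ}
    (he : e ∈ atlas ℂ X) (he' : e' ∈ atlas ℂ X) :
    AnalyticOnNhd ℂ (fun w ↦ e' (e.symm w)) (e.symm.trans e').source := by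
  have h1 : e.symm ≫ₕ e' ∈ contDiffGroupoid 1 𝓘(ℂ) := HasGroupoid.compatible he he'
  have h2 := contMDiffOn_iff_contDiffOn.mp (contMDiffOn_of_mem_contDiffGroupoid h1)
  exact (h2.differentiableOn one_ne_zero).analyticOnNhd (e.symm.trans e').open_source

instance isManifold_real [IsManifold 𝓘(ℂ) 1 X] : IsManifold 𝓘(ℝ, ℂ) ∞ X := by
  refine isManifold_of_contDiffOn _ _ _ fun e e' he he' ↦ ?_
  intro z hz
  have h := (analyticOnNhd_transition he he') z (by simpa using hz)
  have h2 : ContDiffAt ℝ ∞ (fun w ↦ e' (e.symm w)) z := (h.contDiffAt (n := ∞)).restrict_scalars ℝ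
  exact h2.contDiffWithinAt

theorem contDiffOn_comp_symm [IsManifold 𝓘(ℝ, ℂ) ∞ X] {e : OpenPartialHomeomorph X ℂ}
    (he : e ∈ atlas ℂ X) {φ : X → ℝ} (hφ : ContMDiff 𝓘(ℝ, ℂ) 𝓘(ℝ, ℝ) ∞ φ) :
    ContDiffOn ℝ ∞ (fun z ↦ φ (e.symm z)) e.target :=
  contMDiffOn_iff_contDiffOn.mp (hφ.comp_contMDiffOn (contMDiffOn_symm_of_mem_maximalAtlas
    (IsManifold.subset_maximalAtlas he)))

theorem contMDiff_chartFun [T2Space X] [IsManifold 𝓘(ℝ, ℂ) ∞ X] {e : OpenPartialHomeomorph X ℂ}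
    (he : e ∈ atlas ℂ X) {φ₀ : ℂ → ℝ} (hφ : ContDiff ℝ ∞ φ₀) (hc : HasCompactSupport φ₀)
    (ht : tsupport φ₀ ⊆ e.target) : ContMDiff 𝓘(ℝ, ℂ) 𝓘(ℝ, ℝ) ∞ (chartFun e φ₀) := by
  refine contMDiff_of_tsupport fun x hx ↦ ?_
  obtain ⟨z, hz, rfl⟩ := tsupport_chartFun_subset hc ht hx
  have hs : e.symm z ∈ e.source := e.map_target (ht hz)
  have h1 : ContMDiffAt 𝓘(ℝ, ℂ) 𝓘(ℝ, ℂ) ∞ e (e.symm z) :=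
    contMDiffAt_of_mem_maximalAtlas (IsManifold.subset_maximalAtlas he) hs
  have h2 : ContMDiffAt 𝓘(ℝ, ℂ) 𝓘(ℝ, ℝ) ∞ (fun x ↦ φ₀ (e x)) (e.symm z) :=
    (contMDiff_iff_contDiff.mpr hφ).contMDiffAt.comp _ h1
  refine h2.congr_of_eventuallyEq ?_
  filter_upwards [e.open_source.mem_nhds hs] with y hy using chartFun_of_mem hy

namespace KahlerForm

variable (η : KahlerForm X)

theorem coeffAt_pos (x : X) : 0 < η.coeffAt x :=
  η.pos _ (chart_mem_atlas ℂ x) _ (mem_chart_target ℂ x)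

theorem coeffAt_eq {e : OpenPartialHomeomorph X ℂ} (he : e ∈ atlas ℂ X) {x : X}
    (hx : x ∈ e.source) :
    η.coeffAt x = η.density e (e x) *
      ‖deriv (fun w ↦ e ((chartAt ℂ x).symm w)) (chartAt ℂ x x)‖ ^ 2 := by
  have h := η.transform (chartAt ℂ x) (chart_mem_atlas ℂ x) e he (chartAt ℂ x x) (by
    simp [hx])
  rw [coeffAt, h]
  simp

/-- In an arbitrary holomorphic chart, `dd^c φ / η` is the Laplacian divided by `2 π` times the
coefficient of `η`. -/
theorem ddc_eq [IsManifold 𝓘(ℂ) 1 X] {e : OpenPartialHomeomorph X ℂ} (he : e ∈ atlas ℂ X) {x : X}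
    (hx : x ∈ e.source) {φ : X → ℝ} (hφ : ContDiffAt ℝ 2 (fun z ↦ φ (e.symm z)) (e x)) :
    η.ddc φ x = (2 * Real.pi)⁻¹ * (Δ (fun z ↦ φ (e.symm z))) (e x) / η.density e (e x) := by
  set c := chartAt ℂ x with hc
  set T : ℂ → ℂ := fun w ↦ e (c.symm w) with hT
  have hxs : x ∈ c.source := mem_chart_source ℂ x
  have hTx : T (c x) = e x := by simp [hT, c.left_inv hxs]
  have hmem : c x ∈ (c.symm.trans e).source := by simp [c, hx]
  have hTa : AnalyticAt ℂ T (c x) := analyticOnNhd_transition (chart_mem_atlas ℂ x) he _ hmem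
  have h1 : (fun z : ℂ ↦ φ (c.symm z)) =ᶠ[𝓝 (c x)] fun z ↦ (fun w ↦ φ (e.symm w)) (T z) := by
    filter_upwards [(c.symm.trans e).open_source.mem_nhds hmem] with z hz
    have : c.symm z ∈ e.source := by
      rw [OpenPartialHomeomorph.trans_source] at hz
      exact hz.2
    simp [hT, e.left_inv this]
  have h2 := laplacian_comp_analyticAt hTa (h := fun w ↦ φ (e.symm w)) (by rwa [hTx])
  have hcoef := η.coeffAt_eq he hx
  have hpos := η.coeffAt_pos x
  have hd := η.pos e he _ (e.map_source hx)
  have hne : ‖deriv T (c x)‖ ^ 2 ≠ 0 := by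
    intro h0
    rw [hcoef] at hpos
    rw [show ‖deriv (fun w ↦ e ((chartAt ℂ x).symm w)) (chartAt ℂ x x)‖ ^ 2 = 0 from h0] at hpos
    simp at hpos
  rw [ddc, ← hc, (InnerProductSpace.laplacian_congr_nhds h1).eq_of_nhds, h2, hcoef, hTx]
  change _ * (‖deriv T (c x)‖ ^ 2 * _) / (_ * ‖deriv T (c x)‖ ^ 2) = _
  rw [mul_left_comm, mul_comm (η.density e (e x)), mul_div_mul_left _ _ hne]

theorem ddc_chartFun [IsManifold 𝓘(ℂ) 1 X] {e : OpenPartialHomeomorph X ℂ} (he : e ∈ atlas ℂ X)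
    {x : X} (hx : x ∈ e.source) {φ₀ : ℂ → ℝ} (hφ : ContDiff ℝ ∞ φ₀) :
    η.ddc (chartFun e φ₀) x = (2 * Real.pi)⁻¹ * (Δ φ₀) (e x) / η.density e (e x) := by
  have h1 : (fun z ↦ chartFun e φ₀ (e.symm z)) =ᶠ[𝓝 (e x)] φ₀ := by
    filter_upwards [e.open_target.mem_nhds (e.map_source hx)] with z hz using chartFun_symm hz
  rw [η.ddc_eq he hx ((contDiff_infty.1 hφ 2).contDiffAt.congr_of_eventuallyEq h1),
    (InnerProductSpace.laplacian_congr_nhds h1).eq_of_nhds]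

theorem ddc_eq_zero {φ : X → ℝ} {x : X} (hx : φ =ᶠ[𝓝 x] 0) : η.ddc φ x = 0 := by
  have h1 : (fun z : ℂ ↦ φ ((chartAt ℂ x).symm z)) =ᶠ[𝓝 (chartAt ℂ x x)] fun _ ↦ 0 := by
    have h2 : Tendsto (chartAt ℂ x).symm (𝓝 (chartAt ℂ x x)) (𝓝 x) := by
      have := (chartAt ℂ x).continuousAt_symm (mem_chart_target ℂ x)
      rwa [ContinuousAt, (chartAt ℂ x).left_inv (mem_chart_source ℂ x)] at this
    exact h2.eventually hx
  rw [ddc, (InnerProductSpace.laplacian_congr_nhds h1).eq_of_nhds]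
  have : (Δ (fun _ : ℂ ↦ (0 : ℝ))) (chartAt ℂ x x) = 0 := by
    rw [laplacian_eq_directional contDiff_const.contDiffAt]
    simp
  rw [this]
  simp

/-- `φ ↦ dd^c φ / η` has continuous values. -/
theorem continuous_ddc [IsManifold 𝓘(ℂ) 1 X] {φ : X → ℝ}
    (hφ : ContMDiff 𝓘(ℝ, ℂ) 𝓘(ℝ, ℝ) ∞ φ) : Continuous (η.ddc φ) := by
  refine continuous_iff_continuousAt.mpr fun x ↦ ?_
  set e := chartAt ℂ x with he'
  have he : e ∈ atlas ℂ X := chart_mem_atlas ℂ x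
  have hx : x ∈ e.source := mem_chart_source ℂ x
  have hsm := contDiffOn_comp_symm he hφ
  have h1 : ContinuousAt (fun y ↦ (2 * Real.pi)⁻¹ * (Δ (fun z ↦ φ (e.symm z))) (e y)
      / η.density e (e y)) x := by
    have hex := e.open_target.mem_nhds (e.map_source hx)
    refine ContinuousAt.div ?_ ?_ (η.pos e he _ (e.map_source hx)).ne'
    · refine ContinuousAt.mul continuousAt_const ?_
      have hΔ : ContinuousAt (Δ (fun z ↦ φ (e.symm z))) (e x) := by
        have h2 : ContDiffAt ℝ 2 (fun z ↦ φ (e.symm z)) (e x) :=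
          contDiffAt_infty.1 (hsm.contDiffAt hex) 2
        have h3 := ((h2.fderiv_right (m := 1) (by norm_num)).fderiv_right (m := 0)
          (by norm_num)).continuousAt
        have h4 : Δ (fun z ↦ φ (e.symm z)) = fun y ↦ fderiv ℝ (fderiv ℝ fun z ↦ φ (e.symm z)) y 1 1
            + fderiv ℝ (fderiv ℝ fun z ↦ φ (e.symm z)) y Complex.I Complex.I :=
          funext fun y ↦ laplacian_eq_fderiv_fderiv
        rw [h4]
        fun_prop
      exact hΔ.comp (e.continuousAt hx)
    · exact ((η.contDiffOn e he).continuousOn.continuousAt hex).comp (e.continuousAt hx)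
  refine h1.congr ?_
  filter_upwards [e.open_source.mem_nhds hx] with y hy
  refine (η.ddc_eq he hy ?_).symm
  exact contDiffAt_infty.1 (hsm.contDiffAt (e.open_target.mem_nhds (e.map_source hy))) 2

end KahlerForm

end Charts

/-! ### The area measure of a Kähler form -/

section Area

theorem OpenPartialHomeomorph.aemeasurable_symm {X : Type*} [TopologicalSpace X]
    [MeasurableSpace X] [BorelSpace X] (e : OpenPartialHomeomorph X ℂ) {μ : Measure ℂ}
    (hμ : μ ≪ volume.restrict e.target) : AEMeasurable e.symm μ :=
  (e.continuousOn_symm.aemeasurable e.open_target.measurableSet).mono_ac hμ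

theorem OpenPartialHomeomorph.measurableSet_target_inter {X : Type*} [TopologicalSpace X]
    [MeasurableSpace X] [BorelSpace X] (e : OpenPartialHomeomorph X ℂ) {A : Set X}
    (hA : MeasurableSet A) : MeasurableSet (e.target ∩ e.symm ⁻¹' A) := by
  have h : Measurable (e.target.domRestrict e.symm) :=
    (continuousOn_iff_continuous_domRestrict.mp e.continuousOn_symm).measurable
  have h2 := e.open_target.measurableSet.subtype_image (h hA)
  convert h2 using 1
  ext z
  simp [domRestrict, and_comm]

theorem OpenPartialHomeomorph.measurableSet_source_inter {X : Type*} [TopologicalSpace X]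
    [MeasurableSpace X] [BorelSpace X] (e : OpenPartialHomeomorph X ℂ) {A : Set ℂ}
    (hA : MeasurableSet A) : MeasurableSet (e.source ∩ e ⁻¹' A) := by
  have h : Measurable (e.source.domRestrict e) :=
    (continuousOn_iff_continuous_domRestrict.mp e.continuousOn).measurable
  have h2 := e.open_source.measurableSet.subtype_image (h hA)
  convert h2 using 1
  ext z
  simp [domRestrict, and_comm]

theorem Complex.abs_det_restrictScalars_toSpanSingleton (c : ℂ) :
    |((ContinuousLinearMap.toSpanSingleton ℂ c).restrictScalars ℝ).det| = ‖c‖ ^ 2 := by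
  have h : ((ContinuousLinearMap.toSpanSingleton ℂ c).restrictScalars ℝ).det = ‖c‖ ^ 2 := by
    rw [← Complex.normSq_eq_norm_sq, ← Algebra.norm_complex_apply]
    rw [ContinuousLinearMap.det, Algebra.norm_apply]
    congr 1
    ext z
    simp [mul_comm]
  rw [h, abs_of_nonneg (by positivity)]

variable {X : Type*} [TopologicalSpace X] [ChartedSpace ℂ X] [MeasurableSpace X] [BorelSpace X]

namespace KahlerForm

variable (η : KahlerForm X)

theorem aemeasurable_density {e : OpenPartialHomeomorph X ℂ} (he : e ∈ atlas ℂ X) :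
    AEMeasurable (η.density e) (volume.restrict e.target) :=
  (η.contDiffOn e he).continuousOn.aemeasurable e.open_target.measurableSet

/-- The area measure of the form on the domain of the chart `e`. -/
noncomputable def chartArea (e : OpenPartialHomeomorph X ℂ) : Measure X :=
  Measure.map e.symm
    ((volume.restrict e.target).withDensity (fun z ↦ ENNReal.ofReal (η.density e z)))

theorem chartArea_apply (e : OpenPartialHomeomorph X ℂ) {A : Set X} (hA : MeasurableSet A) :
    η.chartArea e A =
      ∫⁻ z in e.target ∩ e.symm ⁻¹' A, ENNReal.ofReal (η.density e z) := by
  have hac : (volume.restrict e.target).withDensity (fun z ↦ ENNReal.ofReal (η.density e z))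
      ≪ volume.restrict e.target := withDensity_absolutelyContinuous _ _
  have hm := e.measurableSet_target_inter hA
  rw [chartArea, Measure.map_apply_of_aemeasurable (e.aemeasurable_symm hac) hA]
  have h1 : (e.symm ⁻¹' A : Set ℂ) =ᵐ[(volume.restrict e.target).withDensity
      (fun z ↦ ENNReal.ofReal (η.density e z))] (e.target ∩ e.symm ⁻¹' A : Set ℂ) := by
    refine hac.ae_le ?_
    filter_upwards [ae_restrict_mem e.open_target.measurableSet] with z hz
    have : (z ∈ e.symm ⁻¹' A) = (z ∈ e.target ∩ e.symm ⁻¹' A) := by simp [hz]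
    exact this
  rw [measure_congr h1, withDensity_apply _ hm, Measure.restrict_restrict hm,
    inter_eq_self_of_subset_left inter_subset_left]

/-- The area measures of two charts agree where both are defined. -/
theorem chartArea_eq_of_subset [IsManifold 𝓘(ℂ) 1 X] {e e' : OpenPartialHomeomorph X ℂ}
    (he : e ∈ atlas ℂ X) (he' : e' ∈ atlas ℂ X) {A : Set X} (hA : MeasurableSet A)
    (h : A ⊆ e.source) (h' : A ⊆ e'.source) : η.chartArea e A = η.chartArea e' A := by
  rw [η.chartArea_apply e hA, η.chartArea_apply e' hA]
  set S := e.target ∩ e.symm ⁻¹' A with hS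
  have hSsub : S ⊆ (e.symm.trans e').source := fun z hz ↦ by
    rw [OpenPartialHomeomorph.trans_source]
    exact ⟨hz.1, h' hz.2⟩
  have himage : (fun w ↦ e' (e.symm w)) '' S = e'.target ∩ e'.symm ⁻¹' A := by
    ext w
    constructor
    · rintro ⟨z, hz, rfl⟩
      refine ⟨e'.map_source (h' hz.2), ?_⟩
      simpa [e'.left_inv (h' hz.2)] using hz.2
    · rintro ⟨hw, hwA⟩
      have hwA : e'.symm w ∈ A := hwA
      refine ⟨e (e'.symm w), ⟨e.map_source (h hwA), ?_⟩, ?_⟩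
      · simpa [e.left_inv (h hwA)] using hwA
      · simp [e.left_inv (h hwA), e'.right_inv hw]
  have hinj : InjOn (fun w ↦ e' (e.symm w)) S := fun z hz w hw hzw ↦
    e.symm.injOn hz.1 hw.1 (e'.injOn (h' hz.2) (h' hw.2) hzw)
  have han := analyticOnNhd_transition he he'
  rw [← himage, lintegral_image_eq_lintegral_abs_det_fderiv_mul volume
    (e.measurableSet_target_inter hA)
    (f' := fun z ↦ (ContinuousLinearMap.toSpanSingleton ℂ
      (deriv (fun w ↦ e' (e.symm w)) z)).restrictScalars ℝ) (fun z hz ↦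
      ((han z (hSsub hz)).differentiableAt.hasDerivAt.hasFDerivAt.restrictScalars
        ℝ).hasFDerivWithinAt) hinj]
  refine setLIntegral_congr_fun (e.measurableSet_target_inter hA) fun z hz ↦ ?_
  have htr := η.transform e he e' he' z (hSsub hz)
  have hpos := η.pos e' he' _ (e'.map_source (h' hz.2))
  simp only [Complex.abs_det_restrictScalars_toSpanSingleton]
  rw [htr, mul_comm, ENNReal.ofReal_mul (by positivity)]

theorem chartArea_le {e : OpenPartialHomeomorph X ℂ} (he : e ∈ atlas ℂ X) :
    η.chartArea e ≤ η.measure :=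
  le_iSup₂ (f := fun e (_ : e ∈ atlas ℂ X) ↦ η.chartArea e) e he

theorem chartArea_inter_source (e : OpenPartialHomeomorph X ℂ) {A : Set X} (hA : MeasurableSet A) :
    η.chartArea e (A ∩ e.source) = η.chartArea e A := by
  rw [η.chartArea_apply e hA, η.chartArea_apply e (hA.inter e.open_source.measurableSet)]
  congr 2
  ext z
  constructor
  · exact fun hz ↦ ⟨hz.1, hz.2.1⟩
  · exact fun hz ↦ ⟨hz.1, hz.2, e.map_target hz.1⟩

/-- On the domain of a chart the area measure is given by the coefficient of the form. -/
theorem measure_restrict_source [IsManifold 𝓘(ℂ) 1 X] {e : OpenPartialHomeomorph X ℂ}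
    (he : e ∈ atlas ℂ X) : η.measure.restrict e.source = η.chartArea e := by
  have hs := e.open_source.measurableSet
  have key : η.measure ≤ η.chartArea e + η.measure.restrict e.sourceᶜ := by
    refine iSup₂_le fun e' he' ↦ ?_
    change η.chartArea e' ≤ _
    refine Measure.le_iff.mpr fun B hB ↦ ?_
    rw [← measure_inter_add_sdiff B hs, Measure.add_apply, Measure.restrict_apply hB,
      ← sdiff_eq]
    refine add_le_add ?_ (η.chartArea_le he' _)
    have hBs := hB.inter hs
    rw [← η.chartArea_inter_source e' hBs, η.chartArea_eq_of_subset he' he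
      (hBs.inter e'.open_source.measurableSet) inter_subset_right
      (inter_subset_left.trans inter_subset_right)]
    exact measure_mono (inter_subset_left.trans inter_subset_left)
  refine Measure.ext fun A hA ↦ ?_
  rw [Measure.restrict_apply hA]
  refine le_antisymm ?_ ?_
  · refine (key _).trans ?_
    rw [Measure.add_apply, Measure.restrict_apply (hA.inter hs), η.chartArea_inter_source e hA]
    have : A ∩ e.source ∩ e.sourceᶜ = ∅ := by
      ext x
      simp +contextual
    simp [this]
  · rw [← η.chartArea_inter_source e hA]
    exact η.chartArea_le he _

end KahlerForm

end Area

/-! ### Push-forward of measures to a chart -/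

section Push

variable {X : Type*} [TopologicalSpace X]

/-- The coordinate map of a chart, extended by zero to a map on `X`. -/
noncomputable def chartMap (e : OpenPartialHomeomorph X ℂ) : X → ℂ := e.source.indicator e

theorem chartMap_of_mem {e : OpenPartialHomeomorph X ℂ} {x : X} (hx : x ∈ e.source) :
    chartMap e x = e x := indicator_of_mem hx _

variable [MeasurableSpace X] [BorelSpace X]

theorem measurable_chartMap (e : OpenPartialHomeomorph X ℂ) : Measurable (chartMap e) := by
  have h : Measurable (e.source.domRestrict e) :=
    (continuousOn_iff_continuous_domRestrict.mp e.continuousOn).measurable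
  refine measurable_of_restrict_of_restrict_compl e.open_source.measurableSet ?_ ?_
  · convert h using 1
    ext x
    exact chartMap_of_mem x.2
  · convert measurable_const (a := (0 : ℂ)) using 1
    ext x
    exact indicator_of_notMem x.2 _

/-- The push-forward to `ℂ` of the restriction of a measure to the domain of a chart. -/
noncomputable def chartPush (e : OpenPartialHomeomorph X ℂ) (μ : Measure X) : Measure ℂ :=
  (μ.restrict e.source).map (chartMap e)

instance (e : OpenPartialHomeomorph X ℂ) (μ : Measure X) [IsFiniteMeasure μ] :
    IsFiniteMeasure (chartPush e μ) := by
  unfold chartPush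
  infer_instance

theorem lintegral_chartPush (e : OpenPartialHomeomorph X ℂ) (μ : Measure X) {g : ℂ → ℝ≥0∞}
    (hg : Measurable g) : ∫⁻ z, g z ∂(chartPush e μ) = ∫⁻ x in e.source, g (e x) ∂μ := by
  rw [chartPush, lintegral_map hg (measurable_chartMap e)]
  refine setLIntegral_congr_fun e.open_source.measurableSet fun x hx ↦ ?_
  simp only [chartMap_of_mem hx]

theorem setLIntegral_chartPush (e : OpenPartialHomeomorph X ℂ) (μ : Measure X) {g : ℂ → ℝ≥0∞}
    (hg : Measurable g) {B : Set ℂ} (hB : MeasurableSet B) :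
    ∫⁻ z in B, g z ∂(chartPush e μ) = ∫⁻ x in e.source ∩ e ⁻¹' B, g (e x) ∂μ := by
  rw [← lintegral_indicator hB, lintegral_chartPush e μ (hg.indicator hB),
    ← lintegral_indicator e.open_source.measurableSet,
    ← lintegral_indicator (e.measurableSet_source_inter hB)]
  congr 1 with x
  by_cases hx : x ∈ e.source <;> by_cases hxB : e x ∈ B <;> simp [indicator, hx, hxB]

theorem chartPush_apply (e : OpenPartialHomeomorph X ℂ) (μ : Measure X) {B : Set ℂ}
    (hB : MeasurableSet B) : chartPush e μ B = μ (e.source ∩ e ⁻¹' B) := by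
  have := setLIntegral_chartPush e μ (g := 1) measurable_one hB
  simpa using this

theorem integral_chartPush (e : OpenPartialHomeomorph X ℂ) (μ : Measure X) {g : ℂ → ℝ}
    (hg : Measurable g) : ∫ z, g z ∂(chartPush e μ) = ∫ x, chartFun e g x ∂μ := by
  rw [chartPush, integral_map (measurable_chartMap e).aemeasurable hg.aestronglyMeasurable,
    chartFun, integral_indicator e.open_source.measurableSet]
  refine setIntegral_congr_fun e.open_source.measurableSet fun x hx ↦ ?_
  simp only [chartMap_of_mem hx]

variable [ChartedSpace ℂ X] [IsManifold 𝓘(ℂ) 1 X] (η : KahlerForm X)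

/-- In a chart, the area measure of a Kähler form is `density e z dx dy`. -/
theorem chartPush_measure {e : OpenPartialHomeomorph X ℂ} (he : e ∈ atlas ℂ X) :
    chartPush e η.measure =
      (volume.restrict e.target).withDensity (fun z ↦ ENNReal.ofReal (η.density e z)) := by
  have hac : (volume.restrict e.target).withDensity (fun z ↦ ENNReal.ofReal (η.density e z))
      ≪ volume.restrict e.target := withDensity_absolutelyContinuous _ _
  rw [chartPush, η.measure_restrict_source he, KahlerForm.chartArea,
    AEMeasurable.map_map_of_aemeasurable (measurable_chartMap e).aemeasurable
      (e.aemeasurable_symm hac)]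
  conv_rhs => rw [← Measure.map_id (μ := (volume.restrict e.target).withDensity _)]
  refine Measure.map_congr (hac.ae_le ?_)
  filter_upwards [ae_restrict_mem e.open_target.measurableSet] with z hz
  simp [chartMap_of_mem (e.map_target hz), e.right_inv hz]

/-- Null sets of the area measure are Lebesgue null in every chart. -/
theorem KahlerForm.ae_symm_of_ae {e : OpenPartialHomeomorph X ℂ} (he : e ∈ atlas ℂ X)
    {P : X → Prop} {W : Set X} (hW : MeasurableSet W)
    (h : ∀ᵐ x ∂(η.measure.restrict W), P x) :
    ∀ᵐ z, z ∈ e.target → e.symm z ∈ W → P (e.symm z) := by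
  have hac : (volume.restrict e.target).withDensity (fun z ↦ ENNReal.ofReal (η.density e z))
      ≪ volume.restrict e.target := withDensity_absolutelyContinuous _ _
  rw [ae_restrict_iff' hW] at h
  have h1 : ∀ᵐ x ∂(η.measure.restrict e.source), x ∈ W → P x := ae_restrict_of_ae h
  rw [η.measure_restrict_source he, KahlerForm.chartArea] at h1
  have h2 := ae_of_ae_map (e.aemeasurable_symm hac) h1
  rw [ae_withDensity_iff' (η.aemeasurable_density he).ennreal_ofReal,
    ae_restrict_iff' e.open_target.measurableSet] at h2
  filter_upwards [h2] with z hz hzt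
  refine hz hzt ?_
  simpa using η.pos e he z hzt

end Push

/-! ### Quasi-subharmonicity at a point -/

section QuasiSubharmonicAt

variable {X : Type*} [TopologicalSpace X] [ChartedSpace ℂ X]

/-- In the preferred chart at `x`, the function `u` is near `x` the difference of a subharmonic
function and a smooth function. -/
def QuasiSubharmonicAt (u : X → EReal) (x : X) : Prop :=
  ∃ V : Set ℂ, IsOpen V ∧ chartAt ℂ x x ∈ V ∧ V ⊆ (chartAt ℂ x).target ∧
    ∃ p : ℂ → ℝ, ContDiffOn ℝ ∞ p V ∧
      SubharmonicOn (fun z ↦ u ((chartAt ℂ x).symm z) + (p z : EReal)) V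

theorem quasiSubharmonic_iff {u : X → EReal} :
    QuasiSubharmonic u ↔ ∀ x, QuasiSubharmonicAt u x := Iff.rfl

theorem SubharmonicOn.congr {u v : ℂ → EReal} {V : Set ℂ} (h : SubharmonicOn u V)
    (hu : EqOn u v V) : SubharmonicOn v V := by
  refine ⟨fun z hz ↦ ?_, fun z hz ↦ hu hz ▸ h.2.1 z hz, fun z hz ↦ ?_⟩
  · intro y hy
    filter_upwards [h.1 z hz y (by simpa only [hu hz] using hy), self_mem_nhdsWithin] with w hw hwV
    simpa only [hu hwV] using hw
  · obtain ⟨ρ, hρ, hr⟩ := h.2.2 z hz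
    refine ⟨ρ, hρ, fun r hr0 hrρ ↦ ?_⟩
    obtain ⟨h1, h2⟩ := hr r hr0 hrρ
    refine ⟨h1, ?_⟩
    have e : (fun θ ↦ v (circleMap z r θ)) = fun θ ↦ u (circleMap z r θ) := by
      ext θ
      exact (hu (h1 (circleMap_mem_closedBall z hr0.le θ))).symm
    rwa [e, ← hu hz]

theorem SubharmonicOn.mono_isOpen {u : ℂ → EReal} {V W : Set ℂ} (h : SubharmonicOn u V)
    (hW : IsOpen W) (hWV : W ⊆ V) : SubharmonicOn u W := by
  refine ⟨h.1.mono hWV, fun z hz ↦ h.2.1 z (hWV hz), fun z hz ↦ ?_⟩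
  obtain ⟨ρ, hρ, hr⟩ := h.2.2 z (hWV hz)
  obtain ⟨ε, hε, hεW⟩ := Metric.nhds_basis_closedBall.mem_iff.mp (hW.mem_nhds hz)
  refine ⟨min ρ ε, lt_min hρ hε, fun r hr0 hrρ ↦ ⟨?_, ?_⟩⟩
  · exact (Metric.closedBall_subset_closedBall (hrρ.le.trans (min_le_right _ _))).trans hεW
  · exact (hr r hr0 (hrρ.trans_le (min_le_left _ _))).2

theorem QuasiSubharmonicAt.congr {u v : X → EReal} {x : X} (h : QuasiSubharmonicAt u x)
    (huv : u =ᶠ[𝓝 x] v) : QuasiSubharmonicAt v x := by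
  obtain ⟨V, hV, hxV, hVt, p, hp, hsub⟩ := h
  obtain ⟨W, hWu, hW, hxW⟩ := eventually_nhds_iff.mp huv
  set c := chartAt ℂ x
  have hO : IsOpen (c.target ∩ c.symm ⁻¹' W) := c.symm.isOpen_inter_preimage hW
  refine ⟨V ∩ (c.target ∩ c.symm ⁻¹' W), hV.inter hO, ⟨hxV, mem_chart_target ℂ x, ?_⟩,
    inter_subset_left.trans hVt, p, hp.mono inter_subset_left, ?_⟩
  · simpa [c, (chartAt ℂ x).left_inv (mem_chart_source ℂ x)] using hxW
  · refine (hsub.mono_isOpen (hV.inter hO) inter_subset_left).congr fun z hz ↦ ?_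
    simp only
    rw [hWu _ hz.2.2]

theorem tendsto_chartAt_symm (x : X) : Tendsto (chartAt ℂ x).symm (𝓝 (chartAt ℂ x x)) (𝓝 x) := by
  have := (chartAt ℂ x).continuousAt_symm (mem_chart_target ℂ x)
  rwa [ContinuousAt, (chartAt ℂ x).left_inv (mem_chart_source ℂ x)] at this

theorem QuasiSubharmonicAt.upperSemicontinuousAt_symm {u : X → EReal} {x : X}
    (h : QuasiSubharmonicAt u x) :
    UpperSemicontinuousAt (fun z ↦ u ((chartAt ℂ x).symm z)) (chartAt ℂ x x) := by
  obtain ⟨V, hV, hxV, hVt, p, hp, hsub⟩ := h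
  exact hsub.upperSemicontinuousAt (hV.mem_nhds hxV) (hp.continuousOn.continuousAt
    (hV.mem_nhds hxV))

theorem QuasiSubharmonicAt.upperSemicontinuousAt {u : X → EReal} {x : X}
    (h : QuasiSubharmonicAt u x) : UpperSemicontinuousAt u x := by
  intro y hy
  have h1 := h.upperSemicontinuousAt_symm y (by
    simpa [(chartAt ℂ x).left_inv (mem_chart_source ℂ x)] using hy)
  have h2 := ((chartAt ℂ x).continuousAt (mem_chart_source ℂ x)).eventually h1
  filter_upwards [h2, (chartAt ℂ x).open_source.mem_nhds (mem_chart_source ℂ x)] with z hz hzs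
  simpa [(chartAt ℂ x).left_inv hzs] using hz

theorem QuasiSubharmonic.measurable [MeasurableSpace X] [BorelSpace X] {u : X → EReal}
    (h : QuasiSubharmonic u) : Measurable u :=
  UpperSemicontinuous.measurable fun x ↦ (quasiSubharmonic_iff.mp h x).upperSemicontinuousAt

theorem QuasiSubharmonicAt.le_of_ae_le [MeasurableSpace X] [BorelSpace X] [IsManifold 𝓘(ℂ) 1 X]
    (η : KahlerForm X) {u v : X → EReal} {x : X} (hu : QuasiSubharmonicAt u x)
    (hv : UpperSemicontinuousAt v x) {W : Set X} (hW : IsOpen W) (hx : x ∈ W)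
    (h : ∀ᵐ y ∂(η.measure.restrict W), u y ≤ v y) : u x ≤ v x := by
  obtain ⟨V, hV, hxV, hVt, p, hp, hsub⟩ := hu
  have h1 := η.ae_symm_of_ae (chart_mem_atlas ℂ x) hW.measurableSet h
  have hT := tendsto_chartAt_symm x
  have h2 : UpperSemicontinuousAt (fun z ↦ v ((chartAt ℂ x).symm z)) (chartAt ℂ x x) := by
    intro y hy
    exact hT.eventually (hv y (by simpa [(chartAt ℂ x).left_inv (mem_chart_source ℂ x)] using hy))
  have h3 := hsub.le_of_ae_le (hV.mem_nhds hxV) (hp.continuousOn.continuousAt (hV.mem_nhds hxV))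
    h2 (W := (chartAt ℂ x).target ∩ (chartAt ℂ x).symm ⁻¹' W) (by
      refine inter_mem ((chartAt ℂ x).open_target.mem_nhds (mem_chart_target ℂ x)) ?_
      exact hT (hW.mem_nhds hx)) (by
      filter_upwards [h1] with z hz hzW using hz hzW.1 hzW.2)
  simpa [(chartAt ℂ x).left_inv (mem_chart_source ℂ x)] using h3

end QuasiSubharmonicAt

/-! ### Local potentials on the surface -/

section LocalPotential

theorem contDiff_mul_of_tsupport_subset {χ d : ℂ → ℝ} {V : Set ℂ} (hV : IsOpen V)
    (hχ : ContDiff ℝ ∞ χ) (hd : ContDiffOn ℝ ∞ d V) (h : tsupport χ ⊆ V) :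
    ContDiff ℝ ∞ (fun z ↦ χ z * d z) := by
  refine contDiff_iff_contDiffAt.mpr fun z ↦ ?_
  by_cases hz : z ∈ tsupport χ
  · exact hχ.contDiffAt.mul (hd.contDiffAt (hV.mem_nhds (h hz)))
  · have h0 : (fun z ↦ χ z * d z) =ᶠ[𝓝 z] fun _ ↦ 0 := by
      filter_upwards [notMem_tsupport_iff_eventuallyEq.mp hz] with w hw
      simp [hw]
    exact contDiffAt_const.congr_of_eventuallyEq h0

theorem measurable_canonicalPotential (b : ContDiffBump (0 : ℂ)) {F : ℂ → ℝ}
    (hF : ContDiff ℝ ∞ F) (hFc : HasCompactSupport F) (M N : Measure ℂ) [IsFiniteMeasure N] :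
    Measurable (canonicalPotential b F M N) := by
  unfold canonicalPotential
  exact ((contDiff_smoothPart b hF hFc N).continuous.measurable.coe_real_ereal).sub
    (lowerSemicontinuous_logPotential b M).measurable.coe_ereal_ennreal

variable {X : Type*} [TopologicalSpace X] [ChartedSpace ℂ X]

theorem exists_closedBall_subset_target (a : X) :
    ∃ δ > 0, Metric.closedBall (chartAt ℂ a a) (4 * δ) ⊆ (chartAt ℂ a).target := by
  obtain ⟨ε, hε, h⟩ := Metric.nhds_basis_closedBall.mem_iff.mp
    ((chartAt ℂ a).open_target.mem_nhds (mem_chart_target ℂ a))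
  exact ⟨ε / 4, by positivity, by rwa [mul_div_cancel₀ _ (by norm_num)]⟩

/-- A radius such that the disc of four times this radius lies in the target of the preferred
chart. -/
noncomputable def chartRadius (a : X) : ℝ := (exists_closedBall_subset_target a).choose

theorem chartRadius_pos (a : X) : 0 < chartRadius a :=
  (exists_closedBall_subset_target a).choose_spec.1

theorem closedBall_subset_target (a : X) :
    Metric.closedBall (chartAt ℂ a a) (4 * chartRadius a) ⊆ (chartAt ℂ a).target :=
  (exists_closedBall_subset_target a).choose_spec.2

/-- The coordinate disc at `a` of radius `chartRadius a`. -/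
def coordDisc (a : X) : Set X :=
  (chartAt ℂ a).source ∩ chartAt ℂ a ⁻¹' Metric.ball (chartAt ℂ a a) (chartRadius a)

theorem isOpen_coordDisc (a : X) : IsOpen (coordDisc a) :=
  (chartAt ℂ a).isOpen_inter_preimage Metric.isOpen_ball

theorem mem_coordDisc (a : X) : a ∈ coordDisc a :=
  ⟨mem_chart_source ℂ a, Metric.mem_ball_self (chartRadius_pos a)⟩

/-- The cut-off function of the logarithmic kernel near `a`. -/
noncomputable def kernelBump (a : X) : ContDiffBump (0 : ℂ) :=
  ⟨chartRadius a / 2, chartRadius a, by have := chartRadius_pos a; positivity,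
    by have := chartRadius_pos a; linarith⟩

/-- The cut-off function in the chart at `a`. -/
noncomputable def chartBump (a : X) : ContDiffBump (chartAt ℂ a a) :=
  ⟨2 * chartRadius a, 3 * chartRadius a, by have := chartRadius_pos a; positivity,
    by have := chartRadius_pos a; linarith⟩

theorem tsupport_chartBump_subset (a : X) : tsupport (chartBump a) ⊆ (chartAt ℂ a).target := by
  rw [(chartBump a).tsupport_eq]
  refine (Metric.closedBall_subset_closedBall ?_).trans (closedBall_subset_target a)
  have := chartRadius_pos a
  change 3 * chartRadius a ≤ _
  linarith

theorem chartBump_eq_one {a : X} {z : ℂ}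
    (hz : z ∈ Metric.ball (chartAt ℂ a a) (2 * chartRadius a)) : chartBump a z = 1 :=
  (chartBump a).one_of_mem_closedBall (Metric.ball_subset_closedBall hz)

theorem ball_subset_target (a : X) :
    Metric.ball (chartAt ℂ a a) (2 * chartRadius a) ⊆ (chartAt ℂ a).target := by
  refine Metric.ball_subset_closedBall.trans ((Metric.closedBall_subset_closedBall ?_).trans
    (closedBall_subset_target a))
  have := chartRadius_pos a
  linarith

theorem ball_subset_target' (a : X) :
    Metric.ball (chartAt ℂ a a) (chartRadius a) ⊆ (chartAt ℂ a).target := by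
  refine (Metric.ball_subset_ball ?_).trans (ball_subset_target a)
  have := chartRadius_pos a
  linarith

variable (η : KahlerForm X)

/-- The coefficient of the form in the chart at `a`, cut off to a test function. -/
noncomputable def localDensity (a : X) (z : ℂ) : ℝ :=
  chartBump a z * η.density (chartAt ℂ a) z

/-- The inverse of the coefficient of the form in the chart at `a`, cut off to a test function. -/
noncomputable def localWeight (a : X) (z : ℂ) : ℝ :=
  chartBump a z * (η.density (chartAt ℂ a) z)⁻¹

theorem contDiff_localDensity (a : X) : ContDiff ℝ ∞ (localDensity η a) :=
  contDiff_mul_of_tsupport_subset (chartAt ℂ a).open_target (chartBump a).contDiff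
    (η.contDiffOn _ (chart_mem_atlas ℂ a)) (tsupport_chartBump_subset a)

theorem contDiff_localWeight (a : X) : ContDiff ℝ ∞ (localWeight η a) :=
  contDiff_mul_of_tsupport_subset (chartAt ℂ a).open_target (chartBump a).contDiff
    ((η.contDiffOn _ (chart_mem_atlas ℂ a)).inv fun z hz ↦
      (η.pos _ (chart_mem_atlas ℂ a) z hz).ne') (tsupport_chartBump_subset a)

theorem hasCompactSupport_localDensity (a : X) : HasCompactSupport (localDensity η a) :=
  (chartBump a).hasCompactSupport.mul_right

theorem hasCompactSupport_localWeight (a : X) : HasCompactSupport (localWeight η a) :=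
  (chartBump a).hasCompactSupport.mul_right

theorem localWeight_nonneg (a : X) (z : ℂ) : 0 ≤ localWeight η a z := by
  by_cases hz : z ∈ (chartAt ℂ a).target
  · exact mul_nonneg (chartBump a).nonneg (inv_nonneg.mpr (η.pos _ (chart_mem_atlas ℂ a) z hz).le)
  · have : chartBump a z = 0 := by
      by_contra h
      exact hz (tsupport_chartBump_subset a (subset_tsupport _ h))
    simp [localWeight, this]

theorem measurable_localWeight (a : X) :
    Measurable (fun z ↦ ENNReal.ofReal (localWeight η a z)) :=
  ENNReal.measurable_ofReal.comp (contDiff_localWeight η a).continuous.measurable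

variable [MeasurableSpace X] [BorelSpace X]

/-- The push-forward of `ν` to the chart at `a`, divided by the coefficient of the form. -/
noncomputable def weightedPush (ν : Measure X) (a : X) : Measure ℂ :=
  (chartPush (chartAt ℂ a) ν).withDensity (fun z ↦ ENNReal.ofReal (localWeight η a z))

instance (ν : Measure X) [IsFiniteMeasure ν] (a : X) : IsFiniteMeasure (weightedPush η ν a) := by
  obtain ⟨C, hC⟩ := (contDiff_localWeight η a).continuous.bounded_above_of_compact_support
    (hasCompactSupport_localWeight η a)
  refine isFiniteMeasure_withDensity (ne_top_of_le_ne_top ?_ (lintegral_mono (g := fun _ ↦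
    ENNReal.ofReal C) fun z ↦ ENNReal.ofReal_le_ofReal ((le_abs_self _).trans (hC z))))
  rw [lintegral_const]
  exact ENNReal.mul_ne_top ENNReal.ofReal_ne_top (measure_ne_top _ _)

theorem integral_weightedPush (ν : Measure X) (a : X) {g : ℂ → ℝ} (hg : Measurable g) :
    ∫ z, g z ∂(weightedPush η ν a)
      = ∫ x, chartFun (chartAt ℂ a) (fun z ↦ localWeight η a z * g z) x ∂ν := by
  rw [weightedPush, integral_withDensity_eq_integral_toReal_smul (measurable_localWeight η a)
    (by simp), ← integral_chartPush _ _ (g := fun z ↦ localWeight η a z * g z)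
      ((contDiff_localWeight η a).continuous.measurable.mul hg)]
  refine integral_congr_ae (Eventually.of_forall fun z ↦ ?_)
  simp [ENNReal.toReal_ofReal (localWeight_nonneg η a z)]

/-- The potential near `a` of the current `μ - η`, as determined by `μ` and by its negative
multiplied with the area form. -/
noncomputable def localPotential (μ ν : Measure X) (a x : X) : EReal :=
  canonicalPotential (kernelBump a) (localDensity η a) (chartPush (chartAt ℂ a) μ)
    (weightedPush η ν a) (chartAt ℂ a x)

/-- The identity of currents `μ = η + dd^c (-ν / η)`. -/
def IsCurrentPair (μ ν : Measure X) : Prop :=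
  ∀ φ : X → ℝ, ContMDiff 𝓘(ℝ, ℂ) 𝓘(ℝ, ℝ) ∞ φ →
    ∫ x, φ x ∂μ + ∫ x, η.ddc φ x ∂ν = ∫ x, φ x ∂η.measure

variable {η} [IsManifold 𝓘(ℂ) 1 X]

/-- The preferred charts at `a` and at `x` may differ; subharmonicity is known in any holomorphic
coordinate. -/
theorem quasiSubharmonicAt_localPotential (μ ν : Measure X) [IsFiniteMeasure μ]
    [IsFiniteMeasure ν] {a x : X} (hx : x ∈ (chartAt ℂ a).source) :
    QuasiSubharmonicAt (localPotential η μ ν a) x := by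
  set e := chartAt ℂ a
  set c := chartAt ℂ x
  have hcx : c x ∈ (c.symm.trans e).source := by
    rw [OpenPartialHomeomorph.trans_source]
    exact ⟨mem_chart_target ℂ x, by simpa [c, (chartAt ℂ x).left_inv (mem_chart_source ℂ x)]⟩
  obtain ⟨ρ₀, hρ₀, hsub⟩ := Metric.isOpen_iff.mp (c.symm.trans e).open_source _ hcx
  obtain ⟨ρ, hρ, hρρ, p, hp, hs⟩ := exists_subharmonicOn_canonicalPotential (kernelBump a)
    (contDiff_localDensity η a) (hasCompactSupport_localDensity η a) (chartPush e μ)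
    (weightedPush η ν a) hρ₀ ((analyticOnNhd_transition (chart_mem_atlas ℂ x)
      (chart_mem_atlas ℂ a)).mono hsub)
  refine ⟨Metric.ball (c x) ρ, Metric.isOpen_ball, Metric.mem_ball_self hρ, ?_, p, hp, hs⟩
  intro z hz
  have := hsub (Metric.ball_subset_ball hρρ hz)
  rw [OpenPartialHomeomorph.trans_source] at this
  exact this.1

/-- The integral with respect to the area form, for functions supported where `localDensity` is the
density of the form. -/
theorem integral_chartFun (a : X) {φ : ℂ → ℝ} (hφ : Measurable φ)
    (ht : Function.support φ ⊆ Metric.ball (chartAt ℂ a a) (2 * chartRadius a)) :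
    ∫ x, chartFun (chartAt ℂ a) φ x ∂η.measure = ∫ x, φ x * localDensity η a x := by
  have he : chartAt ℂ a ∈ atlas ℂ X := chart_mem_atlas ℂ a
  rw [← integral_chartPush _ _ hφ, chartPush_measure η he,
    integral_withDensity_eq_integral_toReal_smul₀ (η.aemeasurable_density he).ennreal_ofReal
      (by simp), ← integral_indicator (chartAt ℂ a).open_target.measurableSet]
  congr 1 with z
  by_cases hz : z ∈ Function.support φ
  · have hzt := ball_subset_target a (ht hz)
    rw [indicator_of_mem hzt, ENNReal.toReal_ofReal (η.pos _ he z hzt).le, localDensity,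
      chartBump_eq_one (ht hz), one_mul, smul_eq_mul, mul_comm]
  · simp [indicator, Function.notMem_support.1 hz]

variable [T2Space X]

/-- The identity of currents in the chart at `a`. -/
theorem IsCurrentPair.chart_identity {μ ν : Measure X} (h : IsCurrentPair η μ ν) (a : X)
    {φ : ℂ → ℝ} (hφ : ContDiff ℝ ∞ φ) (hφc : HasCompactSupport φ)
    (ht : tsupport φ ⊆ Metric.ball (chartAt ℂ a a) (2 * chartRadius a)) :
    ∫ x, φ x ∂(chartPush (chartAt ℂ a) μ) =
      (∫ x, φ x * localDensity η a x) - (2 * Real.pi)⁻¹ * ∫ x, Δ φ x ∂(weightedPush η ν a) := by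
  set e := chartAt ℂ a with he'
  have he : e ∈ atlas ℂ X := chart_mem_atlas ℂ a
  have hte : tsupport φ ⊆ e.target := ht.trans (ball_subset_target a)
  have h1 := h (chartFun e φ) (contMDiff_chartFun he hφ hφc hte)
  rw [integral_chartPush e μ hφ.continuous.measurable]
  have h2 : ∫ x, chartFun e φ x ∂η.measure = ∫ x, φ x * localDensity η a x :=
    integral_chartFun a hφ.continuous.measurable ((subset_tsupport φ).trans ht)
  have h3 : ∫ x, η.ddc (chartFun e φ) x ∂ν
      = (2 * Real.pi)⁻¹ * ∫ x, Δ φ x ∂(weightedPush η ν a) := by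
    rw [integral_weightedPush η ν a hφ.contDiff_laplacian.continuous.measurable,
      ← integral_const_mul]
    congr 1 with x
    by_cases hx : x ∈ e.source
    · rw [η.ddc_chartFun he hx hφ, chartFun_of_mem hx, localWeight]
      by_cases hz : e x ∈ tsupport φ
      · rw [chartBump_eq_one (ht hz), one_mul, mul_div_assoc, mul_comm (_⁻¹) (Δ φ (e x)),
          ← div_eq_mul_inv]
      · have : Δ φ (e x) = 0 :=
          image_eq_zero_of_notMem_tsupport fun h ↦ hz (tsupport_laplacian_subset φ h)
        simp [this]
    · have h0 : chartFun e (fun z ↦ localWeight η a z * Δ φ z) x = 0 := indicator_of_notMem hx _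
      rw [h0, mul_zero]
      refine η.ddc_eq_zero (notMem_tsupport_iff_eventuallyEq.mp fun hxt ↦ hx ?_)
      obtain ⟨z, hz, rfl⟩ := tsupport_chartFun_subset hφc hte hxt
      exact e.map_target (hte hz)
  rw [h2, h3] at h1
  linarith

/-- Near `a`, the measure `ν` of a pair `(μ, ν)` is the negative of the local potential times the
area form. -/
theorem IsCurrentPair.restrict_coordDisc {μ ν : Measure X} [IsFiniteMeasure μ] [IsFiniteMeasure ν]
    (h : IsCurrentPair η μ ν) (a : X) :
    (∀ᵐ x ∂(η.measure.restrict (coordDisc a)), localPotential η μ ν a x ≤ 0 ∧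
      localPotential η μ ν a x ≠ ⊥) ∧
    ν.restrict (coordDisc a) = (η.measure.restrict (coordDisc a)).withDensity
      (fun x ↦ (-localPotential η μ ν a x).toENNReal) := by
  set e := chartAt ℂ a with he'
  have he : e ∈ atlas ℂ X := chart_mem_atlas ℂ a
  set δ := chartRadius a
  set B := Metric.ball (e a) δ with hB
  have hBt : B ⊆ e.target := ball_subset_target' a
  have hBm : MeasurableSet B := Metric.isOpen_ball.measurableSet
  set P := canonicalPotential (kernelBump a) (localDensity η a) (chartPush e μ)
    (weightedPush η ν a) with hP
  obtain ⟨h1, h2⟩ := restrict_eq_withDensity_canonicalPotential (kernelBump a)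
    (contDiff_localDensity η a) (hasCompactSupport_localDensity η a) (M := chartPush e μ)
    (N := weightedPush η ν a) (z₀ := e a) (δ := δ) (fun φ hφ hφc ht ↦
      h.chart_identity a hφ hφc (by
        refine ht.trans (Metric.ball_subset_ball ?_)
        change δ + δ ≤ 2 * δ
        linarith))
  rw [← hP] at h1 h2
  have hPm' : Measurable P := measurable_canonicalPotential (kernelBump a)
    (contDiff_localDensity η a) (hasCompactSupport_localDensity η a) _ _
  have hPm : Measurable (fun z ↦ (-P z).toENNReal) := by fun_prop
  have hηP := chartPush_measure η he
  have hac : chartPush e η.measure ≪ volume := by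
    rw [hηP]
    exact (withDensity_absolutelyContinuous _ _).trans Measure.restrict_le_self.absolutelyContinuous
  have hd {z : ℂ} (hz : z ∈ B) : localDensity η a z = η.density e z := by
    rw [localDensity, chartBump_eq_one (Metric.ball_subset_ball (by
      have := chartRadius_pos a
      linarith) hz), one_mul]
  have hw {z : ℂ} (hz : z ∈ B) : localWeight η a z = (η.density e z)⁻¹ := by
    rw [localWeight, chartBump_eq_one (Metric.ball_subset_ball (by
      have := chartRadius_pos a
      linarith) hz), one_mul]
  refine ⟨?_, Measure.ext fun A hA ↦ ?_⟩
  · rw [ae_restrict_iff' hBm] at h1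
    have h3 := ae_of_ae_map (measurable_chartMap e).aemeasurable (hac.ae_le h1)
    rw [ae_restrict_iff' e.open_source.measurableSet] at h3
    rw [ae_restrict_iff' (isOpen_coordDisc a).measurableSet]
    filter_upwards [h3] with x hx hxD
    have := hx hxD.1
    rw [chartMap_of_mem hxD.1] at this
    exact this hxD.2
  · set B' := B ∩ (e.target ∩ e.symm ⁻¹' A) with hB'
    have hB'm : MeasurableSet B' := hBm.inter (e.measurableSet_target_inter hA)
    have hset : A ∩ coordDisc a = e.source ∩ e ⁻¹' B' := by
      ext x
      constructor
      · rintro ⟨hxA, hxs, hxB⟩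
        refine ⟨hxs, hxB, e.map_source hxs, ?_⟩
        simpa [e.left_inv hxs] using hxA
      · rintro ⟨hxs, hxB, -, hxA⟩
        refine ⟨?_, hxs, hxB⟩
        simpa [e.left_inv hxs] using hxA
    have hldm : Measurable (fun z ↦ ENNReal.ofReal (localDensity η a z)) :=
      (contDiff_localDensity η a).continuous.measurable.ennreal_ofReal
    rw [Measure.restrict_apply hA, withDensity_apply _ hA, Measure.restrict_restrict hA, hset]
    change _ = ∫⁻ x in e.source ∩ e ⁻¹' B', (-P (e x)).toENNReal ∂η.measure
    rw [← setLIntegral_chartPush e _ hPm hB'm, hηP, ← chartPush_apply e ν hB'm]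
    calc chartPush e ν B'
        = ∫⁻ z in B', (fun z ↦ ENNReal.ofReal (localWeight η a z)) z
            * ENNReal.ofReal (localDensity η a z) ∂(chartPush e ν) := by
          rw [← setLIntegral_one]
          refine setLIntegral_congr_fun hB'm fun z hz ↦ ?_
          have hpos := η.pos e he z (hBt hz.1)
          simp only
          rw [hd hz.1, hw hz.1, ← ENNReal.ofReal_mul (inv_nonneg.mpr hpos.le),
            inv_mul_cancel₀ hpos.ne', ENNReal.ofReal_one]
      _ = ∫⁻ z in B', ENNReal.ofReal (localDensity η a z) ∂(weightedPush η ν a) := by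
          rw [weightedPush, setLIntegral_withDensity_eq_setLIntegral_mul _
            (measurable_localWeight η a) hldm hB'm]
          rfl
      _ = ∫⁻ z in B', (-P z).toENNReal * ENNReal.ofReal (localDensity η a z) := by
          rw [← Measure.restrict_restrict_of_subset (μ := weightedPush η ν a)
            (inter_subset_left : B' ⊆ B), h2, setLIntegral_withDensity_eq_setLIntegral_mul _
            hPm hldm hB'm, Measure.restrict_restrict_of_subset (inter_subset_left : B' ⊆ B)]
          rfl
      _ = _ := by
          rw [restrict_withDensity hB'm, lintegral_withDensity_eq_lintegral_mul₀
            ((η.aemeasurable_density he).ennreal_ofReal.mono_measure Measure.restrict_le_self)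
            hPm.aemeasurable, Measure.restrict_restrict_of_subset (inter_subset_left.trans hBt)]
          refine setLIntegral_congr_fun hB'm fun z hz ↦ ?_
          simp only [Pi.mul_apply]
          rw [hd hz.1, mul_comm]

end LocalPotential

/-! ### Potentials of type M and pairs of measures -/

section Pairs

variable {X : Type*} [TopologicalSpace X] [ChartedSpace ℂ X] [MeasurableSpace X] {η : KahlerForm X}

theorem EReal.toENNReal_neg_inj {a b : EReal} (ha : a ≤ 0) (hb : b ≤ 0)
    (h : (-a).toENNReal = (-b).toENNReal) : a = b := by
  have h1 : ((-a).toENNReal : EReal) = ((-b).toENNReal : EReal) := by rw [h]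
  rw [EReal.coe_toENNReal (by simpa using EReal.neg_le_neg_iff.mpr ha),
    EReal.coe_toENNReal (by simpa using EReal.neg_le_neg_iff.mpr hb)] at h1
  exact neg_injective h1

theorem IsPotentialM.nonpos {μ : Measure X} {U : X → EReal} (h : IsPotentialM η μ U) (x : X) :
    U x ≤ 0 := h.isGreatest.2 (mem_range_self x)

theorem EReal.toReal_toENNReal_neg {a : EReal} (ha : a ≤ 0) :
    ((-a).toENNReal).toReal = -a.toReal := by
  have h : 0 ≤ -a := by simpa using EReal.neg_le_neg_iff.mpr ha
  rw [EReal.toReal_toENNReal h, EReal.toReal_neg_eq]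

/-- The measure `-U η`. -/
noncomputable def negMeasure (η : KahlerForm X) (U : X → EReal) : Measure X :=
  η.measure.withDensity (fun x ↦ (-U x).toENNReal)

theorem negMeasure_univ (U : X → EReal) :
    negMeasure η U univ = ∫⁻ x, (-U x).toENNReal ∂η.measure := by
  rw [negMeasure, withDensity_apply _ MeasurableSet.univ, Measure.restrict_univ]

theorem isFiniteMeasure_negMeasure {U : X → EReal} (h0 : ∀ x, U x ≤ 0)
    (hbot : ∀ᵐ x ∂η.measure, U x ≠ ⊥) (hi : Integrable (fun x ↦ (U x).toReal) η.measure) :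
    IsFiniteMeasure (negMeasure η U) := by
  have h1 : (fun x ↦ (-U x).toENNReal) =ᵐ[η.measure] fun x ↦ ENNReal.ofReal (-(U x).toReal) := by
    filter_upwards [hbot] with x hx
    have hx0 := h0 x
    induction hU : U x with
    | bot => exact absurd hU hx
    | top => simp [hU] at hx0
    | coe t => rw [← EReal.coe_neg, EReal.toENNReal_of_ne_top (by simp)]; simp
  refine isFiniteMeasure_withDensity ?_
  rw [lintegral_congr_ae h1]
  exact (hi.neg.lintegral_lt_top).ne

theorem integral_negMeasure {U : X → EReal} (h0 : ∀ x, U x ≤ 0) (hm : Measurable U)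
    (hbot : ∀ᵐ x ∂η.measure, U x ≠ ⊥) (g : X → ℝ) :
    ∫ x, g x ∂(negMeasure η U) = -∫ x, (U x).toReal * g x ∂η.measure := by
  rw [negMeasure, integral_withDensity_eq_integral_toReal_smul (by fun_prop), ← integral_neg]
  · congr 1 with x
    rw [EReal.toReal_toENNReal_neg (h0 x), smul_eq_mul, neg_mul]
  · filter_upwards [hbot] with x hx
    rw [lt_top_iff_ne_top, Ne, EReal.toENNReal_eq_top_iff, EReal.neg_eq_top_iff]
    exact hx

theorem IsPotentialM.isFiniteMeasure {μ : Measure X} {U : X → EReal} (h : IsPotentialM η μ U) :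
    IsFiniteMeasure (negMeasure η U) :=
  isFiniteMeasure_negMeasure h.nonpos h.ae_ne_bot h.integrable

/-- The functional at a potential of type M, as an element of `[0, ∞]`. -/
theorem IsPotentialM.value_eq {μ : Measure X} {U : X → EReal} (h : IsPotentialM η μ U) :
    -erealIntegral η.measure U - erealIntegral μ U =
      ((∫⁻ x, (-U x).toENNReal ∂η.measure + ∫⁻ x, (-U x).toENNReal ∂μ : ℝ≥0∞) : EReal) := by
  have h1 : U = fun x ↦ -(((-U x).toENNReal : ℝ≥0∞) : EReal) := by
    ext x
    rw [EReal.coe_toENNReal (by simpa using EReal.neg_le_neg_iff.mpr (h.nonpos x)), neg_neg]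
  have e1 := erealIntegral_neg_coe η.measure (fun x ↦ (-U x).toENNReal)
  have e2 := erealIntegral_neg_coe μ (fun x ↦ (-U x).toENNReal)
  rw [← h1] at e1 e2
  rw [e1, e2, neg_neg, sub_eq_add_neg, neg_neg, EReal.coe_ennreal_add]

/-- Densities that define the same measure near `x` agree almost everywhere there. -/
theorem ae_eq_of_withDensity_eq {u v : X → EReal} {W : Set X} {ν : Measure X} [IsFiniteMeasure ν]
    (hu : AEMeasurable u (η.measure.restrict W)) (hv : AEMeasurable v (η.measure.restrict W))
    (hu0 : ∀ᵐ x ∂(η.measure.restrict W), u x ≤ 0) (hv0 : ∀ᵐ x ∂(η.measure.restrict W), v x ≤ 0)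
    (h1 : ν.restrict W = (η.measure.restrict W).withDensity (fun x ↦ (-u x).toENNReal))
    (h2 : ν.restrict W = (η.measure.restrict W).withDensity (fun x ↦ (-v x).toENNReal)) :
    ∀ᵐ x ∂(η.measure.restrict W), u x = v x := by
  have hfin : ∫⁻ x in W, (-u x).toENNReal ∂η.measure ≠ ⊤ := by
    have : ν.restrict W univ ≠ ⊤ := measure_ne_top _ _
    rwa [h1, withDensity_apply _ MeasurableSet.univ, Measure.restrict_univ] at this
  have h3 := (withDensity_eq_iff (by fun_prop) (by fun_prop) hfin).mp (h1.symm.trans h2)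
  filter_upwards [h3, hu0, hv0] with x hx a b using EReal.toENNReal_neg_inj a b hx

variable [BorelSpace X]

theorem IsPotentialM.measurable {μ : Measure X} {U : X → EReal} (h : IsPotentialM η μ U) :
    Measurable U := h.quasiSubharmonic.measurable

/-- The measure `ν` of the pair is `-U η`. -/
theorem IsPotentialM.isCurrentPair {μ : Measure X} {U : X → EReal} (h : IsPotentialM η μ U) :
    IsCurrentPair η μ (negMeasure η U) := by
  intro φ hφ
  rw [integral_negMeasure h.nonpos h.measurable h.ae_ne_bot, h.current_eq φ hφ]
  ring

theorem aemeasurable_localPotential (μ ν : Measure X) [IsFiniteMeasure μ] [IsFiniteMeasure ν]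
    (a : X) : AEMeasurable (localPotential η μ ν a) (η.measure.restrict (coordDisc a)) := by
  have h := (measurable_canonicalPotential (kernelBump a) (contDiff_localDensity η a)
    (hasCompactSupport_localDensity η a) (chartPush (chartAt ℂ a) μ)
    (weightedPush η ν a)).comp (measurable_chartMap (chartAt ℂ a))
  refine h.aemeasurable.congr ?_
  filter_upwards [ae_restrict_mem (isOpen_coordDisc a).measurableSet] with x hx
  rw [Function.comp_apply, chartMap_of_mem hx.1, localPotential]

variable [IsManifold 𝓘(ℂ) 1 X]

/-- Two quasi-subharmonic functions that agree almost everywhere agree. -/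
theorem QuasiSubharmonicAt.eq_of_ae_eq {u v : X → EReal} {x : X} (hu : QuasiSubharmonicAt u x)
    (hv : QuasiSubharmonicAt v x) {W : Set X} (hW : IsOpen W) (hx : x ∈ W)
    (h : ∀ᵐ y ∂(η.measure.restrict W), u y = v y) : u x = v x :=
  le_antisymm
    (hu.le_of_ae_le η hv.upperSemicontinuousAt hW hx (h.mono fun _ hy ↦ hy.le))
    (hv.le_of_ae_le η hu.upperSemicontinuousAt hW hx (h.mono fun _ hy ↦ hy.ge))

variable [T2Space X]

theorem IsCurrentPair.localPotential_nonpos {μ ν : Measure X} [IsFiniteMeasure μ]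
    [IsFiniteMeasure ν] (h : IsCurrentPair η μ ν) {a x : X} (hx : x ∈ coordDisc a) :
    localPotential η μ ν a x ≤ 0 :=
  (quasiSubharmonicAt_localPotential μ ν hx.1).le_of_ae_le η (v := fun _ ↦ 0)
    (upperSemicontinuous_const.upperSemicontinuousAt x) (isOpen_coordDisc a) hx
    ((h.restrict_coordDisc a).1.mono fun _ hy ↦ hy.1)

/-- Everywhere, and not only almost everywhere, a potential of type M is given by the explicit
formula in a coordinate disc. -/
theorem IsPotentialM.eq_localPotential {μ : Measure X} [IsFiniteMeasure μ] {U : X → EReal}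
    (h : IsPotentialM η μ U) {a x : X} (hx : x ∈ coordDisc a) :
    U x = localPotential η μ (negMeasure η U) a x := by
  have := h.isFiniteMeasure
  have hp := h.isCurrentPair.restrict_coordDisc a
  refine (quasiSubharmonic_iff.mp h.quasiSubharmonic x).eq_of_ae_eq
    (quasiSubharmonicAt_localPotential μ _ hx.1) (isOpen_coordDisc a) hx (η := η)
    (ae_eq_of_withDensity_eq (ν := negMeasure η U) h.measurable.aemeasurable
      (aemeasurable_localPotential μ _ a) (Eventually.of_forall h.nonpos)
      (hp.1.mono fun _ hy ↦ hy.1) ?_ hp.2)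
  rw [negMeasure, restrict_withDensity (isOpen_coordDisc a).measurableSet]

/-- The function that equals near each point the local potential of a pair of measures. -/
noncomputable def pairPotential (η : KahlerForm X) (μ ν : Measure X) (x : X) : EReal :=
  localPotential η μ ν x x

/-- The local potentials in different coordinate discs agree where both are defined, since they are
quasi-subharmonic and densities of the same measure. -/
theorem IsCurrentPair.pairPotential_eq {μ ν : Measure X} [IsFiniteMeasure μ] [IsFiniteMeasure ν]
    (h : IsCurrentPair η μ ν) {a x : X} (hx : x ∈ coordDisc a) :
    pairPotential η μ ν x = localPotential η μ ν a x := by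
  have ha := h.restrict_coordDisc a
  have hb := h.restrict_coordDisc x
  have hab : IsOpen (coordDisc x ∩ coordDisc a) :=
    (isOpen_coordDisc x).inter (isOpen_coordDisc a)
  have hle1 : η.measure.restrict (coordDisc x ∩ coordDisc a) ≤ η.measure.restrict (coordDisc x) :=
    Measure.restrict_mono inter_subset_left le_rfl
  have hle2 : η.measure.restrict (coordDisc x ∩ coordDisc a) ≤ η.measure.restrict (coordDisc a) :=
    Measure.restrict_mono inter_subset_right le_rfl
  refine (quasiSubharmonicAt_localPotential μ ν (mem_coordDisc x).1).eq_of_ae_eq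
    (quasiSubharmonicAt_localPotential μ ν hx.1) hab ⟨mem_coordDisc x, hx⟩ (η := η)
    (ae_eq_of_withDensity_eq (ν := ν) ((aemeasurable_localPotential μ ν x).mono_measure hle1)
      ((aemeasurable_localPotential μ ν a).mono_measure hle2)
      (ae_mono hle1 (hb.1.mono fun _ hy ↦ hy.1)) (ae_mono hle2 (ha.1.mono fun _ hy ↦ hy.1)) ?_ ?_)
  · have := congrArg (fun m : Measure X ↦ m.restrict (coordDisc x ∩ coordDisc a)) hb.2
    simp only [restrict_withDensity hab.measurableSet] at this
    rwa [Measure.restrict_restrict_of_subset inter_subset_left,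
      Measure.restrict_restrict_of_subset inter_subset_left] at this
  · have := congrArg (fun m : Measure X ↦ m.restrict (coordDisc x ∩ coordDisc a)) ha.2
    simp only [restrict_withDensity hab.measurableSet] at this
    rwa [Measure.restrict_restrict_of_subset inter_subset_right,
      Measure.restrict_restrict_of_subset inter_subset_right] at this

theorem IsCurrentPair.quasiSubharmonic_pairPotential {μ ν : Measure X} [IsFiniteMeasure μ]
    [IsFiniteMeasure ν] (h : IsCurrentPair η μ ν) : QuasiSubharmonic (pairPotential η μ ν) :=
  quasiSubharmonic_iff.mpr fun x ↦
    (quasiSubharmonicAt_localPotential μ ν (mem_coordDisc x).1).congr (by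
      filter_upwards [(isOpen_coordDisc x).mem_nhds (mem_coordDisc x)] with y hy
      exact (h.pairPotential_eq hy).symm)

theorem IsCurrentPair.pairPotential_nonpos {μ ν : Measure X} [IsFiniteMeasure μ]
    [IsFiniteMeasure ν] (h : IsCurrentPair η μ ν) (x : X) : pairPotential η μ ν x ≤ 0 :=
  h.localPotential_nonpos (mem_coordDisc x)

variable [CompactSpace X]

theorem exists_finset_iUnion_coordDisc (X : Type*) [TopologicalSpace X] [ChartedSpace ℂ X]
    [CompactSpace X] : ∃ s : Finset X, ⋃ a : s, coordDisc (a : X) = univ := by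
  obtain ⟨s, hs⟩ := isCompact_univ.elim_finite_subcover (fun a : X ↦ coordDisc a)
    isOpen_coordDisc fun x _ ↦ mem_iUnion.mpr ⟨x, mem_coordDisc x⟩
  refine ⟨s, eq_univ_of_univ_subset (hs.trans ?_)⟩
  intro x hx
  simp only [mem_iUnion] at hx ⊢
  obtain ⟨a, ha, hxa⟩ := hx
  exact ⟨⟨a, ha⟩, hxa⟩

theorem IsCurrentPair.ae_ne_bot {μ ν : Measure X} [IsFiniteMeasure μ] [IsFiniteMeasure ν]
    (h : IsCurrentPair η μ ν) : ∀ᵐ x ∂η.measure, pairPotential η μ ν x ≠ ⊥ := by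
  obtain ⟨s, hs⟩ := exists_finset_iUnion_coordDisc X
  rw [← Measure.restrict_univ (μ := η.measure), ← hs, ae_restrict_iUnion_iff]
  intro a
  filter_upwards [(h.restrict_coordDisc (a : X)).1,
    ae_restrict_mem (isOpen_coordDisc (a : X)).measurableSet] with x hx hxa
  rw [h.pairPotential_eq hxa]
  exact hx.2

/-- The measure `ν` of a pair is recovered from its potential. -/
theorem IsCurrentPair.negMeasure_eq {μ ν : Measure X} [IsFiniteMeasure μ] [IsFiniteMeasure ν]
    (h : IsCurrentPair η μ ν) : negMeasure η (pairPotential η μ ν) = ν := by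
  obtain ⟨s, hs⟩ := exists_finset_iUnion_coordDisc X
  refine Measure.ext_of_iUnion_eq_univ hs fun a ↦ ?_
  rw [negMeasure, restrict_withDensity (isOpen_coordDisc (a : X)).measurableSet,
    (h.restrict_coordDisc (a : X)).2]
  refine withDensity_congr_ae ?_
  filter_upwards [ae_restrict_mem (isOpen_coordDisc (a : X)).measurableSet] with x hxa
  rw [h.pairPotential_eq hxa]

/-- A pair of measures comes from a potential, which is of type M when it attains the value `0`. -/
theorem IsCurrentPair.isPotentialM {μ ν : Measure X} [IsFiniteMeasure μ] [IsFiniteMeasure ν]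
    (h : IsCurrentPair η μ ν) {x : X} (hx : pairPotential η μ ν x = 0) :
    IsPotentialM η μ (pairPotential η μ ν) where
  quasiSubharmonic := h.quasiSubharmonic_pairPotential
  ae_ne_bot := h.ae_ne_bot
  integrable := by
    have hm := h.quasiSubharmonic_pairPotential.measurable
    have h1 : ∫⁻ x, (-pairPotential η μ ν x).toENNReal ∂η.measure ≠ ⊤ := by
      have h2 : ν univ ≠ ⊤ := measure_ne_top _ _
      rw [← h.negMeasure_eq, negMeasure, withDensity_apply _ MeasurableSet.univ,
        Measure.restrict_univ] at h2
      exact h2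
    have h2 := integrable_toReal_of_lintegral_ne_top (by fun_prop) h1
    refine h2.neg.congr (Eventually.of_forall fun x ↦ ?_)
    simp only [Pi.neg_apply]
    rw [EReal.toReal_toENNReal_neg (h.pairPotential_nonpos x), neg_neg]
  current_eq := fun φ hφ ↦ by
    have h1 := h φ hφ
    rw [← h.negMeasure_eq, integral_negMeasure h.pairPotential_nonpos
      h.quasiSubharmonic_pairPotential.measurable h.ae_ne_bot] at h1
    linarith
  isGreatest := ⟨⟨x, hx⟩, by rintro _ ⟨y, rfl⟩; exact h.pairPotential_nonpos y⟩

end Pairs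

/-! ### Weak convergence of probability measures and varying integrands -/

section WeakConvergence

variable {X : Type*} [TopologicalSpace X] [MeasurableSpace X] [BorelSpace X]

/-- As `X` is compact, the integrands converge uniformly when the parameter converges. -/
theorem tendsto_integral_of_continuous_uncurry [CompactSpace X] {Y : Type*} [TopologicalSpace Y]
    {ι : Type*} {l : Filter ι} {p : ι → ProbabilityMeasure X} {q : ProbabilityMeasure X}
    (hp : Tendsto p l (𝓝 q)) {G : Y × X → ℝ} (hG : Continuous G) {y : ι → Y} {y₀ : Y}
    (hy : Tendsto y l (𝓝 y₀)) :
    Tendsto (fun i ↦ ∫ x, G (y i, x) ∂(p i : Measure X)) l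
      (𝓝 (∫ x, G (y₀, x) ∂(q : Measure X))) := by
  let c : C(Y, C(X, ℝ)) := ContinuousMap.curry ⟨G, hG⟩
  have hc : Tendsto (fun i ↦ ‖c (y i) - c y₀‖) l (𝓝 0) := by
    have h1 := (c.continuous.tendsto y₀).comp hy
    exact tendsto_iff_norm_sub_tendsto_zero.mp h1
  have h1 := ProbabilityMeasure.tendsto_iff_forall_integral_tendsto.mp hp
    (BoundedContinuousFunction.mkOfCompact (c y₀))
  have hint : ∀ i (f : C(X, ℝ)), Integrable f (p i : Measure X) := fun i f ↦
    (BoundedContinuousFunction.mkOfCompact f).integrable _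
  have h2 : Tendsto (fun i ↦ ∫ x, c (y i) x ∂(p i : Measure X) - ∫ x, c y₀ x ∂(p i : Measure X)) l
      (𝓝 0) := by
    refine squeeze_zero_norm (fun i ↦ ?_) hc
    rw [← integral_sub (hint i _) (hint i _)]
    have h3 := norm_integral_le_of_norm_le_const (μ := (p i : Measure X))
      (f := fun x ↦ c (y i) x - c y₀ x) (C := ‖c (y i) - c y₀‖)
      (Eventually.of_forall fun x ↦ (c (y i) - c y₀).norm_coe_le_norm x)
    simpa using h3
  have h3 := h2.add h1
  simp only [zero_add] at h3
  refine h3.congr fun i ↦ ?_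
  change _ - _ + ∫ x, c y₀ x ∂(p i : Measure X) = _
  rw [sub_add_cancel]
  rfl

variable [HasOuterApproxClosed X]

/-- The portmanteau theorem for the superlevel sets of a sequence of functions: the set `{t < g}` is
the increasing union of open sets on which eventually `t < f i`. -/
theorem measure_superlevel_le_liminf {ι : Type*} {l : Filter ι} [l.IsCountablyGenerated]
    {p : ι → ProbabilityMeasure X} {q : ProbabilityMeasure X} (hp : Tendsto p l (𝓝 q))
    {f : ι → X → ℝ} {g : X → ℝ} {t : ℝ}
    (h : ∀ x, t < g x → ∀ᶠ z in l ×ˢ 𝓝 x, t < f z.1 z.2) :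
    (q : Measure X) {x | t < g x} ≤ l.liminf fun i ↦ (p i : Measure X) {x | t < f i x} := by
  obtain ⟨s, hs⟩ := l.exists_antitone_basis
  set O : ℕ → Set X := fun N ↦ interior {y | ∀ i ∈ s N, t < f i y} with hO
  have hmono : Monotone O := fun m n hmn ↦ interior_mono fun y hy i hi ↦ hy i (hs.2 hmn hi)
  have hcov : {x | t < g x} ⊆ ⋃ N, O N := fun x hx ↦ by
    obtain ⟨S, hS, V, hV, hSV⟩ := eventually_prod_iff.mp (h x hx)
    obtain ⟨N, -, hN⟩ := hs.1.mem_iff.mp hS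
    refine mem_iUnion.mpr ⟨N, mem_interior_iff_mem_nhds.mpr ?_⟩
    filter_upwards [hV] with y hy i hi using hSV (hN hi) hy
  refine (measure_mono hcov).trans ?_
  rw [hmono.measure_iUnion]
  refine iSup_le fun N ↦ ?_
  refine (ProbabilityMeasure.le_liminf_measure_open_of_tendsto hp isOpen_interior).trans ?_
  refine liminf_le_liminf ?_
  filter_upwards [hs.1.mem_of_mem (i := N) trivial] with i hi
  exact measure_mono fun y hy ↦ interior_subset hy i hi

/-- Fatou's lemma for weakly convergent probability measures and integrands that are lower
semicontinuous along the sequence; it follows by the layer cake formula from the portmanteau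
theorem for open sets. -/
theorem lintegral_le_liminf_of_tendsto {ι : Type*} {l : Filter ι} [l.IsCountablyGenerated]
    {p : ι → ProbabilityMeasure X} {q : ProbabilityMeasure X} (hp : Tendsto p l (𝓝 q))
    {f : ι → X → ℝ≥0∞} {g : X → ℝ≥0∞} (hf : ∀ i, Measurable (f i)) (hg : Measurable g)
    (h : ∀ x, ∀ t < g x, ∀ᶠ z in l ×ˢ 𝓝 x, t < f z.1 z.2) :
    ∫⁻ x, g x ∂(q : Measure X) ≤ l.liminf fun i ↦ ∫⁻ x, f i x ∂(p i : Measure X) := by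
  -- Truncation reduces to real valued integrands, for which there is the layer cake formula.
  have key : ∀ K : ℕ, ∫⁻ x, min (g x) K ∂(q : Measure X)
      ≤ l.liminf fun i ↦ ∫⁻ x, f i x ∂(p i : Measure X) := fun K ↦ by
    have hne : ∀ a : ℝ≥0∞, min a K ≠ ⊤ := fun a ↦
      ne_top_of_le_ne_top (ENNReal.natCast_ne_top K) (min_le_right _ _)
    have layer : ∀ (m : Measure X) (u : X → ℝ≥0∞), Measurable u →
        ∫⁻ x, min (u x) K ∂m = ∫⁻ t in Ioi (0 : ℝ), m {x | t < (min (u x) K).toReal} := by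
      intro m u hu
      rw [← lintegral_eq_lintegral_meas_lt m (Eventually.of_forall fun _ ↦ ENNReal.toReal_nonneg)
        (by fun_prop)]
      exact lintegral_congr fun x ↦ (ENNReal.ofReal_toReal (hne _)).symm
    rw [layer _ g hg]
    calc ∫⁻ t in Ioi (0 : ℝ), (q : Measure X) {x | t < (min (g x) K).toReal}
        ≤ ∫⁻ t in Ioi (0 : ℝ),
            l.liminf fun i ↦ (p i : Measure X) {x | t < (min (f i x) K).toReal} := by
          refine setLIntegral_mono_ae' measurableSet_Ioi (Eventually.of_forall fun t ht ↦ ?_)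
          refine measure_superlevel_le_liminf hp fun x hx ↦ ?_
          have e : ∀ a : ℝ≥0∞, t < (min a K).toReal ↔ ENNReal.ofReal t < min a K := fun a ↦
            (ENNReal.ofReal_lt_iff_lt_toReal (le_of_lt ht) (hne a)).symm
          rw [e, lt_min_iff] at hx
          filter_upwards [h x _ hx.1] with z hz
          rw [e, lt_min_iff]
          exact ⟨hz, hx.2⟩
      _ ≤ l.liminf fun i ↦ ∫⁻ t in Ioi (0 : ℝ),
            (p i : Measure X) {x | t < (min (f i x) K).toReal} := by
          refine lintegral_liminf_le fun i ↦ Antitone.measurable fun a b hab ↦ ?_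
          exact measure_mono fun x hx ↦ lt_of_le_of_lt hab hx
      _ ≤ _ := by
          refine liminf_le_liminf (Eventually.of_forall fun i ↦ ?_)
          rw [← layer _ _ (hf i)]
          exact lintegral_mono fun x ↦ min_le_left _ _
  have hmono : Monotone fun (K : ℕ) x ↦ min (g x) (K : ℝ≥0∞) := fun a b hab x ↦
    min_le_min le_rfl (by exact_mod_cast hab)
  have hsup : ∀ x, g x = ⨆ K : ℕ, min (g x) (K : ℝ≥0∞) := fun x ↦ by
    refine le_antisymm (le_of_forall_lt fun c hc ↦ ?_) (iSup_le fun K ↦ min_le_left _ _)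
    obtain ⟨K, hK⟩ := ENNReal.exists_nat_gt (ne_top_of_lt hc)
    exact lt_iSup_iff.mpr ⟨K, lt_min hc hK⟩
  calc ∫⁻ x, g x ∂(q : Measure X) = ∫⁻ x, ⨆ K : ℕ, min (g x) (K : ℝ≥0∞) ∂(q : Measure X) :=
        lintegral_congr hsup
    _ = ⨆ K : ℕ, ∫⁻ x, min (g x) (K : ℝ≥0∞) ∂(q : Measure X) :=
        lintegral_iSup (fun K ↦ by fun_prop) hmono
    _ ≤ _ := iSup_le key

end WeakConvergence

/-! ### Limits of potentials -/

section Limits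

variable {X : Type*} [TopologicalSpace X]

/-- The coordinate map `chartMap` is discontinuous at the boundary of the chart, where the weight
vanishes. -/
theorem continuous_weight_mul [ChartedSpace ℂ X] {η : KahlerForm X} [T2Space X]
    [IsManifold 𝓘(ℂ) 1 X] (a : X) {ρ : ℂ → ℝ} (hρ : Continuous ρ) :
    Continuous (fun z : ℂ × X ↦ chartFun (chartAt ℂ a) (localWeight η a) z.2 *
      ρ (z.1 - chartMap (chartAt ℂ a) z.2)) := by
  set e := chartAt ℂ a with he'
  have hts : tsupport (localWeight η a) ⊆ e.target :=
    (tsupport_mul_subset_left).trans (tsupport_chartBump_subset a)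
  have hψ : Continuous (chartFun e (localWeight η a)) :=
    (contMDiff_chartFun (chart_mem_atlas ℂ a) (contDiff_localWeight η a)
      (hasCompactSupport_localWeight η a) hts).continuous
  refine continuous_iff_continuousAt.mpr fun ⟨y, t⟩ ↦ ?_
  by_cases ht : t ∈ e.source
  · refine (hψ.comp continuous_snd).continuousAt.mul ?_
    have h1 : ContinuousAt (fun z : ℂ × X ↦ ρ (z.1 - e z.2)) (y, t) :=
      hρ.continuousAt.comp (continuousAt_fst.sub
        (ContinuousAt.comp (f := Prod.snd) (e.continuousAt ht) continuousAt_snd))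
    refine h1.congr ?_
    filter_upwards [continuousAt_snd.eventually (e.open_source.mem_nhds ht)] with z hz
    rw [chartMap_of_mem hz]
  · have ht' : t ∉ tsupport (chartFun e (localWeight η a)) := fun h ↦ by
      obtain ⟨w, hw, rfl⟩ := tsupport_chartFun_subset (hasCompactSupport_localWeight η a) hts h
      exact ht (e.map_target (hts hw))
    refine (continuousAt_const (y := (0 : ℝ))).congr ?_
    filter_upwards [continuousAt_snd.eventually
      (notMem_tsupport_iff_eventuallyEq.mp ht')] with z hz
    simp [hz]

variable [MeasurableSpace X] [BorelSpace X]

/-- The logarithmic potential is jointly lower semicontinuous in the measure and the point. The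
restriction to the domain of the chart is harmless since this domain is open. -/
theorem logPotential_chartPush_le_liminf [HasOuterApproxClosed X] (b : ContDiffBump (0 : ℂ))
    (e : OpenPartialHomeomorph X ℂ) {ι : Type*} {l : Filter ι} [l.IsCountablyGenerated]
    {p : ι → ProbabilityMeasure X} {q : ProbabilityMeasure X} (hp : Tendsto p l (𝓝 q))
    {y : ι → ℂ} {y₀ : ℂ} (hy : Tendsto y l (𝓝 y₀)) :
    logPotential b (chartPush e q) y₀ ≤
      l.liminf fun i ↦ logPotential b (chartPush e (p i)) (y i) := by
  have hms := e.open_source.measurableSet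
  have heq : ∀ (μ : Measure X) (z : ℂ), logPotential b (chartPush e μ) z =
      ∫⁻ t, e.source.indicator (fun t ↦ logKernelE b (z - chartMap e t)) t ∂μ := fun μ z ↦ by
    rw [logPotential, lintegral_chartPush e μ (g := fun w ↦ logKernelE b (z - w))
      ((measurable_logKernelE b).comp (measurable_const.sub measurable_id)),
      lintegral_indicator hms]
    refine setLIntegral_congr_fun hms fun t ht ↦ ?_
    simp only [chartMap_of_mem ht]
  have hmeas : ∀ z : ℂ,
      Measurable (e.source.indicator (fun t ↦ logKernelE b (z - chartMap e t))) := fun z ↦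
    ((measurable_logKernelE b).comp (measurable_const.sub (measurable_chartMap e))).indicator hms
  simp only [heq]
  refine lintegral_le_liminf_of_tendsto hp (fun i ↦ hmeas _) (hmeas _) fun t s hs ↦ ?_
  have ht : t ∈ e.source := by
    by_contra h
    rw [indicator_of_notMem h] at hs
    exact not_lt_bot hs
  rw [indicator_of_mem ht, chartMap_of_mem ht] at hs
  have h1 : Tendsto (fun z : ι × X ↦ logKernelE b (y z.1 - e z.2)) (l ×ˢ 𝓝 t)
      (𝓝 (logKernelE b (y₀ - e t))) :=
    ((continuous_logKernelE b).tendsto _).comp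
      ((hy.comp tendsto_fst).sub ((e.continuousAt ht).tendsto.comp tendsto_snd))
  filter_upwards [h1.eventually_const_lt hs,
    tendsto_snd.eventually (e.open_source.mem_nhds ht)] with z hz1 hz2
  rw [indicator_of_mem hz2, chartMap_of_mem hz2]
  exact hz1

variable [ChartedSpace ℂ X] {η : KahlerForm X}

theorem smoothPart_weightedPush_smul (b : ContDiffBump (0 : ℂ)) (F : ℂ → ℝ) (c : NNReal)
    (m : Measure X) (a : X) (y : ℂ) :
    smoothPart b F (weightedPush η (c • m) a) y = planeConv (logKernel b) F y +
      (2 * Real.pi)⁻¹ * (c * ∫ t, chartFun (chartAt ℂ a) (localWeight η a) t *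
        logRemainder b (y - chartMap (chartAt ℂ a) t) ∂m) := by
  rw [smoothPart, convMeasure, integral_weightedPush η _ a
    (g := fun w ↦ logRemainder b (y - w)) ((contDiff_logRemainder b).continuous.measurable.comp
      (measurable_const.sub measurable_id)),
    integral_smul_nnreal_measure]
  congr 3
  congr 1 with t
  by_cases ht : t ∈ (chartAt ℂ a).source
  · simp only [chartFun_of_mem ht, chartMap_of_mem ht]
  · simp [chartFun, ht]

/-- The smooth part of the potential is continuous in the measure and the point. -/
theorem tendsto_smoothPart [T2Space X] [CompactSpace X] [IsManifold 𝓘(ℂ) 1 X]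
    (a : X) {ι : Type*} {l : Filter ι} {m : ι → ProbabilityMeasure X} {m₀ : ProbabilityMeasure X}
    (hm : Tendsto m l (𝓝 m₀)) {c : ι → NNReal} {c₀ : NNReal} (hc : Tendsto c l (𝓝 c₀))
    {y : ι → ℂ} {y₀ : ℂ} (hy : Tendsto y l (𝓝 y₀)) :
    Tendsto (fun i ↦ smoothPart (kernelBump a) (localDensity η a)
      (weightedPush η (c i • (m i : Measure X)) a) (y i)) l
      (𝓝 (smoothPart (kernelBump a) (localDensity η a)
        (weightedPush η (c₀ • (m₀ : Measure X)) a) y₀)) := by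
  simp only [smoothPart_weightedPush_smul]
  refine Tendsto.add ?_ (Tendsto.mul tendsto_const_nhds (Tendsto.mul ?_ ?_))
  · exact ((contDiff_planeConv (integrable_logKernel (kernelBump a)).locallyIntegrable
      (contDiff_localDensity η a)
      (hasCompactSupport_localDensity η a)).continuous.tendsto y₀).comp hy
  · exact (NNReal.continuous_coe.tendsto c₀).comp hc
  · exact tendsto_integral_of_continuous_uncurry hm
      (continuous_weight_mul a (contDiff_logRemainder (kernelBump a)).continuous) hy

/-- The potentials are jointly upper semicontinuous in the measures and the point. -/
theorem eventually_lt_neg_localPotential [HasOuterApproxClosed X] [T2Space X] [CompactSpace X]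
    [IsManifold 𝓘(ℂ) 1 X] {a : X} {ι : Type*} {l : Filter ι} [l.IsCountablyGenerated]
    {p m : ι → ProbabilityMeasure X} {p₀ m₀ : ProbabilityMeasure X} (hp : Tendsto p l (𝓝 p₀))
    (hm : Tendsto m l (𝓝 m₀)) {c : ι → NNReal} {c₀ : NNReal} (hc : Tendsto c l (𝓝 c₀))
    {x : ι → X} {x₀ : X} (hx : Tendsto x l (𝓝 x₀)) (hx₀ : x₀ ∈ (chartAt ℂ a).source) {t : ℝ}
    (ht : (t : EReal) < -localPotential η p₀ (c₀ • (m₀ : Measure X)) a x₀) :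
    ∀ᶠ i in l, (t : EReal) < -localPotential η (p i) (c i • (m i : Measure X)) a (x i) := by
  have hy : Tendsto (fun i ↦ chartAt ℂ a (x i)) l (𝓝 (chartAt ℂ a x₀)) :=
    ((chartAt ℂ a).continuousAt hx₀).tendsto.comp hx
  have hs := tendsto_smoothPart (η := η) a hm hc hy
  have hl := logPotential_chartPush_le_liminf (kernelBump a) (chartAt ℂ a) hp hy
  have hneg : ∀ (s : ℝ) (Φ : ℝ≥0∞), (t : EReal) < -((s : EReal) - (Φ : EReal)) ↔
      ((t + s : ℝ) : EReal) < (Φ : EReal) := fun s Φ ↦ by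
    induction Φ with
    | top =>
      have h1 : ((t + s : ℝ) : EReal) < ((⊤ : ℝ≥0∞) : EReal) := EReal.coe_lt_top _
      have h2 : (t : EReal) < -((s : EReal) - ((⊤ : ℝ≥0∞) : EReal)) := by
        simp [EReal.coe_lt_top]
      exact iff_of_true h2 h1
    | coe r =>
      have e1 : (((r : NNReal) : ℝ≥0∞) : EReal) = ((r : ℝ) : EReal) := rfl
      rw [e1, ← EReal.coe_sub, ← EReal.coe_neg, EReal.coe_lt_coe_iff, EReal.coe_lt_coe_iff]
      constructor <;> intro h <;> linarith
  simp only [localPotential, canonicalPotential] at ht ⊢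
  rw [hneg] at ht
  simp only [hneg]
  obtain ⟨r, hr1, hr2⟩ := EReal.lt_iff_exists_real_btwn.mp ht
  have hr1' : t + smoothPart (kernelBump a) (localDensity η a)
      (weightedPush η (c₀ • (m₀ : Measure X)) a) (chartAt ℂ a x₀) < r := by exact_mod_cast hr1
  have h1 := (hs.const_add t).eventually_lt_const hr1'
  have h2 : ∀ᶠ i in l, (r : EReal) <
      (logPotential (kernelBump a) (chartPush (chartAt ℂ a) (p i)) (chartAt ℂ a (x i)) : EReal) ∨
      r < 0 := by
    rcases lt_or_ge r 0 with h | h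
    · exact Eventually.of_forall fun _ ↦ Or.inr h
    · have h3 : ENNReal.ofReal r < logPotential (kernelBump a) (chartPush (chartAt ℂ a) p₀)
          (chartAt ℂ a x₀) := by
        rw [← EReal.coe_ennreal_lt_coe_ennreal_iff, EReal.coe_ennreal_ofReal, max_eq_left h]
        exact hr2
      filter_upwards [eventually_lt_of_lt_liminf (h3.trans_le hl)] with i hi
      left
      rw [← EReal.coe_ennreal_lt_coe_ennreal_iff, EReal.coe_ennreal_ofReal, max_eq_left h] at hi
      exact hi
  filter_upwards [h1, h2] with i hi1 hi2
  have hi1' : ((t + smoothPart (kernelBump a) (localDensity η a)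
      (weightedPush η (c i • (m i : Measure X)) a) (chartAt ℂ a (x i)) : ℝ) : EReal)
        < (r : EReal) := by
    exact_mod_cast hi1
  rcases hi2 with h | h
  · exact hi1'.trans h
  · exact (hi1'.trans (by exact_mod_cast h)).trans_le (EReal.coe_ennreal_nonneg _)

end Limits

/-! ### Existence of a minimizer -/

section Minimizer

theorem metrizableSpace_of_chartedSpace (X : Type*) [TopologicalSpace X] [T2Space X]
    [CompactSpace X] [ChartedSpace ℂ X] : TopologicalSpace.MetrizableSpace X := by
  have := ChartedSpace.secondCountable_of_sigmaCompact ℂ X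
  exact TopologicalSpace.metrizableSpace_of_t3_secondCountable X

variable {X : Type*} [TopologicalSpace X] [ChartedSpace ℂ X] [MeasurableSpace X]
  {η : KahlerForm X}

/-- The value of the functional at a measure with potential `U`. -/
noncomputable def potentialEnergy (η : KahlerForm X) (μ : Measure X) (U : X → EReal) : ℝ≥0∞ :=
  ∫⁻ x, (-U x).toENNReal ∂η.measure + ∫⁻ x, (-U x).toENNReal ∂μ

/-- The values of the functional at the measures that do not charge `D` and have a potential of
type M. -/
def energySet (η : KahlerForm X) (D : Set X) : Set ℝ≥0∞ :=
  {v | ∃ μ ∈ measuresOff D, ∃ U, IsPotentialM η μ U ∧ v = potentialEnergy η μ U}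

/-- Measures without a potential of type M do not affect the minimum, since the functional is `⊤`
there. -/
theorem isLeast_holeFunctional {D : Set X} {v : ℝ≥0∞} (h : IsLeast (energySet η D) v) :
    IsLeast (holeFunctional η '' measuresOff D) (v : EReal) := by
  have hle : ∀ μ ∈ measuresOff D, (v : EReal) ≤ holeFunctional η μ := fun μ hμ ↦
    le_iInf₂ fun U hU ↦ by
      rw [hU.value_eq]
      exact EReal.coe_ennreal_le_coe_ennreal_iff.mpr (h.2 ⟨μ, hμ, U, hU, rfl⟩)
  obtain ⟨μ, hμ, U, hU, rfl⟩ := h.1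
  refine ⟨⟨μ, hμ, le_antisymm (iInf₂_le_of_le U hU ?_) (hle μ hμ)⟩, ?_⟩
  · rw [hU.value_eq]
    rfl
  · rintro _ ⟨μ', hμ', rfl⟩
    exact hle μ' hμ'

variable [T2Space X] [CompactSpace X] [BorelSpace X] [IsManifold 𝓘(ℂ) 1 X]

/-- Limits of potentials of type M: if the measures, the measures `-U η = c m` and the points where
the potentials vanish converge, then the limit of the measures has a potential of type M, and the
energy is lower semicontinuous. -/
theorem exists_isPotentialM_of_tendsto {p m : ℕ → ProbabilityMeasure X}
    {p₀ m₀ : ProbabilityMeasure X} (hp : Tendsto p atTop (𝓝 p₀)) (hm : Tendsto m atTop (𝓝 m₀))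
    {c : ℕ → NNReal} {c₀ : NNReal} (hc : Tendsto c atTop (𝓝 c₀)) {x : ℕ → X} {x₀ : X}
    (hx : Tendsto x atTop (𝓝 x₀)) {U : ℕ → X → EReal}
    (hU : ∀ n, IsPotentialM η (p n) (U n)) (hx0 : ∀ n, U n (x n) = 0)
    (hUm : ∀ n, negMeasure η (U n) = c n • (m n : Measure X)) {v : ℝ≥0∞} (hv : v ≠ ⊤)
    (hval : Tendsto (fun n ↦ potentialEnergy η (p n) (U n)) atTop (𝓝 v)) :
    ∃ U₀, IsPotentialM η p₀ U₀ ∧ potentialEnergy η p₀ U₀ ≤ v := by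
  have := metrizableSpace_of_chartedSpace X
  let := TopologicalSpace.metrizableSpaceMetric X
  have hcont : ∀ f : X → ℝ, Continuous f → ∀ (r : ℕ → ProbabilityMeasure X) r₀,
      Tendsto r atTop (𝓝 r₀) →
      Tendsto (fun n ↦ ∫ y, f y ∂(r n : Measure X)) atTop (𝓝 (∫ y, f y ∂(r₀ : Measure X))) :=
    fun f hf r r₀ hr ↦ ProbabilityMeasure.tendsto_iff_forall_integral_tendsto.mp hr
      (BoundedContinuousFunction.mkOfCompact ⟨f, hf⟩)
  have hpair : IsCurrentPair η (p₀ : Measure X) (c₀ • (m₀ : Measure X)) := by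
    intro φ hφ
    have h1 := hcont φ hφ.continuous p p₀ hp
    have h2 := hcont _ (η.continuous_ddc hφ) m m₀ hm
    have h3 := h1.add (((NNReal.continuous_coe.tendsto c₀).comp hc).mul h2)
    have h4 : ∀ n, ∫ y, φ y ∂(p n : Measure X) + (c n : ℝ) * ∫ y, η.ddc φ y ∂(m n : Measure X)
        = ∫ y, φ y ∂η.measure := fun n ↦ by
      have := (hU n).isCurrentPair φ hφ
      rw [hUm, integral_smul_nnreal_measure] at this
      exact this
    rw [integral_smul_nnreal_measure]
    exact tendsto_nhds_unique (h3.congr h4) tendsto_const_nhds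
  set U₀ := pairPotential η (p₀ : Measure X) (c₀ • (m₀ : Measure X)) with hU₀
  -- The negatives of the potentials are lower semicontinuous along the sequence.
  have key : ∀ y, ∀ t : ℝ, (t : EReal) < -U₀ y →
      ∀ᶠ z in atTop ×ˢ 𝓝 y, (t : EReal) < -U z.1 z.2 := by
    intro y t ht
    have h1 := eventually_lt_neg_localPotential (η := η) (a := y) (l := atTop ×ˢ 𝓝 y)
      (hp.comp tendsto_fst) (hm.comp tendsto_fst) (hc.comp tendsto_fst)
      (x := fun z : ℕ × X ↦ z.2) tendsto_snd (mem_chart_source ℂ y) ht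
    filter_upwards [h1, tendsto_snd.eventually ((isOpen_coordDisc y).mem_nhds (mem_coordDisc y))]
      with z hz hzd
    rw [(hU z.1).eq_localPotential hzd, hUm]
    exact hz
  have hU₀le : ∀ y, U₀ y ≤ 0 := hpair.pairPotential_nonpos
  have hmax : U₀ x₀ = 0 := by
    refine le_antisymm (hU₀le x₀) ?_
    by_contra hneg
    push Not at hneg
    have h1 : ((0 : ℝ) : EReal) < -U₀ x₀ := by
      rw [EReal.coe_zero, ← neg_zero]
      exact EReal.neg_lt_neg_iff.mpr hneg
    have h2 := (tendsto_id.prodMk hx).eventually (key x₀ 0 h1)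
    obtain ⟨n, hn⟩ := h2.exists
    simp [hx0] at hn
  have hpot : IsPotentialM η p₀ U₀ := hpair.isPotentialM hmax
  refine ⟨U₀, hpot, ?_⟩
  have hmass : ∀ (d : NNReal) (r : ProbabilityMeasure X), (d • (r : Measure X)) univ = d := by
    intro d r
    simp
  have ha : ∫⁻ y, (-U₀ y).toENNReal ∂η.measure = c₀ := by
    rw [← negMeasure_univ, hpair.negMeasure_eq, hmass]
  have han : ∀ n, ∫⁻ y, (-U n y).toENNReal ∂η.measure = c n := fun n ↦ by
    rw [← negMeasure_univ, hUm, hmass]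
  have hbn : Tendsto (fun n ↦ ∫⁻ y, (-U n y).toENNReal ∂(p n : Measure X)) atTop
      (𝓝 (v - c₀)) := by
    have h1 := ENNReal.Tendsto.sub hval (ENNReal.tendsto_coe.mpr hc) (Or.inl hv)
    refine h1.congr fun n ↦ ?_
    rw [potentialEnergy, han]
    exact ENNReal.add_sub_cancel_left ENNReal.coe_ne_top
  -- The first term of the energy is continuous, so it remains to treat the second one.
  have hb : ∫⁻ y, (-U₀ y).toENNReal ∂(p₀ : Measure X) ≤ v - c₀ := by
    rw [← hbn.liminf_eq]
    refine lintegral_le_liminf_of_tendsto hp (fun n ↦ ?_) ?_ fun y t ht ↦ ?_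
    · have := (hU n).measurable
      fun_prop
    · have := hpot.measurable
      fun_prop
    · have e : ∀ u : EReal, u ≤ 0 → (t < (-u).toENNReal ↔ ((t.toReal : ℝ) : EReal) < -u) := by
        intro u hu
        have hu' : 0 ≤ -u := by simpa using EReal.neg_le_neg_iff.mpr hu
        rw [← EReal.coe_ennreal_lt_coe_ennreal_iff, EReal.coe_toENNReal hu']
        rw [EReal.coe_ennreal_toReal]
        exact ne_top_of_lt ht
      rw [e _ (hU₀le y)] at ht
      filter_upwards [key y _ ht] with z hz
      rwa [e _ ((hU z.1).nonpos z.2)]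
  have hcv : (c₀ : ℝ≥0∞) ≤ v := by
    refine le_of_tendsto_of_tendsto' (ENNReal.tendsto_coe.mpr hc) hval fun n ↦ ?_
    rw [potentialEnergy, han]
    exact le_self_add
  rw [potentialEnergy, ha]
  calc (c₀ : ℝ≥0∞) + _ ≤ c₀ + (v - c₀) := by gcongr
    _ = v := add_tsub_cancel_of_le hcv

/-- The direct method: a minimizing sequence has a subsequence that converges to a minimizer. -/
theorem exists_isLeast_energySet [Nonempty X] {D : Set X} (hD : IsOpen D)
    (hfin : ∃ v ∈ energySet η D, v ≠ ⊤) : ∃ v, IsLeast (energySet η D) v := by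
  have := metrizableSpace_of_chartedSpace X
  let := TopologicalSpace.metrizableSpaceMetric X
  have := ChartedSpace.secondCountable_of_sigmaCompact ℂ X
  obtain ⟨v₁, hv₁, hv₁top⟩ := hfin
  set v := sInf (energySet η D) with hvdef
  have hvtop : v ≠ ⊤ := ne_top_of_le_ne_top hv₁top (sInf_le hv₁)
  obtain ⟨w, -, hw, hwm⟩ := exists_seq_tendsto_sInf (S := energySet η D) ⟨v₁, hv₁⟩
    (OrderBot.bddBelow _)
  choose μ hμ U hU hwU using hwm
  have hprob : ∀ n, IsProbabilityMeasure (μ n) := fun n ↦ (hμ n).1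
  have hfin : ∀ n, IsFiniteMeasure (negMeasure η (U n)) := fun n ↦ (hU n).isFiniteMeasure
  let p : ℕ → ProbabilityMeasure X := fun n ↦ ⟨μ n, hprob n⟩
  let N : ℕ → FiniteMeasure X := fun n ↦ ⟨negMeasure η (U n), hfin n⟩
  choose x hx using fun n ↦ (hU n).isGreatest.1
  have hcw : ∀ n, ((N n).mass : ℝ≥0∞) ≤ w n := fun n ↦ by
    rw [FiniteMeasure.ennreal_mass, hwU n, potentialEnergy, ← negMeasure_univ]
    exact le_self_add
  have hbound : ∀ᶠ n in atTop, (N n).mass ∈ Icc 0 (v + 1).toNNReal := by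
    have h1 : v < v + 1 := ENNReal.lt_add_right hvtop one_ne_zero
    filter_upwards [hw.eventually_lt_const h1] with n hn
    refine ⟨zero_le, ?_⟩
    rw [← ENNReal.coe_le_coe, ENNReal.coe_toNNReal (by finiteness)]
    exact (hcw n).trans hn.le
  -- The measures `-U η` are not probability measures; their normalizations and masses are followed
  -- separately. For the zero measure, `normalize` is an arbitrary probability measure.
  have hK : IsCompact ((univ : Set (ProbabilityMeasure X)) ×ˢ (univ : Set (ProbabilityMeasure X))
      ×ˢ (Icc 0 (v + 1).toNNReal) ×ˢ (univ : Set X)) :=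
    isCompact_univ.prod (isCompact_univ.prod (isCompact_Icc.prod isCompact_univ))
  obtain ⟨⟨p₀, m₀, c₀, x₀⟩, -, φ, hφ, hlim⟩ := hK.tendsto_subseq'
    (x := fun n ↦ (p n, (N n).normalize, (N n).mass, x n))
    (hbound.mono fun n hn ↦ ⟨mem_univ _, mem_univ _, hn, mem_univ _⟩).frequently
  have l1 := (continuous_fst.tendsto _).comp hlim
  have l2 := ((continuous_fst.comp continuous_snd).tendsto _).comp hlim
  have l3 := ((continuous_fst.comp (continuous_snd.comp continuous_snd)).tendsto _).comp hlim
  have l4 := ((continuous_snd.comp (continuous_snd.comp continuous_snd)).tendsto _).comp hlim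
  obtain ⟨U₀, hU₀, hle⟩ := exists_isPotentialM_of_tendsto (η := η) (U := fun n ↦ U (φ n))
    l1 l2 l3 l4
    (fun n ↦ hU (φ n)) (fun n ↦ hx (φ n)) (fun n ↦ by
      have := (N (φ n)).self_eq_mass_smul_normalize
      exact congrArg (fun F : FiniteMeasure X ↦ (F : Measure X)) this) hvtop (by
      refine (hw.comp hφ.tendsto_atTop).congr fun n ↦ ?_
      exact hwU (φ n))
  have hmem : (p₀ : Measure X) ∈ measuresOff D := by
    refine ⟨inferInstance, ?_⟩
    have h1 := ProbabilityMeasure.le_liminf_measure_open_of_tendsto l1 hD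
    have h2 : ∀ n, (p (φ n) : Measure X) D = 0 := fun n ↦ (hμ (φ n)).2
    simpa [h2] using h1
  have hmem2 : potentialEnergy η p₀ U₀ ∈ energySet η D := ⟨p₀, hmem, U₀, hU₀, rfl⟩
  refine ⟨potentialEnergy η p₀ U₀, hmem2, fun u hu ↦ hle.trans (sInf_le hu)⟩

end Minimizer

/-! ### The geodesic distance in a chart -/

section GeodesicDistance

open Manifold Bundle NNReal

/-- The chart at `x` is Lipschitz at `x` for the Riemannian distance, and points at a small
Riemannian distance from `x` lie in the domain of the chart: a short path stays in a neighborhood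
on which the derivative of the chart is bounded. -/
theorem exists_edist_extChartAt_le_riemannianEDist {E : Type*} [NormedAddCommGroup E]
    [NormedSpace ℝ E] {H : Type*} [TopologicalSpace H] (I : ModelWithCorners ℝ E H) {M : Type*}
    [TopologicalSpace M] [ChartedSpace H M] [RiemannianBundle (fun x : M ↦ TangentSpace I x)]
    [IsManifold I 1 M] [IsContinuousRiemannianBundle E (fun x : M ↦ TangentSpace I x)]
    [RegularSpace M] (x : M) :
    ∃ C > (0 : ℝ≥0), ∃ c > (0 : ℝ≥0∞), ∀ y, riemannianEDist I x y < c →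
      y ∈ (chartAt H x).source ∧
        edist (extChartAt I x x) (extChartAt I x y) ≤ C * riemannianEDist I x y := by
  obtain ⟨C, C_pos, hC₀⟩ := eventually_enorm_mfderiv_extChartAt_lt I x
  have hC : ∀ᶠ y in 𝓝 x, ∀ v : TangentSpace I y,
      @enorm E _ (mfderiv% (extChartAt I x) y v) ≤ C * ‖v‖ₑ := by
    filter_upwards [hC₀] with y hy v
    refine le_trans ?_ (mul_le_mul_left hy.le ‖v‖ₑ)
    -- The tangent space carries the norm of the Riemannian metric in the source of the derivative
    -- and the norm of `E` in its target; the latter is visible only after unfolding.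
    with_unfolding_all exact ContinuousLinearMap.le_opENorm _ v
  obtain ⟨c, c_pos, hc⟩ := setOfPred_riemannianEDist_lt_subset_nhds' I
    (inter_mem hC (chart_source_mem_nhds H x))
  refine ⟨C, C_pos, c, c_pos, fun y hy ↦ ⟨(hc hy).2, ?_⟩⟩
  have key : ∀ r, riemannianEDist I x y < r → r < c →
      edist (extChartAt I x x) (extChartAt I x y) ≤ C * r := by
    intro r hr hrc
    obtain ⟨γ, hγx, hγy, γ_smooth, hγ⟩ := exists_lt_of_riemannianEDist_lt hr
    have hmem : ∀ t ∈ Icc (0 : ℝ) 1, (∀ v : TangentSpace I (γ t),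
        @enorm E _ (mfderiv% (extChartAt I x) (γ t) v) ≤ C * ‖v‖ₑ) ∧
        γ t ∈ (chartAt H x).source := by
      intro t ht
      refine hc (?_ : riemannianEDist I x (γ t) < c)
      have h1 : riemannianEDist I x (γ t) ≤ pathELength I γ 0 t :=
        riemannianEDist_le_pathELength (γ_smooth.mono (Icc_subset_Icc le_rfl ht.2)) hγx rfl ht.1
      have h2 : pathELength I γ 0 t ≤ pathELength I γ 0 1 := pathELength_mono le_rfl ht.2
      exact (h1.trans h2).trans_lt (hγ.trans hrc)
    let γ' := extChartAt I x ∘ γ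
    have hC' : CMDiff[Icc 0 1] 1 γ' :=
      contMDiffOn_extChartAt.comp (I' := I) (t := (chartAt H x).source)
        γ_smooth (fun t ht ↦ (hmem t ht).2)
    have hxy : edist (extChartAt I x x) (extChartAt I x y) = ‖γ' 1 - γ' 0‖ₑ := by
      rw [edist_comm, edist_eq_enorm_sub]
      simp [γ', hγx, hγy]
    rw [hxy]
    calc
      ‖γ' 1 - γ' 0‖ₑ
    _ ≤ ∫⁻ t' in Icc 0 1, ‖derivWithin γ' (Icc 0 1) t'‖ₑ := by
      apply enorm_sub_le_lintegral_derivWithin_Icc_of_contDiffOn_Icc _ zero_le_one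
      rwa [← contMDiffOn_iff_contDiffOn]
    _ ≤ ∫⁻ t' in Icc 0 1, C * ‖mfderiv[Icc 0 1] γ t' 1‖ₑ := by
      apply setLIntegral_mono' measurableSet_Icc (fun t' ht' ↦ ?_)
      have h1 : mfderiv[Icc 0 1] γ' t' =
          (mfderiv% (extChartAt I x) (γ t')) ∘L (mfderiv[Icc 0 1] γ t') := by
        apply mfderiv_comp_mfderivWithin
        · exact mdifferentiableAt_extChartAt (hmem t' ht').2
        · exact γ_smooth.mdifferentiableOn one_ne_zero _ ht'
        · rw [uniqueMDiffWithinAt_iff_uniqueDiffWithinAt]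
          exact uniqueDiffOn_Icc zero_lt_one _ ht'
      have h2 : derivWithin γ' (Icc 0 1) t' =
          (mfderiv% (extChartAt I x) (γ t') (mfderiv[Icc 0 1] γ t' 1) : E) := by
        rw [← fderivWithin_derivWithin, ← mfderivWithin_eq_fderivWithin]
        exact DFunLike.congr_fun h1 1
      rw [h2]
      exact (hmem t' ht').1 _
    _ = C * pathELength I γ 0 1 := by
      rw [lintegral_const_mul' _ _ ENNReal.coe_ne_top,
          pathELength_eq_lintegral_mfderivWithin_Icc]
    _ ≤ C * r := by
      gcongr
  -- Let `r` tend to the distance from above.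
  have hmul : Tendsto (fun r : ℝ≥0∞ ↦ (C : ℝ≥0∞) * r) (𝓝[>] (riemannianEDist I x y))
      (𝓝 (C * riemannianEDist I x y)) :=
    ((ENNReal.continuous_const_mul ENNReal.coe_ne_top).tendsto _).mono_left nhdsWithin_le_nhds
  have : (𝓝[>] (riemannianEDist I x y)).NeBot := nhdsGT_neBot_of_exists_gt ⟨c, hy⟩
  refine ge_of_tendsto hmul ?_
  filter_upwards [Ioo_mem_nhdsGT hy] with r hr using key r hr.1 hr.2

variable {X : Type*} [TopologicalSpace X] [ChartedSpace ℂ X] [IsManifold 𝓘(ℂ) 1 X]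

namespace KahlerForm

theorem density_eq_coeffAt_mul (η : KahlerForm X) {e : OpenPartialHomeomorph X ℂ}
    (he : e ∈ atlas ℂ X) {x : X} (hx : x ∈ e.source) :
    η.density e (e x) =
      η.coeffAt x * ‖deriv (fun w ↦ chartAt ℂ x (e.symm w)) (e x)‖ ^ 2 := by
  have h := η.transform e he (chartAt ℂ x) (chart_mem_atlas ℂ x) (e x) (by
    simp [hx])
  rw [h, coeffAt, e.left_inv hx]

/-- The Riemannian metric of a Kähler form. It is continuous, since in the trivialization of the
tangent bundle over a chart it is the Euclidean metric times the coefficient of the form. -/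
noncomputable def riemannianMetric (η : KahlerForm X) :
    ContinuousRiemannianMetric ℂ (fun x : X ↦ TangentSpace 𝓘(ℝ, ℂ) x) where
  inner x := (η.coeffAt x • innerSL ℝ (E := ℂ) : ℂ →L[ℝ] ℂ →L[ℝ] ℝ)
  symm x v w := by
    change η.coeffAt x * @inner ℝ ℂ _ v w = η.coeffAt x * @inner ℝ ℂ _ w v
    exact congrArg _ (@real_inner_comm ℂ _ _ w v)
  pos x v hv := by
    change 0 < η.coeffAt x * @inner ℝ ℂ _ v v
    exact mul_pos (η.coeffAt_pos x) ((@real_inner_self_pos ℂ _ _ _).2 hv)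
  isVonNBounded x := by
    change Bornology.IsVonNBounded ℝ {v : ℂ | η.coeffAt x * inner ℝ v v < 1}
    have hpos := η.coeffAt_pos x
    refine (NormedSpace.isVonNBounded_ball ℝ ℂ (√(η.coeffAt x)⁻¹)).subset fun v hv ↦ ?_
    rw [mem_ball_zero_iff]
    refine Real.lt_sqrt_of_sq_lt ?_
    have h : η.coeffAt x * ‖v‖ ^ 2 < 1 := by
      rw [← real_inner_self_eq_norm_sq]
      exact hv
    rw [inv_eq_one_div, lt_div_iff₀ hpos, mul_comm]
    exact h
  continuous := by
    refine continuous_iff_continuousAt.mpr fun x₀ ↦ ?_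
    rw [FiberBundle.continuousAt_totalSpace]
    refine ⟨continuousAt_id, ?_⟩
    set e := chartAt ℂ x₀ with he'
    have he : e ∈ atlas ℂ X := chart_mem_atlas ℂ x₀
    have hx : x₀ ∈ e.source := mem_chart_source ℂ x₀
    have h1 : ContinuousAt (fun x ↦ (η.density e (e x) • innerSL ℝ (E := ℂ) :
        ℂ →L[ℝ] ℂ →L[ℝ] ℝ)) x₀ := by
      have h0 : ContinuousAt (fun x ↦ η.density e (e x)) x₀ :=
        ContinuousAt.comp (g := η.density e) ((η.contDiffOn e he).continuousOn.continuousAt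
          (e.open_target.mem_nhds (e.map_source hx))) (e.continuousAt hx)
      exact h0.smul continuousAt_const
    refine h1.congr ?_
    filter_upwards [e.open_source.mem_nhds hx] with x hxs
    rw [hom_trivializationAt_apply]
    ext v w
    have hb : x ∈ (trivializationAt ℂ (TangentSpace 𝓘(ℝ, ℂ)) x₀).baseSet := by
      simpa using hxs
    rw [inCoordinates_apply_eq₂ hb hb (mem_univ _)]
    have hsymm : ∀ u : ℂ, ((trivializationAt ℂ (TangentSpace 𝓘(ℝ, ℂ)) x₀).symm x u : ℂ) =
        deriv (fun w ↦ chartAt ℂ x (e.symm w)) (e x) * u := by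
      intro u
      have h2 : ((trivializationAt ℂ (TangentSpace 𝓘(ℝ, ℂ)) x₀).symm x u : ℂ) =
          Trivialization.symmL ℝ (trivializationAt ℂ (TangentSpace 𝓘(ℝ, ℂ)) x₀) x u :=
        (Trivialization.symmL_apply _ hb _).symm
      rw [h2, TangentBundle.symmL_trivializationAt_eq_core hxs, tangentBundleCore_coordChange]
      have han : AnalyticAt ℂ (fun w ↦ chartAt ℂ x (e.symm w)) (e x) :=
        analyticOnNhd_transition he (chart_mem_atlas ℂ x) _ (by simp [hxs])
      have hd := (han.differentiableAt.hasDerivAt.hasFDerivAt.restrictScalars ℝ).fderiv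
      simp only [modelWithCornersSelf_coe, range_id, fderivWithin_univ]
      change fderiv ℝ (fun w ↦ chartAt ℂ x (e.symm w)) (e x) u = _
      rw [hd]
      simp [mul_comm]
    change η.density e (e x) * @inner ℝ ℂ _ v w = _
    simp only [Trivial.fiberBundle_trivializationAt', Trivial.linearMapAt_trivialization,
        LinearMap.id_coe, id_eq]
    change _ = η.coeffAt x * @inner ℝ ℂ _ ((trivializationAt ℂ (TangentSpace 𝓘(ℝ, ℂ)) x₀).symm x v)
      ((trivializationAt ℂ (TangentSpace 𝓘(ℝ, ℂ)) x₀).symm x w)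
    rw [hsymm v, hsymm w, η.density_eq_coeffAt_mul he hxs, ← Complex.normSq_eq_norm_sq]
    simp only [Complex.inner, Complex.normSq_apply, map_mul, Complex.mul_re, Complex.mul_im,
      Complex.conj_re, Complex.conj_im]
    ring

/-- The geodesic distance of a Kähler form is the one of its Riemannian metric. -/
theorem edist_eq (η : KahlerForm X) (x y : X) :
    letI : RiemannianBundle (fun x : X ↦ TangentSpace 𝓘(ℝ, ℂ) x) :=
      ⟨η.riemannianMetric.toRiemannianMetric⟩
    η.edist x y = riemannianEDist 𝓘(ℝ, ℂ) x y := by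
  let : RiemannianBundle (fun x : X ↦ TangentSpace 𝓘(ℝ, ℂ) x) :=
      ⟨η.riemannianMetric.toRiemannianMetric⟩
  have h : η.tangentENorm =
      fun z : X ↦ (inferInstance : ENorm (TangentSpace 𝓘(ℝ, ℂ) z)) := by
    funext z
    refine congrArg ENorm.mk (funext fun v ↦ ?_)
    have h1 : ‖v‖ = √(η.coeffAt z * @inner ℝ ℂ _ v v) := norm_eq_sqrt_real_inner v
    have h2 : ∀ u : ℂ, √(η.coeffAt z * inner ℝ u u) = √(η.coeffAt z) * ‖u‖ := fun u ↦ by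
      rw [real_inner_self_eq_norm_sq, Real.sqrt_mul (η.coeffAt_pos z).le,
        Real.sqrt_sq (norm_nonneg _)]
    exact (congrArg ENNReal.ofReal (h1.trans (h2 v))).symm.trans (ofReal_norm v)
  simp only [KahlerForm.edist]
  rw [h]

end KahlerForm

/-- The Riemannian distance is continuous for the topology of the surface. -/
theorem isOpen_geodesicBall (η : KahlerForm X) (x : X) (r : ℝ) : IsOpen (η.ball x r) := by
  let : RiemannianBundle (fun x : X ↦ TangentSpace 𝓘(ℝ, ℂ) x) :=
    ⟨η.riemannianMetric.toRiemannianMetric⟩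
  have : IsManifold 𝓘(ℝ, ℂ) 1 X := IsManifold.of_le (n := ∞) (by norm_cast)
  refine isOpen_iff_mem_nhds.mpr fun y hy ↦ ?_
  have hy' : riemannianEDist 𝓘(ℝ, ℂ) x y < ENNReal.ofReal r := by
    rw [← η.edist_eq]
    exact hy
  filter_upwards [eventually_riemannianEDist_lt 𝓘(ℝ, ℂ) y (tsub_pos_of_lt hy')] with z hz
  change η.edist x z < _
  rw [η.edist_eq]
  calc riemannianEDist 𝓘(ℝ, ℂ) x z
      ≤ riemannianEDist 𝓘(ℝ, ℂ) x y + riemannianEDist 𝓘(ℝ, ℂ) y z := riemannianEDist_triangle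
    _ < riemannianEDist 𝓘(ℝ, ℂ) x y + (ENNReal.ofReal r - riemannianEDist 𝓘(ℝ, ℂ) x y) := by
        exact ENNReal.add_lt_add_left hy'.ne_top hz
    _ = ENNReal.ofReal r := add_tsub_cancel_of_le hy'.le

/-- Small geodesic balls contain and are contained in coordinate discs of comparable radii. -/
theorem exists_geodesicBall_comparison [T2Space X] [CompactSpace X] (η : KahlerForm X) (x : X) :
    ∃ k K : ℝ, 0 < k ∧ 0 < K ∧ ∀ᶠ r in 𝓝[>] (0 : ℝ),
      (∀ y ∈ (chartAt ℂ x).source, dist (chartAt ℂ x y) (chartAt ℂ x x) < k * r → y ∈ η.ball x r) ∧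
      ∀ y ∈ η.ball x r, y ∈ (chartAt ℂ x).source ∧
        dist (chartAt ℂ x y) (chartAt ℂ x x) < K * r := by
  let : RiemannianBundle (fun x : X ↦ TangentSpace 𝓘(ℝ, ℂ) x) :=
    ⟨η.riemannianMetric.toRiemannianMetric⟩
  have : IsManifold 𝓘(ℝ, ℂ) 1 X := IsManifold.of_le (n := ∞) (by norm_cast)
  obtain ⟨C₁, hC₁, h1⟩ := eventually_riemannianEDist_le_edist_extChartAt 𝓘(ℝ, ℂ) x
  obtain ⟨C₂, hC₂, c, hc, h2⟩ := exists_edist_extChartAt_le_riemannianEDist 𝓘(ℝ, ℂ) x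
  set e := chartAt ℂ x with he
  have hx : x ∈ e.source := mem_chart_source ℂ x
  have h3 : ∀ᶠ z in 𝓝 (e x), riemannianEDist 𝓘(ℝ, ℂ) x (e.symm z) ≤
      C₁ * edist (e x) (e (e.symm z)) := by
    simpa using (tendsto_chartAt_symm x).eventually h1
  obtain ⟨ε, hε, hball⟩ := Metric.eventually_nhds_iff.mp h3
  refine ⟨(C₁ : ℝ)⁻¹, C₂, by positivity, by positivity, ?_⟩
  have hr1 : ∀ᶠ r in 𝓝[>] (0 : ℝ), (C₁ : ℝ)⁻¹ * r < ε := by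
    have : Tendsto (fun r : ℝ ↦ (C₁ : ℝ)⁻¹ * r) (𝓝[>] 0) (𝓝 ((C₁ : ℝ)⁻¹ * 0)) :=
      (continuous_const.mul continuous_id).continuousAt.tendsto.mono_left nhdsWithin_le_nhds
    exact this.eventually_lt_const (by simpa using hε)
  have hr2 : ∀ᶠ r in 𝓝[>] (0 : ℝ), ENNReal.ofReal r < c := by
    have : Tendsto (fun r : ℝ ↦ ENNReal.ofReal r) (𝓝[>] 0) (𝓝 (ENNReal.ofReal 0)) :=
      ENNReal.continuous_ofReal.continuousAt.tendsto.mono_left nhdsWithin_le_nhds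
    exact this.eventually_lt_const (by simpa using hc)
  filter_upwards [hr1, hr2, self_mem_nhdsWithin] with r hr1 hr2 hr0
  have hr0 : 0 < r := hr0
  refine ⟨fun y hys hy ↦ ?_, fun y hy ↦ ?_⟩
  · have h4 := hball (hy.trans hr1)
    rw [e.left_inv hys] at h4
    change η.edist x y < _
    rw [η.edist_eq]
    refine h4.trans_lt ?_
    rw [edist_comm, edist_dist, ← ENNReal.ofReal_coe_nnreal, ← ENNReal.ofReal_mul C₁.coe_nonneg]
    refine (ENNReal.ofReal_lt_ofReal_iff hr0).mpr ?_
    calc (C₁ : ℝ) * dist (e y) (e x) < C₁ * ((C₁ : ℝ)⁻¹ * r) := by gcongr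
      _ = r := by field_simp
  · have hy' : riemannianEDist 𝓘(ℝ, ℂ) x y < ENNReal.ofReal r := by
      rw [← η.edist_eq]
      exact hy
    obtain ⟨hs, hle⟩ := h2 y (hy'.trans hr2)
    refine ⟨hs, ?_⟩
    have hle' : edist (e x) (e y) ≤ C₂ * riemannianEDist 𝓘(ℝ, ℂ) x y := by simpa using hle
    have h5 : edist (e y) (e x) < ENNReal.ofReal (C₂ * r) := by
      rw [edist_comm, ENNReal.ofReal_mul C₂.coe_nonneg, ENNReal.ofReal_coe_nnreal]
      refine hle'.trans_lt ?_
      exact (ENNReal.mul_lt_mul_iff_right (by exact_mod_cast hC₂.ne') ENNReal.coe_ne_top).mpr hy'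
    rw [edist_dist] at h5
    exact (ENNReal.ofReal_lt_ofReal_iff (by positivity)).mp h5

end GeodesicDistance

/-! ### A planar balayage potential -/

theorem abs_planeConv_le {k g : ℂ → ℝ} {Q G ρ : ℝ} (hρ : 0 ≤ ρ) (hk : ∀ t, |k t| ≤ Q)
    (hg : ∀ t, |g t| ≤ G) (hgs : Function.support g ⊆ Metric.ball 0 ρ) (x : ℂ) :
    |planeConv k g x| ≤ G * Q * (Real.pi * ρ ^ 2) := by
  rw [planeConv_comm, planeConv, ← setIntegral_eq_integral_of_forall_compl_eq_zero
    (s := Metric.ball (0 : ℂ) ρ)]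
  · have := norm_setIntegral_le_of_norm_le_const (μ := volume) (s := Metric.ball (0 : ℂ) ρ)
      (f := fun t ↦ g t * k (x - t)) (C := G * Q) measure_ball_lt_top (fun t _ ↦ by
        rw [norm_mul]
        exact mul_le_mul (hg t) (hk _) (norm_nonneg _) ((abs_nonneg _).trans (hg t)))
    refine this.trans (le_of_eq ?_)
    rw [Measure.real, Complex.volume_ball, ENNReal.toReal_mul, ENNReal.toReal_pow,
      ENNReal.toReal_ofReal hρ]
    simp [mul_comm]
  · intro t ht
    rw [Function.notMem_support.1 (fun h ↦ ht (hgs h)), zero_mul]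

/-- The logarithmic kernel `log (1 / ‖t‖)` cut off at the unit circle. -/
noncomputable def unitLog : ℂ → ℝ := (Metric.ball (0 : ℂ) 1).indicator fun t ↦ Real.log (1 / ‖t‖)

theorem unitLog_nonneg (t : ℂ) : 0 ≤ unitLog t := by
  refine indicator_nonneg (fun t ht ↦ ?_) t
  rcases eq_or_ne t 0 with rfl | h
  · simp
  · refine Real.log_nonneg ?_
    rw [le_div_iff₀ (norm_pos_iff.2 h), one_mul]
    exact (mem_ball_zero_iff.1 ht).le

theorem integrable_unitLog : Integrable unitLog := by
  rw [unitLog, integrable_indicator_iff Metric.isOpen_ball.measurableSet]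
  refine (integrableOn_log_norm_ball 1).neg.congr (Eventually.of_forall fun t ↦ ?_)
  simp

theorem unitLog_smul_eq_zero {ε : ℝ} (hε : 0 < ε) {t : ℂ} (ht : ε ≤ ‖t‖) :
    unitLog (ε⁻¹ • t) = 0 := by
  refine indicator_of_notMem ?_ _
  rw [mem_ball_zero_iff, norm_smul, norm_inv, Real.norm_of_nonneg hε.le, not_lt,
    ← div_eq_inv_mul, le_div_iff₀ hε, one_mul]
  exact ht

theorem integral_unitLog_smul (ε : ℝ) :
    ∫ t, unitLog (ε⁻¹ • t) = ε ^ 2 * ∫ t, unitLog t := by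
  rw [Measure.integral_comp_smul]
  simp [Complex.finrank_real_complex]

/-- At distances above `ε` the kernel is at most `log (1 / ε)`, and the excess below is a rescaled
logarithm, with integral of order `ε ^ 2`. -/
theorem logKernel_le (b : ContDiffBump (0 : ℂ)) (hb : b.rOut = 1) {ε : ℝ} (hε : 0 < ε)
    (hε1 : ε ≤ b.rIn) (t : ℂ) :
    logKernel b t ≤ b t * Real.log (1 / ε) + unitLog (ε⁻¹ • t) := by
  have hε2 : ε < 1 := hb ▸ hε1.trans_lt b.rIn_lt_rOut
  have hl : 0 ≤ Real.log (1 / ε) := Real.log_nonneg (by rw [le_div_iff₀ hε]; linarith)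
  rw [logKernel, hb]
  rcases eq_or_ne t 0 with rfl | h
  · have h1 := add_nonneg (mul_nonneg (b.nonneg (x := 0)) hl) (unitLog_nonneg (ε⁻¹ • 0))
    simpa using h1
  have hn := norm_pos_iff.2 h
  rcases le_or_gt ε ‖t‖ with ht | ht
  · rw [unitLog_smul_eq_zero hε ht, add_zero]
    refine mul_le_mul_of_nonneg_left (Real.log_le_log (by positivity) ?_) b.nonneg
    exact one_div_le_one_div_of_le hε ht
  · have hnn : ‖ε⁻¹ • t‖ = ε⁻¹ * ‖t‖ := by
      rw [norm_smul, norm_inv, Real.norm_of_nonneg hε.le]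
    have hm : ε⁻¹ • t ∈ Metric.ball (0 : ℂ) 1 := by
      rw [mem_ball_zero_iff, hnn, ← div_eq_inv_mul, div_lt_one hε]
      exact ht
    rw [unitLog, indicator_of_mem hm, b.one_of_mem_closedBall (by
      rw [mem_closedBall_zero_iff]; exact ht.le.trans hε1), one_mul, one_mul, hnn,
      ← Real.log_mul (by positivity) (by positivity)]
    refine le_of_eq (congrArg _ ?_)
    field_simp

/-- If `g` is comparable to a multiple of the indicator of a small disc, a bounded multiple of the
smooth bump dominates the logarithmic singularity: the potential is nonpositive. -/
theorem planeConv_logKernel_le (b : ContDiffBump (0 : ℂ)) (hb : b.rOut = 1) {ε a : ℝ}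
    (hε : 0 < ε) (hε1 : 5 * ε ≤ b.rIn) (ha : 0 < a) {g : ℂ → ℝ} (hg : ContDiff ℝ ∞ g)
    (hgc : HasCompactSupport g) (hg0 : ∀ t, 0 ≤ g t) (hga : ∀ t, g t ≤ 2 * a)
    (hgs : Function.support g ⊆ Metric.ball 0 (2 * ε)) (hgi : ∀ t ∈ Metric.ball 0 ε, a ≤ g t)
    (x : ℂ) :
    planeConv (logKernel b) g x ≤
      (2 * (∫ t, unitLog t) / Real.pi + Real.log (1 / ε)) * planeConv b g x := by
  set A := ∫ t, unitLog t with hA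
  have hA0 : 0 ≤ A := integral_nonneg unitLog_nonneg
  have hi1 := integrable_mul_comp_sub (integrable_logKernel b).locallyIntegrable hg.continuous hgc x
  have hi2 := integrable_mul_comp_sub b.continuous.locallyIntegrable hg.continuous hgc x
  have hL : 0 ≤ 2 * A / Real.pi := by positivity
  -- Far from the support of `g` the kernels can be compared pointwise. Close to it, `b ⋆ g` is the
  -- integral of `g`, which dominates the integral of the singular part of the kernel.
  rcases lt_or_ge (3 * ε) ‖x‖ with hx | hx
  · rw [planeConv, planeConv, ← integral_const_mul]
    refine integral_mono hi1 (hi2.const_mul _) fun t ↦ ?_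
    by_cases h : g (x - t) = 0
    · simp [h]
    have h1 : ‖x - t‖ < 2 * ε := mem_ball_zero_iff.1 (hgs h)
    have h2 : ε ≤ ‖t‖ := by
      have := norm_sub_norm_le x t
      linarith
    have h3 := logKernel_le b hb hε (by linarith) t
    rw [unitLog_smul_eq_zero hε h2] at h3
    simp only
    rw [← mul_assoc]
    refine mul_le_mul_of_nonneg_right ?_ (hg0 _)
    nlinarith [mul_nonneg hL (b.nonneg (x := t))]
  · have hb1 : planeConv b g x = ∫ t, g (x - t) := by
      refine integral_congr_ae (Eventually.of_forall fun t ↦ ?_)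
      by_cases h : g (x - t) = 0
      · simp [h]
      have h1 : ‖x - t‖ < 2 * ε := mem_ball_zero_iff.1 (hgs h)
      have h2 : ‖t‖ ≤ b.rIn := by
        have := norm_sub_norm_le t x
        rw [norm_sub_rev] at this
        linarith
      simp only
      rw [b.one_of_mem_closedBall (mem_closedBall_zero_iff.2 h2), one_mul]
    have hgint : Integrable g := hg.continuous.integrable_of_hasCompactSupport hgc
    have hlow : a * (Real.pi * ε ^ 2) ≤ planeConv b g x := by
      rw [hb1, integral_sub_left_eq_self]
      refine le_trans ?_ (setIntegral_le_integral (s := Metric.ball 0 ε) hgint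
        (Eventually.of_forall hg0))
      refine le_trans (le_of_eq ?_) (setIntegral_mono_on (f := fun _ ↦ a)
        (integrableOn_const measure_ball_lt_top.ne)
        hgint.integrableOn Metric.isOpen_ball.measurableSet hgi)
      rw [setIntegral_const, Measure.real, Complex.volume_ball, ENNReal.toReal_mul,
        ENNReal.toReal_pow, ENNReal.toReal_ofReal hε.le]
      simp
      ring
    have hkint : Integrable fun t ↦ unitLog (ε⁻¹ • t) :=
      integrable_unitLog.comp_smul (inv_ne_zero hε.ne')
    have hup : planeConv (logKernel b) g x ≤
        ∫ t, (Real.log (1 / ε) * (b t * g (x - t)) + 2 * a * unitLog (ε⁻¹ • t)) := by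
      refine integral_mono hi1 ((hi2.const_mul _).add (hkint.const_mul _)) fun t ↦ ?_
      have h3 := logKernel_le b hb hε (by linarith) t
      simp only
      nlinarith [mul_le_mul_of_nonneg_right h3 (hg0 (x - t)),
        mul_le_mul_of_nonneg_left (hga (x - t)) (unitLog_nonneg (ε⁻¹ • t))]
    rw [integral_add (hi2.const_mul _) (hkint.const_mul _), integral_const_mul,
      integral_const_mul, integral_unitLog_smul, ← hA] at hup
    have h4 := mul_le_mul_of_nonneg_left hlow hL
    have h5 : 2 * A / Real.pi * (a * (Real.pi * ε ^ 2)) = 2 * a * (ε ^ 2 * A) := by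
      field_simp
    rw [h5] at h4
    change _ ≤ Real.log (1 / ε) * planeConv b g x + _ at hup
    linarith

theorem exists_forall_abs_le_of_hasCompactSupport {f : ℂ → ℝ} (hf : Continuous f)
    (hc : HasCompactSupport f) : ∃ C, 0 ≤ C ∧ ∀ t, |f t| ≤ C := by
  obtain ⟨C, hC⟩ := hf.bounded_above_of_compact_support hc
  exact ⟨C, (norm_nonneg _).trans (hC 0), hC⟩

/-- A compactly supported function `W ≤ 0` whose Laplacian cancels the positive density `2 π F`
near the origin and perturbs it by at most a factor `2` elsewhere. All constants depend only on
the lower bound `a` of the density. -/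
theorem exists_planar_balayage {a : ℝ} (ha : 0 < a) : ∃ ε B : ℝ, 0 < ε ∧ ε < 1 ∧ 0 ≤ B ∧
    ∀ F : ℂ → ℝ, ContDiff ℝ ∞ F → (∀ w ∈ Metric.closedBall (0 : ℂ) 2, a ≤ F w ∧ F w ≤ 2 * a) →
      ∃ W : ℂ → ℝ, ContDiff ℝ ∞ W ∧ HasCompactSupport W ∧
        tsupport W ⊆ Metric.closedBall 0 2 ∧ (∀ w, -B ≤ W w ∧ W w ≤ 0) ∧
        (∀ w ∈ Metric.closedBall (0 : ℂ) 2,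
          0 ≤ 2 * Real.pi * F w + Δ W w ∧ 2 * Real.pi * F w + Δ W w ≤ 4 * Real.pi * F w) ∧
        ∀ w ∈ Metric.ball (0 : ℂ) ε, Δ W w = -(2 * Real.pi * F w) := by
  let b : ContDiffBump (0 : ℂ) := ⟨1 / 2, 1, by norm_num, by norm_num⟩
  have hbs : ContDiff ℝ ∞ (b : ℂ → ℝ) := b.contDiff
  obtain ⟨A₁, hA₁, hr⟩ := exists_forall_abs_le_of_hasCompactSupport
    (contDiff_logRemainder b).continuous (hasCompactSupport_logRemainder b)
  obtain ⟨A₂, hA₂, hd⟩ := exists_forall_abs_le_of_hasCompactSupport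
    hbs.contDiff_laplacian.continuous b.hasCompactSupport.laplacian
  set L := 2 * (∫ t, unitLog t) / Real.pi with hL
  have hL0 : 0 ≤ L := by
    have : 0 ≤ ∫ t, unitLog t := integral_nonneg fun t ↦ unitLog_nonneg t
    positivity
  set S := A₁ + L * A₂ + A₂ with hS
  have hS0 : 0 ≤ S := by positivity
  -- The remainder terms are bounded by `2 a (A₁ + M A₂) π (2 ε) ^ 2` with `M = L + log (1 / ε)`,
  -- which for small `ε` is at most the lower bound `2 π a` for the density `2 π F`.
  obtain ⟨ε, hε0, hε1, hεS⟩ : ∃ ε : ℝ, 0 < ε ∧ ε ≤ 1 / 20 ∧ 4 * ε * S ≤ 1 := by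
    refine ⟨min (1 / 20) (1 / (4 * S + 1)), by positivity, min_le_left _ _, ?_⟩
    have h1 : min (1 / 20) (1 / (4 * S + 1)) * (4 * S + 1) ≤ 1 := by
      rw [← le_div_iff₀ (by positivity)]
      exact min_le_right _ _
    have h2 : 0 < min (1 / 20) (1 / (4 * S + 1)) := by positivity
    linarith
  set l := Real.log (1 / ε) with hl
  have hl0 : 0 ≤ l := Real.log_nonneg (by rw [le_div_iff₀ hε0]; linarith)
  have hl1 : l * ε ≤ 1 := by
    have := Real.log_le_sub_one_of_pos (show 0 < 1 / ε by positivity)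
    have h2 := mul_le_mul_of_nonneg_right this hε0.le
    have h3 : (1 / ε - 1) * ε = 1 - ε := by field_simp
    linarith
  set M := L + l with hM
  have hM0 : 0 ≤ M := by positivity
  have hQ : (A₁ + M * A₂) * (4 * ε ^ 2) ≤ 1 := by
    have h1 : (A₁ + M * A₂) * ε ≤ S := by
      have : A₁ * ε ≤ A₁ := mul_le_of_le_one_right hA₁ (by linarith)
      have : L * A₂ * ε ≤ L * A₂ := mul_le_of_le_one_right (by positivity) (by linarith)
      have : l * ε * A₂ ≤ A₂ := mul_le_of_le_one_left hA₂ hl1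
      rw [hM, hS]
      linarith
    nlinarith
  let β : ContDiffBump (0 : ℂ) := ⟨ε, 2 * ε, hε0, by linarith⟩
  refine ⟨ε, M * (2 * a * (Real.pi * (2 * ε) ^ 2)), hε0, by linarith, by positivity,
    fun F hF hFa ↦ ?_⟩
  set g : ℂ → ℝ := fun t ↦ F t * β t with hgdef
  have hg : ContDiff ℝ ∞ g := hF.mul β.contDiff
  have hgc : HasCompactSupport g := β.hasCompactSupport.mul_left
  have hgs : Function.support g ⊆ Metric.ball 0 (2 * ε) := fun t ht ↦ by
    have : t ∈ Function.support β := fun h ↦ ht (by simp [hgdef, h])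
    rwa [β.support_eq] at this
  have hgF : ∀ w ∈ Metric.closedBall (0 : ℂ) 2, 0 ≤ g w ∧ g w ≤ F w := fun w hw ↦ by
    have := hFa w hw
    exact ⟨mul_nonneg (by linarith) β.nonneg, mul_le_of_le_one_right (by linarith) β.le_one⟩
  have hgb : ∀ w, 0 ≤ g w ∧ g w ≤ 2 * a := fun w ↦ by
    by_cases h : g w = 0
    · rw [h]
      exact ⟨le_rfl, by positivity⟩
    · have hw : w ∈ Metric.closedBall (0 : ℂ) 2 := mem_closedBall_zero_iff.2 (by
        have := mem_ball_zero_iff.1 (hgs h)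
        linarith)
      exact ⟨(hgF w hw).1, (hgF w hw).2.trans (hFa w hw).2⟩
  have hgabs : ∀ w, |g w| ≤ 2 * a := fun w ↦ by rw [abs_of_nonneg (hgb w).1]; exact (hgb w).2
  have hg1 : ∀ t ∈ Metric.ball (0 : ℂ) ε, g t = F t := fun t ht ↦ by
    have : β t = 1 := β.one_of_mem_closedBall (Metric.ball_subset_closedBall ht)
    simp [hgdef, this]
  have hin : ∀ t ∈ Metric.ball (0 : ℂ) ε, t ∈ Metric.closedBall (0 : ℂ) 2 := fun t ht ↦
    Metric.ball_subset_closedBall (Metric.ball_subset_ball (by linarith) ht)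
  have hblk : LocallyIntegrable (b : ℂ → ℝ) := b.continuous.locallyIntegrable
  have hklk := (integrable_logKernel b).locallyIntegrable
  have hc1 := contDiff_planeConv hklk hg hgc
  have hc2 := contDiff_planeConv hblk hg hgc
  have hts : tsupport g ⊆ Metric.ball 0 (3 * ε) := by
    refine (closure_mono hgs).trans (Metric.closure_ball_subset_closedBall.trans
      (Metric.closedBall_subset_ball (by linarith)))
  have hs1 := tsupport_planeConv_subset (support_logKernel_subset b) hgc hts
  have hs2 := tsupport_planeConv_subset (k := b) (r := 1) (by rw [b.support_eq]) hgc hts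
  -- The first summand cancels the density near the origin, and the second makes `W` nonpositive
  -- without changing the Laplacian there.
  set W : ℂ → ℝ := planeConv (logKernel b) g - M • planeConv b g with hW
  have hWx : ∀ x, W x = planeConv (logKernel b) g x - M * planeConv b g x := fun x ↦ rfl
  have hWts : tsupport W ⊆ Metric.closedBall 0 2 := by
    have : tsupport W ⊆ tsupport (planeConv (logKernel b) g) ∪ tsupport (planeConv b g) := by
      refine (tsupport_sub _ _).trans (union_subset_union le_rfl ?_)
      exact tsupport_smul_subset_right (fun _ ↦ M) _
    refine this.trans (union_subset (hs1.2.trans ?_) (hs2.2.trans ?_)) <;>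
    exact Metric.ball_subset_closedBall.trans (Metric.closedBall_subset_closedBall (by
      change 3 * ε + 1 ≤ 2
      linarith))
  set q : ℂ → ℝ := fun t ↦ logRemainder b t + M * Δ (b : ℂ → ℝ) t with hq
  have hqb : ∀ t, |q t| ≤ A₁ + M * A₂ := fun t ↦ by
    refine (abs_add_le _ _).trans (add_le_add (hr t) ?_)
    rw [abs_mul, abs_of_nonneg hM0]
    exact mul_le_mul_of_nonneg_left (hd t) hM0
  have hq0 : ∀ t : ℂ, ‖t‖ < 1 / 2 → q t = 0 := fun t ht ↦ by
    have h1 : (b : ℂ → ℝ) =ᶠ[𝓝 t] fun _ ↦ 1 :=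
      b.eventuallyEq_one_of_mem_ball (mem_ball_zero_iff.2 ht)
    have h2 : Δ (b : ℂ → ℝ) t = 0 := by
      rw [(InnerProductSpace.laplacian_congr_nhds h1).eq_of_nhds]
      simp [laplacian_eq_fderiv_fderiv]
    simp [hq, logRemainder_eq_zero b (Or.inl ht), h2]
  have hΔ : ∀ x, Δ W x = -(2 * Real.pi * g x) - planeConv q g x := fun x ↦ by
    have h1 := ((contDiff_infty.1 hc1 2).contDiffAt (x := x))
    have h2 := ((contDiff_infty.1 hc2 2).contDiffAt (x := x))
    have h3 : Δ (planeConv b g) x = planeConv (Δ (b : ℂ → ℝ)) g x := by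
      rw [planeConv_comm, laplacian_planeConv hg.continuous.locallyIntegrable hbs
        b.hasCompactSupport, planeConv_comm]
    have h4 : planeConv q g x =
        planeConv (logRemainder b) g x + M * planeConv (Δ (b : ℂ → ℝ)) g x := by
      have i1 := integrable_mul_comp_sub
        (contDiff_logRemainder b).continuous.locallyIntegrable hg.continuous hgc x
      have i2 := integrable_mul_comp_sub
        hbs.contDiff_laplacian.continuous.locallyIntegrable hg.continuous hgc x
      rw [planeConv, planeConv, planeConv, ← integral_const_mul, ← integral_add i1 (i2.const_mul _)]
      refine integral_congr_ae (Eventually.of_forall fun t ↦ ?_)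
      simp only [hq]
      ring
    have h6 : ContDiffAt ℝ 2 ((-M) • planeConv b g) x := contDiffAt_const.smul h2
    have h5 : Δ W x = Δ (planeConv (logKernel b) g) x - M * Δ (planeConv b g) x := by
      rw [hW, sub_eq_add_neg, ← neg_smul, h1.laplacian_add h6,
      InnerProductSpace.laplacian_smul _ h2]
      simp
      ring
    rw [h5, laplacian_planeConv_logKernel b hg hgc, h3, h4]
    ring
  -- The remainder kernel vanishes near the origin, hence so does its convolution with `g`.
  have hnear : ∀ x : ℂ, ‖x‖ < 1 / 4 → planeConv q g x = 0 := fun x hx ↦ by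
    refine integral_eq_zero_of_ae (Eventually.of_forall fun t ↦ ?_)
    by_cases h : g (x - t) = 0
    · simp [h]
    have h1 : ‖x - t‖ < 2 * ε := mem_ball_zero_iff.1 (hgs h)
    have h2 : ‖t‖ < 1 / 2 := by
      have := norm_sub_norm_le t x
      rw [norm_sub_rev] at this
      linarith
    simp [hq0 t h2]
  have hpi := Real.pi_pos
  refine ⟨W, hc1.sub (contDiff_const.smul hc2), hs1.1.sub (hs2.1.smul_left (f := fun _ ↦ M)),
    hWts, fun w ↦ ⟨?_, ?_⟩, fun w hw ↦ ?_, fun w hw ↦ ?_⟩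
  · have h1 : 0 ≤ planeConv (logKernel b) g w :=
      integral_nonneg fun t ↦ mul_nonneg (logKernel_nonneg b t) (hgb _).1
    have h2 := abs_planeConv_le (k := b) (Q := 1) (by positivity : 0 ≤ 2 * ε)
      (fun t ↦ by rw [abs_of_nonneg b.nonneg]; exact b.le_one) hgabs hgs w
    have h3 := mul_le_mul_of_nonneg_left (le_of_abs_le h2) hM0
    rw [hWx]
    linarith
  · rw [hWx, sub_nonpos]
    exact planeConv_logKernel_le b rfl hε0 (by change 5 * ε ≤ 1 / 2; linarith) ha hg hgc
      (fun t ↦ (hgb t).1) (fun t ↦ (hgb t).2) hgs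
      (fun t ht ↦ by rw [hg1 t ht]; exact (hFa t (hin t ht)).1) w
  · have hFw := hFa w hw
    have hgw := hgF w hw
    rw [hΔ]
    rcases lt_or_ge ‖w‖ (1 / 4) with h | h
    · rw [hnear w h]
      constructor <;> nlinarith
    · have h1 : g w = 0 := by
        by_contra h2
        have := mem_ball_zero_iff.1 (hgs h2)
        linarith
      have h2 := abs_planeConv_le (by positivity : 0 ≤ 2 * ε) hqb hgabs hgs w
      have h3 : 2 * a * (A₁ + M * A₂) * (Real.pi * (2 * ε) ^ 2) ≤ 2 * Real.pi * a := by
        have := mul_le_mul_of_nonneg_left hQ (by positivity : 0 ≤ 2 * Real.pi * a)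
        linarith
      have h4 := abs_le.1 (h2.trans h3)
      have h5 : 2 * Real.pi * a ≤ 2 * Real.pi * F w :=
        mul_le_mul_of_nonneg_left hFw.1 (by positivity)
      rw [h1]
      constructor <;> linarith [h4.1, h4.2]
  · rw [hΔ, hnear w (by have := mem_ball_zero_iff.1 hw; linarith), hg1 w hw, sub_zero]

/-! ### The lower bound for the energy -/

section LowerBound

variable {X : Type*} [TopologicalSpace X] [ChartedSpace ℂ X]

/-- Near the centre of a chart the density of the form varies by at most a factor `2`. -/
theorem exists_density_bounds (η : KahlerForm X) (x : X) : ∃ a R : ℝ, 0 < a ∧ 0 < R ∧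
    R < 2 * chartRadius x ∧ ∀ z ∈ Metric.closedBall (chartAt ℂ x x) R,
      a ≤ η.density (chartAt ℂ x) z ∧ η.density (chartAt ℂ x) z ≤ 2 * a := by
  set e := chartAt ℂ x
  have hd := η.pos e (chart_mem_atlas ℂ x) (e x) (mem_chart_target ℂ x)
  have hc : ContinuousAt (η.density e) (e x) :=
    (η.contDiffOn e (chart_mem_atlas ℂ x)).continuousOn.continuousAt
      (e.open_target.mem_nhds (mem_chart_target ℂ x))
  have h1 : ∀ᶠ z in 𝓝 (e x), 2 / 3 * η.density e (e x) ≤ η.density e z ∧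
      η.density e z ≤ 2 * (2 / 3 * η.density e (e x)) :=
    (hc.eventually_const_le (by linarith)).and (hc.eventually_le_const (by linarith))
  obtain ⟨ε, hε, h2⟩ := Metric.nhds_basis_closedBall.eventually_iff.1 h1
  have hδ := chartRadius_pos x
  refine ⟨2 / 3 * η.density e (e x), min ε (chartRadius x), by positivity, by positivity,
    (min_le_right _ _).trans_lt (by linarith), fun z hz ↦ h2 ?_⟩
  exact Metric.closedBall_subset_closedBall (min_le_left _ _) hz

theorem closedBall_subset_target_of_lt {x : X} {R : ℝ} (hR : R < 2 * chartRadius x) :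
    Metric.closedBall (chartAt ℂ x x) R ⊆ (chartAt ℂ x).target :=
  (Metric.closedBall_subset_ball hR).trans (ball_subset_target x)

variable [MeasurableSpace X] [BorelSpace X] [IsManifold 𝓘(ℂ) 1 X] (η : KahlerForm X)

theorem measure_source_inter_preimage {e : OpenPartialHomeomorph X ℂ} (he : e ∈ atlas ℂ X)
    {B : Set ℂ} (hB : MeasurableSet B) (hBt : B ⊆ e.target) :
    η.measure (e.source ∩ e ⁻¹' B) = ∫⁻ z in B, ENNReal.ofReal (η.density e z) := by
  rw [← chartPush_apply e _ hB, chartPush_measure η he, withDensity_apply _ hB,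
    Measure.restrict_restrict hB, inter_eq_self_of_subset_left hBt]

/-- A test function at scale `s` shows that a potential of a measure without mass on a disc of
radius `s` has mean at most `-c s ^ 4`: its integral is of order `s ^ 2`, its Laplacian of order
`s ^ (-2)`. -/
theorem exists_le_of_mem_energySet [T2Space X] [CompactSpace X] (hη : η.measure univ = 1) (x₀ : X) :
    ∃ c s₀ : ℝ, 0 < c ∧ 0 < s₀ ∧ ∀ s, 0 < s → s < s₀ → ∀ D : Set X,
      (∀ y ∈ (chartAt ℂ x₀).source, dist (chartAt ℂ x₀ y) (chartAt ℂ x₀ x₀) < s → y ∈ D) →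
        ∀ v ∈ energySet η D, ENNReal.ofReal (c * s ^ 4) ≤ v := by
  obtain ⟨a, R, ha, hR, hRδ, hdens⟩ := exists_density_bounds η x₀
  set e := chartAt ℂ x₀ with he_def
  set z₀ := e x₀ with hz₀
  have he : e ∈ atlas ℂ X := chart_mem_atlas ℂ x₀
  have hRt : Metric.closedBall z₀ R ⊆ e.target := closedBall_subset_target_of_lt hRδ
  let b : ContDiffBump (0 : ℂ) := ⟨1 / 2, 1, by norm_num, by norm_num⟩
  have hbs : ContDiff ℝ ∞ (b : ℂ → ℝ) := b.contDiff
  obtain ⟨A, hA, hd⟩ := exists_forall_abs_le_of_hasCompactSupport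
    hbs.contDiff_laplacian.continuous b.hasCompactSupport.laplacian
  have hpi := Real.pi_pos
  refine ⟨a ^ 2 * Real.pi ^ 2 / (2 * (A + 1)), R, by positivity, hR, fun s hs hsR D hD v hv ↦ ?_⟩
  obtain ⟨μ, ⟨hμ, hμD⟩, U, hU, rfl⟩ := hv
  have : IsProbabilityMeasure η.measure := ⟨hη⟩
  have := hU.isFiniteMeasure
  set ν := negMeasure η U
  -- The test function is `1` on the disc of radius `s / 2` and supported in the disc of radius `s`.
  set φ₀ : ℂ → ℝ := fun w ↦ b (-(s : ℂ)⁻¹ * z₀ + (s : ℂ)⁻¹ * w) with hφ₀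
  have harg : ∀ w, ‖-(s : ℂ)⁻¹ * z₀ + (s : ℂ)⁻¹ * w‖ = s⁻¹ * dist w z₀ := fun w ↦ by
    rw [show -(s : ℂ)⁻¹ * z₀ + (s : ℂ)⁻¹ * w = (s : ℂ)⁻¹ * (w - z₀) by ring, norm_mul, norm_inv,
      Complex.norm_real, Real.norm_of_nonneg hs.le, dist_eq_norm]
  have hsm : ContDiff ℝ ∞ φ₀ := hbs.comp (contDiff_const.add (contDiff_const.mul contDiff_id))
  have hsupp : Function.support φ₀ ⊆ Metric.ball z₀ s := fun w hw ↦ by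
    have h1 : -(s : ℂ)⁻¹ * z₀ + (s : ℂ)⁻¹ * w ∈ Function.support b := hw
    rw [b.support_eq, mem_ball_zero_iff, harg, ← div_eq_inv_mul, div_lt_iff₀ hs] at h1
    simpa [b] using h1
  have hts : tsupport φ₀ ⊆ Metric.closedBall z₀ s :=
    (closure_mono hsupp).trans Metric.closure_ball_subset_closedBall
  have htR : tsupport φ₀ ⊆ Metric.closedBall z₀ R :=
    hts.trans (Metric.closedBall_subset_closedBall hsR.le)
  have hcs : HasCompactSupport φ₀ :=
    (isCompact_closedBall z₀ s).of_isClosed_subset (isClosed_tsupport _) hts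
  have htt := htR.trans hRt
  have hφ : ContMDiff 𝓘(ℝ, ℂ) 𝓘(ℝ, ℝ) ∞ (chartFun e φ₀) := contMDiff_chartFun he hsm hcs htt
  have hcur := hU.isCurrentPair (chartFun e φ₀) hφ
  have hμ0 : ∫ x, chartFun e φ₀ x ∂μ = 0 := by
    refine integral_eq_zero_of_ae ?_
    have h1 : ∀ᵐ x ∂μ, x ∉ D := measure_eq_zero_iff_ae_notMem.1 hμD
    filter_upwards [h1] with x hx
    by_cases hxs : x ∈ e.source
    · rw [chartFun_of_mem hxs, Pi.zero_apply]
      by_contra h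
      exact hx (hD x hxs (hsupp h))
    · exact indicator_of_notMem hxs _
  have hddc : ∀ x, ‖η.ddc (chartFun e φ₀) x‖ ≤ (2 * Real.pi)⁻¹ * (s⁻¹ ^ 2 * A) / a := fun x ↦ by
    by_cases hx : x ∈ tsupport (chartFun e φ₀)
    · obtain ⟨z, hz, rfl⟩ := tsupport_chartFun_subset hcs htt hx
      have hzt := htt hz
      have hdz := (hdens z (htR hz)).1
      rw [η.ddc_chartFun he (e.map_target hzt) hsm, e.right_inv hzt, laplacian_comp_add_mul hbs,
        norm_inv, Complex.norm_real, Real.norm_of_nonneg hs.le, norm_div, norm_mul, norm_mul,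
        Real.norm_of_nonneg (ha.le.trans hdz), Real.norm_of_nonneg (by positivity),
        Real.norm_of_nonneg (by positivity)]
      gcongr
      exact hd _
    · rw [η.ddc_eq_zero (notMem_tsupport_iff_eventuallyEq.1 hx), norm_zero]
      positivity
  have hup : ∫ x, η.ddc (chartFun e φ₀) x ∂ν
      ≤ (2 * Real.pi)⁻¹ * (s⁻¹ ^ 2 * A) / a * ν.real univ :=
    (le_abs_self _).trans (norm_integral_le_of_norm_le_const (Eventually.of_forall hddc))
  have hlow : a * (Real.pi * (s / 2) ^ 2) ≤ ∫ x, chartFun e φ₀ x ∂η.measure := by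
    set B := Metric.ball z₀ (s / 2)
    have hBm : MeasurableSet B := Metric.isOpen_ball.measurableSet
    have hBR : B ⊆ Metric.closedBall z₀ R :=
      Metric.ball_subset_closedBall.trans (Metric.closedBall_subset_closedBall (by linarith))
    have hS := e.measurableSet_source_inter hBm
    have h1 : ENNReal.ofReal (a * (Real.pi * (s / 2) ^ 2)) ≤ η.measure (e.source ∩ e ⁻¹' B) := by
      rw [measure_source_inter_preimage η he hBm (hBR.trans hRt)]
      refine le_trans (le_of_eq ?_) (setLIntegral_mono' (f := fun _ ↦ ENNReal.ofReal a) hBm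
        fun z hz ↦ ENNReal.ofReal_le_ofReal (hdens z (hBR hz)).1)
      rw [setLIntegral_const, Complex.volume_ball, ENNReal.ofReal_mul ha.le,
        ENNReal.ofReal_mul hpi.le, ENNReal.ofReal_pow (by positivity),
        mul_comm (ENNReal.ofReal Real.pi)]
      congr 2
      rw [← NNReal.coe_real_pi, ENNReal.ofReal_coe_nnreal]
    have h2 := (ENNReal.ofReal_le_iff_le_toReal (measure_ne_top _ _)).1 h1
    refine h2.trans ?_
    change η.measure.real _ ≤ _
    rw [← integral_indicator_one hS]
    refine integral_mono ((integrable_const (1 : ℝ)).indicator hS) ?_ fun x ↦ ?_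
    · have h3 : ∀ x, ‖chartFun e φ₀ x‖ ≤ 1 := fun x ↦ by
        by_cases hxs : x ∈ e.source
        · rw [chartFun_of_mem hxs, Real.norm_of_nonneg b.nonneg]
          exact b.le_one
        · rw [chartFun, indicator_of_notMem hxs]
          simp
      exact Integrable.of_bound hφ.continuous.aestronglyMeasurable 1 (Eventually.of_forall h3)
    · refine indicator_le' (fun y hy ↦ ?_) (fun y _ ↦ ?_) x
      · rw [chartFun_of_mem hy.1]
        have : b (-(s : ℂ)⁻¹ * z₀ + (s : ℂ)⁻¹ * e y) = 1 := b.one_of_mem_closedBall (by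
          rw [mem_closedBall_zero_iff, harg, ← div_eq_inv_mul, div_le_iff₀ hs]
          have : dist (e y) z₀ < s / 2 := hy.2
          change _ ≤ 1 / 2 * s
          linarith)
        exact this.ge
      · exact indicator_nonneg (fun _ _ ↦ b.nonneg) y
  rw [hμ0, zero_add] at hcur
  rw [← hcur] at hlow
  have h3 := hlow.trans hup
  -- The constant `A + 1` avoids a division by `A`, which is not known to be positive.
  have hν : a ^ 2 * Real.pi ^ 2 / (2 * (A + 1)) * s ^ 4 ≤ ν.real univ := by
    have h4 : (2 * Real.pi)⁻¹ * (s⁻¹ ^ 2 * A) / a * ν.real univ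
        ≤ (2 * Real.pi)⁻¹ * (s⁻¹ ^ 2 * (A + 1)) / a * ν.real univ := by
      gcongr
      linarith
    have h5 := h3.trans h4
    have h6 : (2 * Real.pi)⁻¹ * (s⁻¹ ^ 2 * (A + 1)) / a * ν.real univ
        = (A + 1) * ν.real univ / (2 * Real.pi * s ^ 2 * a) := by
      field_simp
    rw [h6, le_div_iff₀ (by positivity)] at h5
    rw [div_mul_eq_mul_div, div_le_iff₀ (by positivity)]
    linarith
  refine (ENNReal.ofReal_le_ofReal hν).trans ?_
  rw [Measure.real, ENNReal.ofReal_toReal (measure_ne_top _ _), negMeasure_univ]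
  exact le_self_add

end LowerBound

/-! ### The upper bound for the energy -/

section UpperBound

variable {X : Type*} [TopologicalSpace X] [ChartedSpace ℂ X]

theorem subharmonicOn_zero {V : Set ℂ} (hV : IsOpen V) : SubharmonicOn (fun _ ↦ 0) V := by
  refine ⟨upperSemicontinuousOn_const, fun _ _ ↦ EReal.zero_ne_top, fun z hz ↦ ?_⟩
  obtain ⟨ε, hε, hεV⟩ := Metric.nhds_basis_closedBall.mem_iff.mp (hV.mem_nhds hz)
  refine ⟨ε, hε, fun r _ hr ↦ ⟨(Metric.closedBall_subset_closedBall hr.le).trans hεV, ?_⟩⟩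
  simp [erealIntegral]

/-- The subharmonic part of a smooth function is `0`. -/
theorem quasiSubharmonic_coe [IsManifold 𝓘(ℝ, ℂ) ∞ X] {u : X → ℝ}
    (hu : ContMDiff 𝓘(ℝ, ℂ) 𝓘(ℝ, ℝ) ∞ u) : QuasiSubharmonic (fun x ↦ (u x : EReal)) := by
  intro x
  refine ⟨(chartAt ℂ x).target, (chartAt ℂ x).open_target, mem_chart_target ℂ x, Subset.rfl,
    fun z ↦ -u ((chartAt ℂ x).symm z), (contDiffOn_comp_symm (chart_mem_atlas ℂ x) hu).neg, ?_⟩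
  refine (subharmonicOn_zero (chartAt ℂ x).open_target).congr fun z _ ↦ ?_
  simp only
  rw [← EReal.coe_add, add_neg_cancel, EReal.coe_zero]

theorem KahlerForm.ddc_const (η : KahlerForm X) (c : ℝ) (x : X) : η.ddc (fun _ ↦ c) x = 0 := by
  simp [KahlerForm.ddc]

variable [MeasurableSpace X] [BorelSpace X] {η : KahlerForm X}

theorem isPotentialM_coe [CompactSpace X] [IsManifold 𝓘(ℝ, ℂ) ∞ X] [IsFiniteMeasure η.measure]
    {μ : Measure X} {u : X → ℝ} (hu : ContMDiff 𝓘(ℝ, ℂ) 𝓘(ℝ, ℝ) ∞ u) (h0 : ∀ x, u x ≤ 0) {x : X}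
    (hx : u x = 0)
    (hcur : ∀ φ : X → ℝ, ContMDiff 𝓘(ℝ, ℂ) 𝓘(ℝ, ℝ) ∞ φ →
      ∫ x, φ x ∂μ = ∫ x, φ x ∂η.measure + ∫ x, u x * η.ddc φ x ∂η.measure) :
    IsPotentialM η μ (fun x ↦ (u x : EReal)) where
  quasiSubharmonic := quasiSubharmonic_coe hu
  ae_ne_bot := Eventually.of_forall fun x ↦ EReal.coe_ne_bot _
  integrable := by
    simpa using hu.continuous.integrable_of_hasCompactSupport (HasCompactSupport.of_compactSpace u)
  current_eq := by simpa using hcur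
  isGreatest := ⟨⟨x, by simp [hx]⟩, by rintro _ ⟨y, rfl⟩; exact EReal.coe_nonpos.2 (h0 y)⟩

variable [IsManifold 𝓘(ℂ) 1 X]

theorem integral_chartFun_localWeight_mul (a : X) {g : ℂ → ℝ} (hg : Continuous g)
    (ht : Function.support g ⊆ Metric.ball (chartAt ℂ a a) (2 * chartRadius a)) :
    ∫ x, chartFun (chartAt ℂ a) (fun z ↦ localWeight η a z * g z) x ∂η.measure = ∫ z, g z := by
  have hm : Measurable fun z ↦ localWeight η a z * g z :=
    ((contDiff_localWeight η a).continuous.mul hg).measurable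
  rw [integral_chartFun a hm ((Function.support_mul_subset_right _ _).trans ht)]
  congr 1 with z
  by_cases hz : g z = 0
  · simp [hz]
  have hzb := ht hz
  have hpos := η.pos _ (chart_mem_atlas ℂ a) z (ball_subset_target a hzb)
  rw [localWeight, localDensity, chartBump_eq_one hzb]
  field_simp

/-- Green's formula on the surface, for a function supported in a coordinate disc. -/
theorem integral_mul_ddc_chartFun [T2Space X] (a : X) {φ : X → ℝ}
    (hφ : ContMDiff 𝓘(ℝ, ℂ) 𝓘(ℝ, ℝ) ∞ φ) {g : ℂ → ℝ} (hg : ContDiff ℝ ∞ g)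
    (hgc : HasCompactSupport g)
    (ht : tsupport g ⊆ Metric.ball (chartAt ℂ a a) (2 * chartRadius a)) :
    ∫ x, φ x * η.ddc (chartFun (chartAt ℂ a) g) x ∂η.measure =
      ∫ x, chartFun (chartAt ℂ a) g x * η.ddc φ x ∂η.measure := by
  set e := chartAt ℂ a
  have he : e ∈ atlas ℂ X := chart_mem_atlas ℂ a
  have hte : tsupport g ⊆ e.target := ht.trans (ball_subset_target a)
  set ψ : ℂ → ℝ := fun z ↦ chartBump a z * φ (e.symm z) with hψdef
  have hψ : ContDiff ℝ ∞ ψ := contDiff_mul_of_tsupport_subset e.open_target (chartBump a).contDiff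
    (contDiffOn_comp_symm he hφ) (tsupport_chartBump_subset a)
  have hψ1 : ∀ z ∈ Metric.ball (e a) (2 * chartRadius a), ψ z = φ (e.symm z) := fun z hz ↦ by
    simp [hψdef, chartBump_eq_one hz]
  have hΔg : Function.support (Δ g) ⊆ tsupport g :=
    (subset_tsupport _).trans (tsupport_laplacian_subset g)
  have h1 : ∀ x, φ x * η.ddc (chartFun e g) x =
      chartFun e (fun z ↦ localWeight η a z * ((2 * Real.pi)⁻¹ * (ψ z * Δ g z))) x := fun x ↦ by
    by_cases hx : x ∈ e.source
    · rw [η.ddc_chartFun he hx hg, chartFun_of_mem hx]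
      by_cases h0 : Δ g (e x) = 0
      · simp [h0]
      have hz := ht (hΔg h0)
      rw [hψ1 _ hz, e.left_inv hx, localWeight, chartBump_eq_one hz]
      ring
    · have h0 : η.ddc (chartFun e g) x = 0 := by
        refine η.ddc_eq_zero (notMem_tsupport_iff_eventuallyEq.1 fun h ↦ hx ?_)
        obtain ⟨z, hz, rfl⟩ := tsupport_chartFun_subset hgc hte h
        exact e.map_target (hte hz)
      rw [h0, mul_zero, chartFun, indicator_of_notMem hx]
  have h2 : ∀ x, chartFun e g x * η.ddc φ x =
      chartFun e (fun z ↦ localWeight η a z * ((2 * Real.pi)⁻¹ * (g z * Δ ψ z))) x := fun x ↦ by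
    by_cases hx : x ∈ e.source
    · rw [chartFun_of_mem hx, chartFun_of_mem hx]
      by_cases h0 : g (e x) = 0
      · simp [h0]
      have hz := ht (subset_tsupport g h0)
      have hev : (fun z ↦ φ (e.symm z)) =ᶠ[𝓝 (e x)] ψ := by
        filter_upwards [Metric.isOpen_ball.mem_nhds hz] with w hw using (hψ1 w hw).symm
      rw [η.ddc_eq he hx ((contDiff_infty.1 hψ 2).contDiffAt.congr_of_eventuallyEq hev),
        (InnerProductSpace.laplacian_congr_nhds hev).eq_of_nhds, localWeight, chartBump_eq_one hz]
      ring
    · rw [chartFun, chartFun, indicator_of_notMem hx, indicator_of_notMem hx, zero_mul]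
  simp_rw [h1, h2]
  have c1 : Continuous fun z ↦ (2 * Real.pi)⁻¹ * (ψ z * Δ g z) :=
    continuous_const.mul (hψ.continuous.mul hg.contDiff_laplacian.continuous)
  have c2 : Continuous fun z ↦ (2 * Real.pi)⁻¹ * (g z * Δ ψ z) :=
    continuous_const.mul (hg.continuous.mul hψ.contDiff_laplacian.continuous)
  rw [integral_chartFun_localWeight_mul a c1 fun z hz ↦ ht (hΔg fun h ↦ hz (by simp [h])),
    integral_chartFun_localWeight_mul a c2
      fun z hz ↦ ht (subset_tsupport g fun h ↦ hz (by simp [h])),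
    integral_const_mul, integral_const_mul, integral_mul_laplacian hψ hg hgc]
  simp_rw [mul_comm]

/-- A smooth potential `u ≤ 0` supported in a coordinate disc, with `-1 ≤ dd^c u / η ≤ 1`, is the
potential of type M of the probability measure `η + dd^c u`, whose energy is at most three times
the integral of `-u`. -/
theorem exists_mem_energySet_of_chartFun [T2Space X] [CompactSpace X] (hη : η.measure univ = 1)
    (a : X) {g : ℂ → ℝ} (hg : ContDiff ℝ ∞ g) (hgc : HasCompactSupport g)
    (ht : tsupport g ⊆ Metric.ball (chartAt ℂ a a) (2 * chartRadius a)) (hg0 : ∀ z, g z ≤ 0)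
    (hdd : ∀ x, 0 ≤ 1 + η.ddc (chartFun (chartAt ℂ a) g) x ∧
      1 + η.ddc (chartFun (chartAt ℂ a) g) x ≤ 2) {D : Set X} (hD : MeasurableSet D)
    (hDz : ∀ x ∈ D, 1 + η.ddc (chartFun (chartAt ℂ a) g) x = 0) :
    ∃ v ∈ energySet η D,
      v ≤ 3 * ∫⁻ x, ENNReal.ofReal (-chartFun (chartAt ℂ a) g x) ∂η.measure := by
  set e := chartAt ℂ a
  have he : e ∈ atlas ℂ X := chart_mem_atlas ℂ a
  have : IsProbabilityMeasure η.measure := ⟨hη⟩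
  set u := chartFun e g with hu_def
  have hu : ContMDiff 𝓘(ℝ, ℂ) 𝓘(ℝ, ℝ) ∞ u :=
    contMDiff_chartFun he hg hgc (ht.trans (ball_subset_target a))
  have hint {f : X → ℝ} (hf : Continuous f) : Integrable f η.measure :=
    hf.integrable_of_hasCompactSupport (HasCompactSupport.of_compactSpace f)
  have hc := η.continuous_ddc hu
  set h : X → ℝ := fun x ↦ 1 + η.ddc u x with hh
  have hhc : Continuous h := continuous_const.add hc
  have hhm : Measurable fun x ↦ ENNReal.ofReal (h x) := hhc.measurable.ennreal_ofReal
  have hgreen := fun (φ : X → ℝ) hφ ↦ integral_mul_ddc_chartFun (η := η) a (φ := φ) hφ hg hgc ht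
  have hu0 : ∀ x, u x ≤ 0 := fun x ↦ by
    by_cases hx : x ∈ e.source
    · rw [hu_def, chartFun_of_mem hx]
      exact hg0 _
    · rw [hu_def, chartFun, indicator_of_notMem hx]
  have hδ := chartRadius_pos a
  -- The closed disc of radius `4 * chartRadius a` provides a point off the support of `g`.
  obtain ⟨x₁, hx₁⟩ : ∃ x, u x = 0 := by
    have hmem : e a + (3 * chartRadius a : ℝ) ∈ e.target := closedBall_subset_target a (by
      rw [Metric.mem_closedBall, dist_eq_norm, add_sub_cancel_left, Complex.norm_real,
        Real.norm_of_nonneg (by positivity)]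
      linarith)
    refine ⟨e.symm (e a + (3 * chartRadius a : ℝ)), ?_⟩
    rw [hu_def, chartFun_symm hmem]
    refine image_eq_zero_of_notMem_tsupport fun h ↦ ?_
    have := ht h
    rw [Metric.mem_ball, dist_eq_norm, add_sub_cancel_left, Complex.norm_real,
      Real.norm_of_nonneg (by positivity)] at this
    linarith
  set μ := η.measure.withDensity fun x ↦ ENNReal.ofReal (h x) with hμ
  have hcur : ∀ φ : X → ℝ, ContMDiff 𝓘(ℝ, ℂ) 𝓘(ℝ, ℝ) ∞ φ →
      ∫ x, φ x ∂μ = ∫ x, φ x ∂η.measure + ∫ x, u x * η.ddc φ x ∂η.measure := fun φ hφ ↦ by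
    have hi : Integrable (fun x ↦ φ x * η.ddc u x) η.measure := hint (hφ.continuous.mul hc)
    rw [hμ, integral_withDensity_eq_integral_toReal_smul hhm (by simp), ← hgreen φ hφ,
      ← integral_add (hint hφ.continuous) hi]
    congr 1 with x
    rw [ENNReal.toReal_ofReal (hdd x).1, smul_eq_mul]
    ring
  have hprob : IsProbabilityMeasure μ := ⟨by
    rw [hμ, withDensity_apply _ MeasurableSet.univ, Measure.restrict_univ,
      ← ofReal_integral_eq_lintegral_ofReal (hint hhc) (Eventually.of_forall fun x ↦ (hdd x).1),
      hh, integral_add (integrable_const _) (hint hc)]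
    have h1 := hgreen (fun _ ↦ 1) contMDiff_const
    simp only [one_mul, η.ddc_const, mul_zero, integral_zero] at h1
    rw [← hu_def] at h1
    simp [h1]⟩
  have hμD : μ D = 0 := by
    rw [hμ, withDensity_apply _ hD]
    refine (setLIntegral_congr_fun (g := fun _ ↦ 0) hD fun x hx ↦ ?_).trans (by simp)
    simp [hh, hDz x hx]
  refine ⟨_, ⟨μ, ⟨hprob, hμD⟩, _, isPotentialM_coe hu hu0 hx₁ hcur, rfl⟩, ?_⟩
  have hneg : ∀ x, (-(u x : EReal)).toENNReal = ENNReal.ofReal (-u x) := fun x ↦ by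
    rw [← EReal.coe_neg, EReal.toENNReal_of_ne_top (EReal.coe_ne_top _), EReal.toReal_coe]
  have hum : Measurable fun x ↦ ENNReal.ofReal (-u x) :=
    hu.continuous.neg.measurable.ennreal_ofReal
  simp only [potentialEnergy, hneg]
  have h2 : ∫⁻ x, ENNReal.ofReal (-u x) ∂μ ≤ 2 * ∫⁻ x, ENNReal.ofReal (-u x) ∂η.measure := by
    rw [hμ, lintegral_withDensity_eq_lintegral_mul _ hhm hum, ← lintegral_const_mul _ hum]
    refine lintegral_mono fun x ↦ ?_
    have h3 : ENNReal.ofReal (h x) ≤ 2 := (ENNReal.ofReal_le_ofReal (hdd x).2).trans (by simp)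
    exact mul_le_mul' h3 le_rfl
  refine (add_le_add_right h2 _).trans (le_of_eq ?_)
  ring

/-- The planar balayage function at scale `r` empties a disc of radius `r` at an energy of order
`r ^ 4`: the potential is of order `r ^ 2` on a disc of area of order `r ^ 2`. -/
theorem exists_mem_energySet_le [T2Space X] [CompactSpace X] (hη : η.measure univ = 1) (x₀ : X) :
    ∃ C r₀ : ℝ, 0 < C ∧ 0 < r₀ ∧ ∀ r, 0 < r → r < r₀ → ∀ D : Set X,
      (∀ y ∈ D, y ∈ (chartAt ℂ x₀).source ∧ dist (chartAt ℂ x₀ y) (chartAt ℂ x₀ x₀) < r) →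
        ∃ v ∈ energySet η D, v ≤ ENNReal.ofReal (C * r ^ 4) := by
  obtain ⟨a, R, ha, hR, hRδ, hdens⟩ := exists_density_bounds η x₀
  obtain ⟨ε, B, hε, hε1, hB, hbal⟩ := exists_planar_balayage ha
  set e := chartAt ℂ x₀
  set z₀ := e x₀
  have he : e ∈ atlas ℂ X := chart_mem_atlas ℂ x₀
  have hRt : Metric.closedBall z₀ R ⊆ e.target := closedBall_subset_target_of_lt hRδ
  have hpi := Real.pi_pos
  refine ⟨24 * a * Real.pi * (B + 1) / ε ^ 4, ε * R / 2, by positivity, by positivity,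
    fun r hr hrR D hD ↦ ?_⟩
  -- The planar function has a hole of radius `ε`, so that the scale is `r / ε`.
  obtain ⟨ρ, hρdef⟩ : ∃ ρ, ρ = r / ε := ⟨_, rfl⟩
  have hρ : 0 < ρ := by rw [hρdef]; positivity
  have hrρ : r = ε * ρ := by rw [hρdef]; field_simp
  have hρR : 2 * ρ ≤ R := by
    rw [hρdef, ← mul_div_assoc, div_le_iff₀ hε]
    linarith
  have hρC : (ρ : ℂ) ≠ 0 := by exact_mod_cast hρ.ne'
  have hin : ∀ w ∈ Metric.closedBall (0 : ℂ) 2, z₀ + ρ * w ∈ Metric.closedBall z₀ R :=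
    fun w hw ↦ by
      rw [mem_closedBall_zero_iff] at hw
      rw [Metric.mem_closedBall, dist_eq_norm, add_sub_cancel_left, norm_mul, Complex.norm_real,
        Real.norm_of_nonneg hρ.le]
      nlinarith
  have hF : ∀ w ∈ Metric.closedBall (0 : ℂ) 2,
      localDensity η x₀ (z₀ + ρ * w) = η.density e (z₀ + ρ * w) := fun w hw ↦ by
    rw [localDensity, chartBump_eq_one (Metric.closedBall_subset_ball hRδ (hin w hw)), one_mul]
  obtain ⟨W, hW, hWc, hWt, hWb, hWΔ, hW0⟩ := hbal (fun w ↦ localDensity η x₀ (z₀ + ρ * w))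
    ((contDiff_localDensity η x₀).comp (contDiff_const.add (contDiff_const.mul contDiff_id)))
    fun w hw ↦ by rw [hF w hw]; exact hdens _ (hin w hw)
  set T : ℂ → ℂ := fun z ↦ -(ρ : ℂ)⁻¹ * z₀ + (ρ : ℂ)⁻¹ * z with hT
  have hTn : ∀ z, ‖T z‖ = dist z z₀ / ρ := fun z ↦ by
    simp only [hT]
    rw [show -(ρ : ℂ)⁻¹ * z₀ + (ρ : ℂ)⁻¹ * z = (ρ : ℂ)⁻¹ * (z - z₀) by ring, norm_mul, norm_inv,
      Complex.norm_real, Real.norm_of_nonneg hρ.le, dist_eq_norm, div_eq_inv_mul]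
  have hTinv : ∀ z, z₀ + ρ * T z = z := fun z ↦ by
    simp only [hT]
    field_simp
    ring
  have hWT : ContDiff ℝ ∞ fun z ↦ W (T z) :=
    hW.comp (contDiff_const.add (contDiff_const.mul contDiff_id))
  set g : ℂ → ℝ := (ρ ^ 2) • fun z ↦ W (T z) with hg_def
  have hg : ContDiff ℝ ∞ g := contDiff_const.smul hWT
  have hgΔ : ∀ z, Δ g z = Δ W (T z) := fun z ↦ by
    rw [hg_def, InnerProductSpace.laplacian_smul _ (contDiff_infty.1 hWT 2).contDiffAt,
      laplacian_comp_add_mul hW, norm_inv, Complex.norm_real, Real.norm_of_nonneg hρ.le,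
      smul_eq_mul, ← mul_assoc, ← mul_pow, mul_inv_cancel₀ hρ.ne', one_pow, one_mul]
  have hgs : Function.support g ⊆ Metric.closedBall z₀ (2 * ρ) := fun z hz ↦ by
    have h1 : T z ∈ Metric.closedBall (0 : ℂ) 2 :=
      hWt (subset_tsupport W fun h ↦ hz (by simp [hg_def, h]))
    rwa [mem_closedBall_zero_iff, hTn, div_le_iff₀ hρ] at h1
  have hgt : tsupport g ⊆ Metric.closedBall z₀ (2 * ρ) :=
    closure_minimal hgs Metric.isClosed_closedBall
  have hgR := hgt.trans (Metric.closedBall_subset_closedBall hρR)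
  have hgc : HasCompactSupport g :=
    (isCompact_closedBall z₀ (2 * ρ)).of_isClosed_subset (isClosed_tsupport _) hgt
  have hgB : ∀ z, g z ≤ 0 ∧ -g z ≤ ρ ^ 2 * B := fun z ↦ by
    have h1 : g z = ρ ^ 2 * W (T z) := rfl
    have h2 := hWb (T z)
    rw [h1]
    exact ⟨mul_nonpos_of_nonneg_of_nonpos (by positivity) h2.2, by nlinarith [sq_nonneg ρ]⟩
  have hdz : ∀ x ∈ e.source, T (e x) ∈ Metric.closedBall (0 : ℂ) 2 →
      0 < η.density e (e x) ∧ 1 + η.ddc (chartFun e g) x = (2 * Real.pi *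
        localDensity η x₀ (z₀ + ρ * T (e x)) + Δ W (T (e x))) / (2 * Real.pi * η.density e (e x)) :=
    fun x hx hTx ↦ by
      have hd := η.pos e he _ (e.map_source hx)
      refine ⟨hd, ?_⟩
      rw [η.ddc_chartFun he hx hg, hF _ hTx, hTinv, hgΔ]
      field_simp
  have hdd : ∀ x, 0 ≤ 1 + η.ddc (chartFun e g) x ∧ 1 + η.ddc (chartFun e g) x ≤ 2 := fun x ↦ by
    by_cases hx : x ∈ tsupport (chartFun e g)
    · obtain ⟨z, hz, rfl⟩ := tsupport_chartFun_subset hgc (hgR.trans hRt) hx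
      have hzt := hRt (hgR hz)
      have hTz : T (e (e.symm z)) ∈ Metric.closedBall (0 : ℂ) 2 := by
        rw [e.right_inv hzt, mem_closedBall_zero_iff, hTn, div_le_iff₀ hρ]
        exact hgt hz
      obtain ⟨hd, heq⟩ := hdz _ (e.map_target hzt) hTz
      have hW2 := hWΔ _ hTz
      rw [heq, div_le_iff₀ (by positivity)]
      refine ⟨div_nonneg hW2.1 (by positivity), hW2.2.trans (le_of_eq ?_)⟩
      rw [hF _ hTz, hTinv]
      ring
    · rw [η.ddc_eq_zero (notMem_tsupport_iff_eventuallyEq.1 hx)]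
      norm_num
  have hD' : MeasurableSet (e.source ∩ e ⁻¹' Metric.ball z₀ r) :=
    e.measurableSet_source_inter Metric.isOpen_ball.measurableSet
  obtain ⟨v, ⟨μ, ⟨hμ, hμD⟩, hv⟩, hvle⟩ := exists_mem_energySet_of_chartFun hη x₀ hg hgc
    (hgR.trans (Metric.closedBall_subset_ball hRδ)) (fun z ↦ (hgB z).1) hdd hD' fun x hx ↦ by
      have h1 : ‖T (e x)‖ < ε := by
        rw [hTn, div_lt_iff₀ hρ, ← hrρ]
        exact hx.2
      have h2 := hW0 (T (e x)) (mem_ball_zero_iff.2 h1)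
      rw [(hdz x hx.1 (mem_closedBall_zero_iff.2 (by linarith))).2, h2, add_neg_cancel, zero_div]
  refine ⟨v, ⟨μ, ⟨hμ, measure_mono_null (fun y hy ↦ hD y hy) hμD⟩, hv⟩, hvle.trans ?_⟩
  set S := e.source ∩ e ⁻¹' Metric.closedBall z₀ (2 * ρ)
  have hBm : MeasurableSet (Metric.closedBall z₀ (2 * ρ)) :=
    Metric.isClosed_closedBall.measurableSet
  have hBR : Metric.closedBall z₀ (2 * ρ) ⊆ Metric.closedBall z₀ R :=
    Metric.closedBall_subset_closedBall hρR
  have hS : MeasurableSet S := e.measurableSet_source_inter hBm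
  have hηS : η.measure S ≤ ENNReal.ofReal (2 * a * (Real.pi * (2 * ρ) ^ 2)) := by
    rw [measure_source_inter_preimage η he hBm (hBR.trans hRt)]
    refine (setLIntegral_mono' (g := fun _ ↦ ENNReal.ofReal (2 * a)) hBm
        fun z hz ↦ ENNReal.ofReal_le_ofReal (hdens z (hBR hz)).2).trans (le_of_eq ?_)
    rw [setLIntegral_const, Complex.volume_closedBall,
      ENNReal.ofReal_mul (p := 2 * a) (by positivity),
      ENNReal.ofReal_mul hpi.le, ENNReal.ofReal_pow (by positivity),
      mul_comm (ENNReal.ofReal Real.pi)]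
    congr 2
    rw [← NNReal.coe_real_pi, ENNReal.ofReal_coe_nnreal]
  have hint : ∫⁻ x, ENNReal.ofReal (-chartFun e g x) ∂η.measure ≤
      ENNReal.ofReal (ρ ^ 2 * B) * η.measure S := by
    rw [← lintegral_indicator_const hS]
    refine lintegral_mono fun x ↦ ?_
    by_cases hxS : x ∈ S
    · rw [indicator_of_mem hxS, chartFun_of_mem hxS.1]
      exact ENNReal.ofReal_le_ofReal (hgB _).2
    · have : chartFun e g x = 0 := by
        by_cases hx : x ∈ e.source
        · rw [chartFun_of_mem hx]
          by_contra h
          exact hxS ⟨hx, hgs h⟩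
        · exact indicator_of_notMem hx _
      simp [this]
  calc 3 * ∫⁻ x, ENNReal.ofReal (-chartFun e g x) ∂η.measure
      ≤ ENNReal.ofReal 3 * (ENNReal.ofReal (ρ ^ 2 * B) *
          ENNReal.ofReal (2 * a * (Real.pi * (2 * ρ) ^ 2))) := by
        rw [ENNReal.ofReal_ofNat]
        gcongr
        exact hint.trans (by gcongr)
    -- The factor `24` is `3 * 2 * 2 ^ 2`.
    _ = ENNReal.ofReal (24 * a * Real.pi * B * ρ ^ 4) := by
        rw [← ENNReal.ofReal_mul (by positivity), ← ENNReal.ofReal_mul (by positivity)]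
        congr 1
        ring
    _ ≤ ENNReal.ofReal (24 * a * Real.pi * (B + 1) / ε ^ 4 * r ^ 4) := by
        refine ENNReal.ofReal_le_ofReal ?_
        rw [hrρ, mul_pow, ← mul_assoc, div_mul_cancel₀ _ (by positivity)]
        gcongr
        linarith

end UpperBound

/-! ### The minimum of the functional -/

theorem mainTheorem3 {X : Type*} [TopologicalSpace X] [T2Space X] [CompactSpace X]
    [ConnectedSpace X] [ChartedSpace ℂ X] [IsManifold 𝓘(ℂ) 1 X]
    [MeasurableSpace X] [BorelSpace X]
    (η₀ η : KahlerForm X) (hη : η.measure univ = 1) (x₀ : X) :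
    ∃ c C : ℝ, 0 < c ∧ c < C ∧ ∀ᶠ r in 𝓝[>] (0 : ℝ), ∃ m : ℝ,
      IsLeast (holeFunctional η '' measuresOff (η₀.ball x₀ r)) (m : EReal) ∧
        c * r ^ 4 ≤ m ∧ m ≤ C * r ^ 4 := by
  obtain ⟨k, K, hk, hK, hball⟩ := exists_geodesicBall_comparison η₀ x₀
  obtain ⟨c, s₀, hc, hs₀, hlow⟩ := exists_le_of_mem_energySet η hη x₀
  obtain ⟨C, r₀, hC, hr₀, hup⟩ := exists_mem_energySet_le (η := η) hη x₀
  -- The summand `c * k ^ 4` of the upper constant only serves to make it larger than the lower one.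
  refine ⟨c * k ^ 4, C * K ^ 4 + c * k ^ 4, by positivity, lt_add_of_pos_left _ (by positivity), ?_⟩
  have hpos : 0 < min (s₀ / k) (r₀ / K) := by positivity
  filter_upwards [hball, Ioo_mem_nhdsGT hpos] with r ⟨hin, hout⟩ ⟨hr, hr'⟩
  have hks : k * r < s₀ := by
    have := hr'.trans_le (min_le_left _ _)
    rwa [lt_div_iff₀ hk, mul_comm] at this
  have hKr : K * r < r₀ := by
    have := hr'.trans_le (min_le_right _ _)
    rwa [lt_div_iff₀ hK, mul_comm] at this
  obtain ⟨w, hw, hwle⟩ := hup (K * r) (by positivity) hKr _ hout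
  have hwtop : w ≠ ⊤ := ne_top_of_le_ne_top ENNReal.ofReal_ne_top hwle
  obtain ⟨v, hv⟩ := exists_isLeast_energySet (isOpen_geodesicBall η₀ x₀ r) ⟨w, hw, hwtop⟩
  have hvw : v ≤ w := hv.2 hw
  have hvtop : v ≠ ⊤ := ne_top_of_le_ne_top hwtop hvw
  refine ⟨v.toReal, ?_, ?_, ?_⟩
  · have h := isLeast_holeFunctional hv
    rwa [← EReal.coe_ennreal_toReal hvtop] at h
  · have h := hlow (k * r) (by positivity) hks _ hin v hv.1
    rw [ENNReal.ofReal_le_iff_le_toReal hvtop] at h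
    linarith
  · have h := ENNReal.toReal_le_of_le_ofReal (by positivity) (hvw.trans hwle)
    have : 0 ≤ c * k ^ 4 * r ^ 4 := by positivity
    linarith
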